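/- Let $j\ge 1$ be an odd integer and $a,b,\alpha\in\mathbb R$. Write $(x)_k=x(x+1)\cdots(x+k-1)$ and $(x_1,\dots,x_r)_k=(x_1)_k\cdots(x_r)_k$. **General complementary Bannai–Ito (CBI) polynomials.** $\mathbf I_n(x;\rho_1,\rho_2,r_1,r_2)$ denotes the monic polynomials for which $\mathbf I_{2n}$ is proportional to $${}_4F_3\!\left({-n,\;n+\rho_1+\rho_2-r_1-r_2+1,\;\rho_2+x,\;\rho_2-x\atop \rho_1+\rho_2+1,\;\rho_2-r_1+\tfrac12,\;\rho_2-r_2+\tfrac12};1\right)$$ and $\mathbf I_{2n+1}(x;\rho_1,\rho_2,r_1,r_2)=(x-\rho_2)\,\mathbf I_{2n}(x;\rho_1,\rho_2+1,r_1,r_2)$. With $g=\rho_1+\rho_2-r_1-r_2$ their recurrence coefficients are $$A_n=-\tfrac{(n+2\rho_2-2r_2+1)(n+2\rho_2-2r_1+1)}{4(n+g+1)},\quad C_n=\tfrac{(n+2\rho_1-2r_1+1)(n+2\rho_1-2r_2+1)}{4(n+g+1)}\quad(n\text{ even}),$$ $$A_n=-\tfrac{(n+1)(n-2r_1-2r_2+1)}{4(n+g+1)},\quad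 C_n=\tfrac{(n+2g+1)(n+2\rho_1+2\rho_2+1)}{4(n+g+1)}\quad(n\text{ odd}).$$ **Para-Bannai–Ito polynomials.** Put $\rho_1=\frac{b-j-1+a}4$, $-r_1=\frac{b-j-1-a}4$, and $$A_n^2=\begin{cases}-\frac14\frac{(n-j-a)(n-j-b)}{n-j}& n\text{ even}\\ -\frac14(n+1)& n\text{ odd},\,n\ne j\\ -\frac12(1-\alpha)(j+1)& n=j\end{cases}\qquad C_n^2=\begin{cases}\frac14\frac{(n-j+a)(n-j+b)}{n-j}& n\text{ even}\\ \frac14(n-2j-1)& n\text{ odd},\,n\ne j\\ -\frac12\alpha(j+1)& n=j.\end{cases}$$ Let $u_n=A^2_{n-1}C^2_n$ for $n\ge1$, and let $P_n=\mathbf P^{(2)}_n$ be the monic polynomials of degree $n$ with $P_0=1$ and $$xP_n=P_{n+1}+(\rho_1-A^2_n-C^2_n)P_n+u_nP_{n-1}\qquad(u_0:=0).$$ Let (S) be the condition "$a<-j$ and $|b|<1$, or $|a|<1$ and $b<-j$", and ($\overline{\mathrm S}$) the condition "$a\le-j$ and $|b|\le1$, or $|a|\le1$ and $b\le-j$". Then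 the following hold. 1. **Truncation.** Let $e_1+e_2\ne0$, $e_1/(e_1+e_2)=\alpha$, and let $\rho_2,r_2$ depend on $t$ through $\rho_1+\rho_2=-\frac{j+1}2+e_1t$, $-r_1-r_2=-\frac{j+1}2+e_2t$. As $t\to0$, $t\neq 0$, the CBI coefficients satisfy $A_n\to A_n^2$, $C_n\to C_n^2$ for all $n\ge 0$, and, if $\alpha\ne0$, $\mathbf I_n(x;\rho_1,\rho_2,r_1,r_2)\to P_n(x)$ for all real $x$ and $0\le n\le 2j$. Moreover $u_{2j+1}=0$. 2. **Positivity.** If ($\overline{\mathrm S}$) and $0\le\alpha\le1$, then $u_n\ge0$ for $1\le n\le2j$. If (S) and $0<\alpha<1$, then $u_n>0$ for $1\le n\le2j$. Conversely, if $j\ge3$ and $u_n>0$ for $1\le n\le 2j$, then (S) and $0<\alpha<1$. 3. **Dunkl-difference equation.** Let $T^{\pm}f(x)=f(x\pm1)$, $Rf(x)=f(-x)$, and, for $\beta\in\mathbb R$, $$\mathcal D_\beta=A(x)T^++B(x)T^-+C(x)R+D(x)T^+R-(A(x)+B(x)+C(x)+D(x))I+\beta\tfrac{4x+b+a+j+1}{8x}(I-R),$$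 $$A(x)=\tfrac{(x+\rho_1+1)(x-\rho_1+\frac{1-j}2)(2x-2r_1+1)(2x+2r_1-j)}{8(x+1)(2x+1)},\quad B(x)=\tfrac{(x+\rho_1+\frac{j+1}2)(x-\rho_1-1)(2x+2r_1-1)(2x-2r_1+j)}{8x(2x-1)},$$ $$C(x)=\tfrac{(x+\rho_1+\frac{j+1}2)(4x^2+\omega)}{8x}-\tfrac{(x+\rho_1+\frac{j+1}2)(x+\rho_1+1)(2x-2r_1+1)(2x+2r_1-j)}{8x(2x+1)}-B(x),$$ $$D(x)=-\tfrac{(2\rho_1+j+1)(x+\rho_1+1)(2x-2r_1+1)(2x+2r_1-j)}{16x(x+1)(2x+1)},\quad \omega=4(1+\rho_1-r_1)\tfrac{1-j}2+4r_1(1-r_1)-j.$$ For $0\le n\le2j$ and real $x\notin\{0,-1,\pm\frac12\}$, $\mathcal D_\beta P_n(x)=\Lambda_n^{(\beta)}P_n(x)$, where $\Lambda^{(\beta)}_{2m}=m(m-j)$ and $\Lambda^{(\beta)}_{2m+1}=m(m+1-j)+\beta$. 4. **Explicit expression.** Let $\alpha\ne0$ and $a,b\notin\{2i-j:0\le i<j\}$.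 Put $q=-\frac{b+j+1+a}4$. For $0\le n\le j$, $P_{2n}(x)=\kappa^{(1)}_n\sum_{k=0}^nA_{n,k}$ with $$A_{n,k}=\begin{cases}\dfrac{(-n,\,n-j,\,q+x,\,q-x)_k}{(1,\,-\frac{b+j}2,\,-\frac{j+a}2,\,\frac{1-j}2)_k}&k\le\frac{j-1}2\\[3mm] \dfrac1\alpha\dfrac{(-n,\,q+x,\,q-x)_k}{(1,\,-\frac{b+j}2,\,-\frac{j+a}2)_k}\dfrac{(n-j)_{j-n}(1)_{n+k-j-1}}{(\frac{1-j}2)_{(j-1)/2}(1)_{k-(j+1)/2}}&k>\frac{j-1}2,\end{cases}$$ $$\kappa_n^{(1)}=\begin{cases}\dfrac{(-\frac{b+j}2,\,-\frac{j+a}2,\,\frac{1-j}2)_n}{(n-j)_n}&n\le\frac{j-1}2\\[3mm] \alpha\dfrac{(-\frac{b+j}2,\,-\frac{j+a}2)_n(\frac{1-j}2)_{(j-1)/2}(1)_{n-(j+1)/2}}{(n-j)_{j-n}(1)_{2n-j-1}}&n>\frac{j-1}2.\end{cases}$$ For $0\le n\le j-1$, $n\ne\frac{j-1}2$, $P_{2n+1}(x)=\kappa^{(2)}_n\bigl(x+\frac{b+j+1+a}4\bigr)\sum_{k=0}^nB_{n,k}$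 with $$B_{n,k}=\begin{cases}\dfrac{(-n,\,n+1-j,\,q+1+x,\,q+1-x)_k}{(1,\,\frac{3-j}2,\,\frac{2-j-a}2,\,\frac{2-j-b}2)_k}&k<\frac{j-1}2\\[3mm] \dfrac1\alpha\dfrac{(-n,\,q+1+x,\,q+1-x)_k}{(1,\,\frac{2-j-a}2,\,\frac{2-j-b}2)_k}\dfrac{(n+1-j)_{j-n-1}(1)_{n+k-j}}{(\frac{3-j}2)_{(j-3)/2}(1)_{k-(j-1)/2}}&k\ge\frac{j-1}2,\end{cases}$$ $$\kappa_n^{(2)}=\begin{cases}\dfrac{(\frac{2-j-a}2,\,\frac{2-j-b}2,\,\frac{3-j}2)_n}{(n+1-j)_n}&n<\frac{j-1}2\\[3mm] \alpha\dfrac{(\frac{2-j-a}2,\,\frac{2-j-b}2)_n(\frac{3-j}2)_{(j-3)/2}(1)_{n-(j-1)/2}}{(n+1-j)_{j-n-1}(1)_{2n-j}}&n>\frac{j-1}2.\end{cases}$$ In the remaining odd case, for all real $a,b,\alpha$, $$P_j(x)=(-1)^{(j-1)/2}\bigl(x+\tfrac{b+j+1+a}4\bigr)(q+1+x)_{(j-1)/2}(q+1-x)_{(j-1)/2}.$$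 5. **Orthogonality.** Let (S) hold and $0\le\alpha\le1$. Define the Bannai–Ito bi-lattice $x_0,\dots,x_{2j}$ by $$x_{4s}=-\tfrac{4s-j+a-b}4-\tfrac14,\quad x_{4s+1}=\tfrac{4s-j-a-b}4-\tfrac14,\quad x_{4s+2}=\tfrac{4s+2-j+a-b}4-\tfrac14\qquad(0\le s\le\tfrac{j-1}2),$$ $$x_{4s+3}=-\tfrac{4s+2-j-a-b}4-\tfrac14\qquad(0\le s\le\tfrac{j-3}2),$$ and, for $0\le n\le 2j$, $h_n=h_n(\alpha)$ by $$h_{2n}=\frac1{2^{2n}}\sqrt{\frac{(-j,\,1,\,\frac{2+a-j}2,\,-\frac{j+a}2,\,\frac{2+b-j}2,\,-\frac{j+b}2)_n}{(\frac{2-j}2,\,-\frac j2)_n}}\times\begin{cases}1&n\le\frac{j-1}2\\2\sqrt{\alpha(1-\alpha)}&n>\frac{j-1}2,\end{cases}$$ $$h_{2n+1}=\frac1{2^{2n+1}}\sqrt{\frac{-(-j)_{n+1}(1)_n(\frac{2+a-j}2)_n(-\frac{j+a}2)_{n+1}(\frac{2+b-j}2)_n(-\frac{j+b}2)_{n+1}}{(\frac{2-j}2)_n(-\frac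 j2)_{n+1}}}\times\begin{cases}1&n<\frac{j-1}2\\\sqrt{2\alpha}&n=\frac{j-1}2\\2\sqrt{\alpha(1-\alpha)}&n>\frac{j-1}2.\end{cases}$$ Let $\tilde h=h_{2j}(\tfrac12)$ and define the weights $$w_{4s}=\frac{2\alpha\tilde h}{(-s)_s(1)_{\frac{j-1}2-s}(-s+\frac{1-a}2)_{\frac{j-1}2}(s+\frac{1+a-b-j}2)_{\frac{j+1}2}(s-\frac{b+j}2)_{\frac{j+1}2}},$$ $$w_{4s+1}=\frac{2(1-\alpha)\tilde h}{(-s)_s(1)_{\frac{j-1}2-s}(-s+\frac{1+a}2)_{\frac{j+1}2}(s+\frac{1-a-b-j}2)_{\frac{j-1}2}(s-\frac{b+j}2)_{\frac{j+1}2}},$$ $$w_{4s+2}=\frac{-2\alpha\tilde h}{(-s)_s(1)_{\frac{j-1}2-s}(-s-\frac{1+a}2)_{\frac{j+1}2}(s+\frac{1+a-b-j}2)_{\frac{j+1}2}(s+\frac{2-b-j}2)_{\frac{j-1}2}},$$ $$w_{4s+3}=\frac{-2(1-\alpha)\tilde h}{(-s)_s(1)_{\frac{j-3}2-s}(-s-\frac{1-a}2)_{\frac{j+1}2}(s+\frac{1-a-b-j}2)_{\frac{j+1}2}(s+\frac{2-b-j}2)_{\frac{j+1}2}}.$$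 Then $h_n=\sqrt{u_1\cdots u_n}$ for $0\le n\le2j$, and $$\sum_{s=0}^{2j}w_s\,P_n(x_s)\,P_m(x_s)=h_n^2\,\delta_{nm}\qquad(0\le n,m\le2j).$$ -/

import Mathlib

open Polynomial Filter Topology

noncomputable section

namespace ParaBI

/-- The Pochhammer symbol `(x)_k = x (x + 1) ⋯ (x + k - 1)`. -/
def poch (x : ℝ) (k : ℕ) : ℝ := (ascPochhammer ℝ k).eval x

/-! ### The general complementary Bannai-Ito polynomials -/

/-- The Wilson polynomial
`₄F₃(-n, n+a+b+c+d-1, a-iy, a+iy; a+b, a+c, a+d; 1)` at `y = i x`, as a polynomial in `x`.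
Here `(a-iy)_k (a+iy)_k = ∏_{m<k} ((a+m)² + y²) = ∏_{m<k} ((a+m)² - x²)`. -/
def wilsonAtIX (n : ℕ) (a b c d : ℝ) : ℝ[X] :=
  ∑ k ∈ Finset.range (n + 1),
    C (poch (-(n : ℝ)) k * poch (n + a + b + c + d - 1) k /
        (poch 1 k * (poch (a + b) k * poch (a + c) k * poch (a + d) k))) *
      ∏ m ∈ Finset.range k, (C ((a + m) ^ 2) - X ^ 2)

/-- The even polynomial `I_{2n}(x; ρ₁, ρ₂, r₁, r₂)`: the Wilson polynomial above, made monic. -/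
def cbiEven (n : ℕ) (ρ₁ ρ₂ r₁ r₂ : ℝ) : ℝ[X] :=
  let W := wilsonAtIX n ρ₂ (ρ₁ + 1) (-r₁ + 1 / 2) (-r₂ + 1 / 2)
  C W.leadingCoeff⁻¹ * W

/-- The monic general complementary Bannai-Ito polynomial `I_n(x; ρ₁, ρ₂, r₁, r₂)`. -/
def cbi (n : ℕ) (ρ₁ ρ₂ r₁ r₂ : ℝ) : ℝ[X] :=
  if Even n then cbiEven (n / 2) ρ₁ ρ₂ r₁ r₂
  else (X - C ρ₂) * cbiEven (n / 2) ρ₁ (ρ₂ + 1) r₁ r₂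

/-- The recurrence coefficient `A_n` of the complementary Bannai-Ito polynomials. -/
def cbiA (n : ℕ) (ρ₁ ρ₂ r₁ r₂ : ℝ) : ℝ :=
  let g := ρ₁ + ρ₂ - r₁ - r₂
  if Even n then -((n + 2 * ρ₂ - 2 * r₂ + 1) * (n + 2 * ρ₂ - 2 * r₁ + 1) / (4 * (n + g + 1)))
  else -((n + 1) * (n - 2 * r₁ - 2 * r₂ + 1) / (4 * (n + g + 1)))

/-- The recurrence coefficient `C_n` of the complementary Bannai-Ito polynomials. -/
def cbiC (n : ℕ) (ρ₁ ρ₂ r₁ r₂ : ℝ) : ℝ :=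
  let g := ρ₁ + ρ₂ - r₁ - r₂
  if Even n then (n + 2 * ρ₁ - 2 * r₁ + 1) * (n + 2 * ρ₁ - 2 * r₂ + 1) / (4 * (n + g + 1))
  else (n + 2 * g + 1) * (n + 2 * ρ₁ + 2 * ρ₂ + 1) / (4 * (n + g + 1))

/-! ### The parametrization -/

/-- `ρ₁ = (b - j - 1 + a) / 4`. -/
def rho1 (j : ℕ) (a b : ℝ) : ℝ := (b - j - 1 + a) / 4

/-- `r₁`, where `-r₁ = (b - j - 1 - a) / 4`. -/
def r1 (j : ℕ) (a b : ℝ) : ℝ := -((b - j - 1 - a) / 4)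

/-- `ρ₂`, determined by `ρ₁ + ρ₂ = -(j + 1) / 2 + e₁ t`. -/
def rho2 (j : ℕ) (a b e₁ t : ℝ) : ℝ := -((j : ℝ) + 1) / 2 + e₁ * t - rho1 j a b

/-- `r₂`, determined by `-r₁ - r₂ = -(j + 1) / 2 + e₂ t`. -/
def r2 (j : ℕ) (a b e₂ t : ℝ) : ℝ := -(-((j : ℝ) + 1) / 2 + e₂ * t) - r1 j a b

/-! ### The para-Bannai-Ito polynomials for `N = 2j`, `j` odd -/

/-- The recurrence coefficient `A_n`. -/
def coefA (j : ℕ) (a b α : ℝ) (n : ℕ) : ℝ :=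
  if Even n then -(1 / 4) * ((n - j - a) * (n - j - b) / (n - j))
  else if n = j then -(1 / 2) * (1 - α) * (j + 1)
  else -(1 / 4) * (n + 1)

/-- The recurrence coefficient `C_n`. -/
def coefC (j : ℕ) (a b α : ℝ) (n : ℕ) : ℝ :=
  if Even n then (1 / 4) * ((n - j + a) * (n - j + b) / (n - j))
  else if n = j then -(1 / 2) * α * (j + 1)
  else (1 / 4) * (n - 2 * j - 1)

/-- `u_n = A_{n-1} C_n` (used for `n ≥ 1`). -/
def coefU (j : ℕ) (a b α : ℝ) (n : ℕ) : ℝ := coefA j a b α (n - 1) * coefC j a b α n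

/-- The monic polynomials `P_n` generated by the three-term recurrence relation
`x P_n = P_{n+1} + (ρ₁ - A_n - C_n) P_n + A_{n-1} C_n P_{n-1}`. -/
def paraBI (j : ℕ) (a b α : ℝ) : ℕ → ℝ[X]
  | 0 => 1
  | 1 => X - C (rho1 j a b - coefA j a b α 0 - coefC j a b α 0)
  | n + 2 =>
      (X - C (rho1 j a b - coefA j a b α (n + 1) - coefC j a b α (n + 1))) *
          paraBI j a b α (n + 1) -
        C (coefA j a b α n * coefC j a b α (n + 1)) * paraBI j a b α n

/-! ### The Dunkl-difference operator -/

def dunklOmega (j : ℕ) (a b : ℝ) : ℝ :=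
  let ρ := rho1 j a b
  let r := r1 j a b
  4 * (1 + ρ - r) * ((1 - (j : ℝ)) / 2) + 4 * r * (1 - r) - j

def dunklA (j : ℕ) (a b x : ℝ) : ℝ :=
  let ρ := rho1 j a b
  let r := r1 j a b
  (x + ρ + 1) * (x - ρ + (1 - (j : ℝ)) / 2) * (2 * x - 2 * r + 1) * (2 * x + 2 * r - j) /
    (8 * (x + 1) * (2 * x + 1))

def dunklB (j : ℕ) (a b x : ℝ) : ℝ :=
  let ρ := rho1 j a b
  let r := r1 j a b
  (x + ρ + ((j : ℝ) + 1) / 2) * (x - ρ - 1) * (2 * x + 2 * r - 1) * (2 * x - 2 * r + j) /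
    (8 * x * (2 * x - 1))

def dunklC (j : ℕ) (a b x : ℝ) : ℝ :=
  let ρ := rho1 j a b
  let r := r1 j a b
  (x + ρ + ((j : ℝ) + 1) / 2) * (4 * x ^ 2 + dunklOmega j a b) / (8 * x) -
    (x + ρ + ((j : ℝ) + 1) / 2) * (x + ρ + 1) * (2 * x - 2 * r + 1) * (2 * x + 2 * r - j) /
      (8 * x * (2 * x + 1)) -
    dunklB j a b x

def dunklD (j : ℕ) (a b x : ℝ) : ℝ :=
  let ρ := rho1 j a b
  let r := r1 j a b
  (-(2 * ρ + j + 1)) * (x + ρ + 1) * (2 * x - 2 * r + 1) * (2 * x + 2 * r - j) /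
    (16 * x * (x + 1) * (2 * x + 1))

/-- `T⁺ f (x) = f (x + 1)`. -/
def shiftUp (f : ℝ → ℝ) : ℝ → ℝ := fun x => f (x + 1)

/-- `T⁻ f (x) = f (x - 1)`. -/
def shiftDown (f : ℝ → ℝ) : ℝ → ℝ := fun x => f (x - 1)

/-- `R f (x) = f (-x)`. -/
def refl (f : ℝ → ℝ) : ℝ → ℝ := fun x => f (-x)

/-- `D₀ = A T⁺ + B T⁻ + C R + D T⁺R - (A + B + C + D) I`. -/
def dunklZero (j : ℕ) (a b : ℝ) (f : ℝ → ℝ) : ℝ → ℝ := fun x =>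
  dunklA j a b x * shiftUp f x + dunklB j a b x * shiftDown f x + dunklC j a b x * refl f x +
      dunklD j a b x * shiftUp (refl f) x -
    (dunklA j a b x + dunklB j a b x + dunklC j a b x + dunklD j a b x) * f x

/-- `D_β = D₀ + β (4x + b + a + j + 1) / (8x) (I - R)`. -/
def dunkl (j : ℕ) (a b β : ℝ) (f : ℝ → ℝ) : ℝ → ℝ := fun x =>
  dunklZero j a b f x + β * ((4 * x + b + a + j + 1) / (8 * x)) * (f x - refl f x)

/-- `Λ_{2n} = n (n - j)`, `Λ_{2n+1} = n (n + 1 - j) + β`. -/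
def dunklEigenvalue (j : ℕ) (β : ℝ) (n : ℕ) : ℝ :=
  let m : ℝ := ((n / 2 : ℕ) : ℝ)
  if Even n then m * (m - j) else m * (m + 1 - j) + β

/-! ### The explicit expression (truncated sums)

For odd `j`, the natural numbers `(j - 1) / 2`, `(j + 1) / 2` are exact quotients. -/

/-- The summand `A_{n,k}` of `P_{2n}`. -/
def sumA (j : ℕ) (a b α : ℝ) (n k : ℕ) (x : ℝ) : ℝ :=
  let q := -(b + j + 1 + a) / 4
  if k ≤ (j - 1) / 2 then
    poch (-(n : ℝ)) k * poch ((n : ℝ) - j) k * poch (q + x) k * poch (q - x) k /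
      (poch 1 k * poch (-(b + j) / 2) k * poch (-(j + a) / 2) k * poch ((1 - (j : ℝ)) / 2) k)
  else
    1 / α *
      (poch (-(n : ℝ)) k * poch (q + x) k * poch (q - x) k /
        (poch 1 k * poch (-(b + j) / 2) k * poch (-(j + a) / 2) k)) *
      (poch ((n : ℝ) - j) (j - n) * poch 1 (n + k - j - 1) /
        (poch ((1 - (j : ℝ)) / 2) ((j - 1) / 2) * poch 1 (k - (j + 1) / 2)))

/-- The normalization `κ_n^{(1)}` of `P_{2n}`. -/
def kappa1 (j : ℕ) (a b α : ℝ) (n : ℕ) : ℝ :=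
  if n ≤ (j - 1) / 2 then
    poch (-(b + j) / 2) n * poch (-(j + a) / 2) n * poch ((1 - (j : ℝ)) / 2) n /
      poch ((n : ℝ) - j) n
  else
    α *
      (poch (-(b + j) / 2) n * poch (-(j + a) / 2) n * poch ((1 - (j : ℝ)) / 2) ((j - 1) / 2) *
          poch 1 (n - (j + 1) / 2) /
        (poch ((n : ℝ) - j) (j - n) * poch 1 (2 * n - j - 1)))

/-- The summand `B_{n,k}` of `P_{2n+1}`. -/
def sumB (j : ℕ) (a b α : ℝ) (n k : ℕ) (x : ℝ) : ℝ :=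
  let q := -(b + j - 3 + a) / 4
  if k < (j - 1) / 2 then
    poch (-(n : ℝ)) k * poch ((n : ℝ) + 1 - j) k * poch (q + x) k * poch (q - x) k /
      (poch 1 k * poch ((3 - (j : ℝ)) / 2) k * poch ((2 - j - a) / 2) k * poch ((2 - j - b) / 2) k)
  else
    1 / α *
      (poch (-(n : ℝ)) k * poch (q + x) k * poch (q - x) k /
        (poch 1 k * poch ((2 - j - a) / 2) k * poch ((2 - j - b) / 2) k)) *
      (poch ((n : ℝ) + 1 - j) (j - n - 1) * poch 1 (n + k - j) /
        (poch ((3 - (j : ℝ)) / 2) ((j - 3) / 2) * poch 1 (k - (j - 1) / 2)))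

/-- The normalization `κ_n^{(2)}` of `P_{2n+1}`. -/
def kappa2 (j : ℕ) (a b α : ℝ) (n : ℕ) : ℝ :=
  if n < (j - 1) / 2 then
    poch ((2 - j - a) / 2) n * poch ((2 - j - b) / 2) n * poch ((3 - (j : ℝ)) / 2) n /
      poch ((n : ℝ) + 1 - j) n
  else
    α *
      (poch ((2 - j - a) / 2) n * poch ((2 - j - b) / 2) n *
          poch ((3 - (j : ℝ)) / 2) ((j - 3) / 2) * poch 1 (n - (j - 1) / 2) /
        (poch ((n : ℝ) + 1 - j) (j - n - 1) * poch 1 (2 * n - j)))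

/-! ### The lattice, the norms and the weights -/

/-- The grid point `x_i` (`0 ≤ i ≤ 2j`) of the Bannai-Ito bi-lattice; `i = 4s + c`. -/
def grid (j : ℕ) (a b : ℝ) (i : ℕ) : ℝ :=
  let s : ℝ := ((i / 4 : ℕ) : ℝ)
  if i % 4 = 0 then -((4 * s - j + a - b) / 4) - 1 / 4
  else if i % 4 = 1 then (4 * s - j - a - b) / 4 - 1 / 4
  else if i % 4 = 2 then (4 * s + 2 - j + a - b) / 4 - 1 / 4
  else -((4 * s + 2 - j - a - b) / 4) - 1 / 4

/-- The `α`-independent part of `h_n`. -/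
def normBase (j : ℕ) (a b : ℝ) (n : ℕ) : ℝ :=
  let m := n / 2
  if Even n then
    Real.sqrt
        (poch (-(j : ℝ)) m * poch 1 m * poch ((2 + a - j) / 2) m * poch (-(j + a) / 2) m *
            poch ((2 + b - j) / 2) m * poch (-(j + b) / 2) m /
          (poch ((2 - (j : ℝ)) / 2) m * poch (-(j : ℝ) / 2) m)) /
      2 ^ n
  else
    Real.sqrt
        (-1 * poch (-(j : ℝ)) (m + 1) * poch 1 m * poch ((2 + a - j) / 2) m *
            poch (-(j + a) / 2) (m + 1) * poch ((2 + b - j) / 2) m * poch (-(j + b) / 2) (m + 1) /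
          (poch ((2 - (j : ℝ)) / 2) m * poch (-(j : ℝ) / 2) (m + 1))) /
      2 ^ n

/-- The `α`-dependent factor of `h_n`. -/
def normFactor (j : ℕ) (α : ℝ) (n : ℕ) : ℝ :=
  let m := n / 2
  if Even n then
    if m ≤ (j - 1) / 2 then 1 else 2 * Real.sqrt (α * (1 - α))
  else
    if m < (j - 1) / 2 then 1
    else if m = (j - 1) / 2 then Real.sqrt (2 * α)
    else 2 * Real.sqrt (α * (1 - α))

/-- `h_n`. -/
def norm (j : ℕ) (a b α : ℝ) (n : ℕ) : ℝ := normBase j a b n * normFactor j α n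

/-- The weight `w_i` (`0 ≤ i ≤ 2j`), with `i = 4s + c`. The constant `h_{2j}` in it is the
persymmetric one, that is, `h_{2j}` at `α = 1/2`. -/
def weight (j : ℕ) (a b α : ℝ) (i : ℕ) : ℝ :=
  let s := i / 4
  let h := norm j a b (1 / 2) (2 * j)
  if i % 4 = 0 then
    2 * α * h /
      (poch (-(s : ℝ)) s * poch 1 ((j - 1) / 2 - s) * poch (-(s : ℝ) + (1 - a) / 2) ((j - 1) / 2) *
        poch (s + (1 + a - b - j) / 2) ((j + 1) / 2) * poch (s - (b + j) / 2) ((j + 1) / 2))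
  else if i % 4 = 1 then
    2 * (1 - α) * h /
      (poch (-(s : ℝ)) s * poch 1 ((j - 1) / 2 - s) * poch (-(s : ℝ) + (1 + a) / 2) ((j + 1) / 2) *
        poch (s + (1 - a - b - j) / 2) ((j - 1) / 2) * poch (s - (b + j) / 2) ((j + 1) / 2))
  else if i % 4 = 2 then
    -(2 * α * h) /
      (poch (-(s : ℝ)) s * poch 1 ((j - 1) / 2 - s) * poch (-(s : ℝ) - (1 + a) / 2) ((j + 1) / 2) *
        poch (s + (1 + a - b - j) / 2) ((j + 1) / 2) * poch (s + (2 - b - j) / 2) ((j - 1) / 2))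
  else
    -(2 * (1 - α) * h) /
      (poch (-(s : ℝ)) s * poch 1 ((j - 3) / 2 - s) * poch (-(s : ℝ) - (1 - a) / 2) ((j + 1) / 2) *
        poch (s + (1 - a - b - j) / 2) ((j + 1) / 2) * poch (s + (2 - b - j) / 2) ((j + 1) / 2))

end ParaBI

end

/-! Everything starts from one explicit form. With φ_k(x) = (q+x)_k (q-x)_k, the monic Wilson
polynomial W_n (`monicWilson`) has in the basis φ_k the coefficients (-1)^k C(n,k) times a product
over k ≤ i < n, a form that survives vanishing numerator parameters. Let W̃_n be W_n with q, the αᵢ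
and s all raised by one. Since I_{2n} = W_n and I_{2n+1} = (x - ρ₂) W̃_n with q = ρ₂, the three-term
recurrence of the CBI polynomials amounts to the pair (x² - q²) W̃_n = W_{n+1} + u W_n
(`monicWilson_recOdd`) and W_{n+1} = W̃_{n+1} + u' W̃_n (`monicWilson_recEven`), both obtained by
comparing coefficients.

Truncation: the recurrence coefficients converge, the only 0/0 limit being at n = j, where α
appears; the recurrence carries convergence over to the polynomials. In the explicit coefficients at
most one denominator vanishes at t = 0, and it cancels against a numerator α t
(`tendsto_limitQuot`). Equating the two limits gives explicit formulas for all P_n, n ≤ 2j+1, and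
for every α.

Dunkl equation: the Wilson difference operator is bidiagonal on φ_k, and the two-term recurrence of
the coefficients says that P_n is an eigenvector (`wilsonOp_eigen`). The operator D_β acts on even
functions, and on x - q times even functions, through two such Wilson operators.

Orthogonality: α enters only u_j and u_{j+1}, and at α = 1/2 one has u_{2j+1-n} = u_n. Both P_j and
the polynomial P_{j+1} at α = 1 split into linear factors, and their zeros form the grid. At such a
point the recurrence above the middle is a reflection of the one below: P_{j+1+l} = λ κ_l P_{j-1-l},
where λ depends only on the parity of the index of the point (`eval_paraBI_mirror`). Hence P_{2j+1}
vanishes on the grid. The weights are parity factors over ∏ (x_i - x_t), so by Lagrange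
interpolation the sums ∑ w_i P_n(x_i) become leading coefficients, equal to 1 for n = 0 and to 0
otherwise (`sum_weight_paraBI`). A formal argument with the recurrence (`orthogonal_of_recurrence`)
then gives all inner products; it never divides by a norm, so α = 0 and α = 1 are included. -/

namespace ParaBI

/-! ### Monic Wilson polynomials and their contiguous relations -/

section Generic

/-- The Newton-type basis `(q + x)_k (q - x)_k`. -/
noncomputable def newtonBasis (q x : ℝ) (k : ℕ) : ℝ := ∏ m ∈ Finset.range k, ((q + m) ^ 2 - x ^ 2)

theorem newtonBasis_succ (q x : ℝ) (k : ℕ) :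
    newtonBasis q x (k + 1) = newtonBasis q x k * ((q + k) ^ 2 - x ^ 2) := by
  simp [newtonBasis, Finset.prod_range_succ]

theorem newtonBasis_zero (q x : ℝ) : newtonBasis q x 0 = 1 := by simp [newtonBasis]

theorem newtonBasis_succ' (q x : ℝ) (k : ℕ) :
    newtonBasis q x (k + 1) = (q ^ 2 - x ^ 2) * newtonBasis (q + 1) x k := by
  rw [newtonBasis, Finset.prod_range_succ', mul_comm, newtonBasis]
  congr 1
  · simp
  · refine Finset.prod_congr rfl fun m _ => ?_
    push_cast; ring

/-- The two products differ only in one factor, and q² - (q+k+1)² = -(k+1)(2q+k+1). This converts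
expansions based at q into expansions based at q + 1. -/
theorem newtonBasis_shift (q x : ℝ) (k : ℕ) :
    newtonBasis q x (k + 1) = newtonBasis (q + 1) x (k + 1) -
      (k + 1) * (2 * q + k + 1) * newtonBasis (q + 1) x k := by
  rw [newtonBasis_succ', newtonBasis_succ]
  ring

/-- The numerator `(α₁ + i)(α₂ + i)(α₃ + i)`. -/
def numer (α₁ α₂ α₃ : ℝ) (i : ℕ) : ℝ := (α₁ + i) * (α₂ + i) * (α₃ + i)

/-- The quotient of products in the coefficients of the monic Wilson polynomials. -/
noncomputable def quot (α₁ α₂ α₃ s : ℝ) (n k : ℕ) : ℝ :=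
  ∏ i ∈ Finset.Ico k n, (numer α₁ α₂ α₃ i / (n + s + i))

/-- The coefficients of the monic Wilson polynomials in the basis `newtonBasis`. -/
noncomputable def wcoef (α₁ α₂ α₃ s : ℝ) (n k : ℕ) : ℝ :=
  (-1) ^ k * n.choose k * quot α₁ α₂ α₃ s n k

/-- The monic Wilson polynomials, evaluated at `x`. -/
noncomputable def monicWilson (q α₁ α₂ α₃ s : ℝ) (n : ℕ) (x : ℝ) : ℝ :=
  ∑ k ∈ Finset.range (n + 1), wcoef α₁ α₂ α₃ s n k * newtonBasis q x k

/-- Both sides are the product of c + i over k ≤ i ≤ m. -/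
theorem prod_Ico_shift (c : ℝ) {k m : ℕ} (h : k ≤ m) :
    (∏ i ∈ Finset.Ico k m, (c + i)) * (c + m) = (c + k) * ∏ i ∈ Finset.Ico k m, (c + 1 + i) := by
  induction m, h using Nat.le_induction with
  | base => simp
  | succ m h ih =>
    rw [Finset.prod_Ico_succ_top h, Finset.prod_Ico_succ_top h, ih]
    push_cast; ring

variable {α₁ α₂ α₃ s : ℝ}

/-- Raising all parameters by one moves the window k ≤ i < n up by one; the new last factor, at i =
n, has denominator 2n + s. -/
theorem quot_succ_shift {n k : ℕ} (h : k + 1 ≤ n) :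
    quot (α₁ + 1) (α₂ + 1) (α₃ + 1) (s + 1) n k =
      quot α₁ α₂ α₃ s n (k + 1) * (numer α₁ α₂ α₃ n / (2 * n + s)) := by
  have : quot (α₁ + 1) (α₂ + 1) (α₃ + 1) (s + 1) n k =
      ∏ i ∈ Finset.Ico (k + 1) (n + 1), (numer α₁ α₂ α₃ i / (n + s + i)) := by
    rw [quot, ← Finset.prod_Ico_add']
    refine Finset.prod_congr rfl fun i _ => ?_
    simp only [numer]
    push_cast
    congr 1 <;> ring
  rw [this, Finset.prod_Ico_succ_top h, quot]
  congr 2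
  ring

theorem quot_self (n : ℕ) : quot α₁ α₂ α₃ s n n = 1 := by simp [quot]

theorem quot_left {n k : ℕ} (h : k < n) :
    quot α₁ α₂ α₃ s n k =
      numer α₁ α₂ α₃ k / (n + s + k) * quot α₁ α₂ α₃ s n (k + 1) := by
  rw [quot, Finset.prod_eq_prod_Ico_succ_bot h, quot]

theorem quot_succ_top (hs : ∀ m : ℕ, s + m ≠ 0) {n k : ℕ} (h : k ≤ n) :
    quot α₁ α₂ α₃ s (n + 1) k =
      quot α₁ α₂ α₃ s n k * (numer α₁ α₂ α₃ n * (n + s + k) / ((2 * n + s) * (2 * n + 1 + s))) := by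
  have key := prod_Ico_shift (n + s) h
  have h1 : ∏ i ∈ Finset.Ico k n, ((n : ℝ) + s + i) ≠ 0 :=
    Finset.prod_ne_zero_iff.2 fun i _ => by
      have := hs (n + i); push_cast at this; convert this using 1; ring
  have h2 : ∏ i ∈ Finset.Ico k n, ((n : ℝ) + s + 1 + i) ≠ 0 :=
    Finset.prod_ne_zero_iff.2 fun i _ => by
      have := hs (n + 1 + i); push_cast at this; convert this using 1; ring
  have h3 : (2 * n + s : ℝ) ≠ 0 := by
    have := hs (2 * n); push_cast at this; convert this using 1; ring
  have h4 : (2 * n + 1 + s : ℝ) ≠ 0 := by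
    have := hs (2 * n + 1); push_cast at this; convert this using 1; ring
  have e : ∀ i : ℕ, ((n + 1 : ℕ) : ℝ) + s + i = n + s + 1 + i := fun i => by push_cast; ring
  rw [quot, Finset.prod_Ico_succ_top h, quot, Finset.prod_div_distrib, Finset.prod_div_distrib]
  simp only [e]
  rw [show (n : ℝ) + s + 1 + n = 2 * n + 1 + s by ring]
  rw [show (n : ℝ) + s + n = 2 * n + s by ring] at key
  rw [div_mul_div_comm, div_mul_div_comm, div_eq_div_iff (by positivity) (by positivity)]
  linear_combination (∏ i ∈ Finset.Ico k n, numer α₁ α₂ α₃ i) * numer α₁ α₂ α₃ n *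
    (2 * n + 1 + s) * key

theorem quot_pred_shift (hs : ∀ m : ℕ, s + m ≠ 0) {n k : ℕ} (h : k ≤ n) :
    quot (α₁ + 1) (α₂ + 1) (α₃ + 1) (s + 1) n k =
      quot α₁ α₂ α₃ s (n + 1) (k + 1) * ((2 * n + 1 + s) / (n + 1 + s + k)) := by
  have h3 : (2 * n + s : ℝ) ≠ 0 := by
    have := hs (2 * n); push_cast at this; convert this using 1; ring
  have h4 : (2 * n + 1 + s : ℝ) ≠ 0 := by
    have := hs (2 * n + 1); push_cast at this; convert this using 1; ring
  have h5 : (n + 1 + s + k : ℝ) ≠ 0 := by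
    have := hs (n + k + 1); push_cast at this; convert this using 1; ring
  rcases h.eq_or_lt with rfl | h
  · rw [quot_self, quot_self]; field_simp; ring
  · rw [quot_succ_shift h, quot_succ_top hs h]
    push_cast
    have h6 : (n + s + (k + 1) : ℝ) ≠ 0 := by convert h5 using 1; ring
    field_simp
    ring

/-- `A_{2n-1} C_{2n}` in terms of the parameters of the Wilson polynomials. -/
noncomputable def recEven (α₁ α₂ α₃ s : ℝ) (n : ℕ) : ℝ :=
  -(n * ((n + s - α₁) * (n + s - α₂) * (n + s - α₃)) / ((2 * n + s - 1) * (2 * n + s)))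

/-- `A_{2n} C_{2n+1}` in terms of the parameters of the Wilson polynomials. -/
noncomputable def recOdd (α₁ α₂ α₃ s : ℝ) (n : ℕ) : ℝ :=
  -((n + s) * numer α₁ α₂ α₃ n / ((2 * n + s) * (2 * n + 1 + s)))

/-- This is the comparison of coefficients of `newtonBasis q x (k + 1)` in `monicWilson_recOdd`;
once the products are reduced to a common one, only the binomial identity `hb` is left. -/
theorem wcoef_recOdd (hs : ∀ m : ℕ, s + m ≠ 0) {n k : ℕ} (h : k + 1 ≤ n) :
    -wcoef (α₁ + 1) (α₂ + 1) (α₃ + 1) (s + 1) n k =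
      wcoef α₁ α₂ α₃ s (n + 1) (k + 1) +
        recOdd α₁ α₂ α₃ s n * wcoef α₁ α₂ α₃ s n (k + 1) := by
  have h3 : (2 * n + s : ℝ) ≠ 0 := by
    have := hs (2 * n); push_cast at this; convert this using 1; ring
  have h4 : (2 * n + 1 + s : ℝ) ≠ 0 := by
    have := hs (2 * n + 1); push_cast at this; convert this using 1; ring
  have hb : (n.choose (k + 1) : ℝ) * (k + 1) = n.choose k * (n - k) := by
    have := Nat.choose_succ_right_eq n k
    rw [← Nat.cast_sub (by omega)]
    exact_mod_cast this
  simp only [wcoef, recOdd]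
  rw [quot_succ_shift h, quot_succ_top hs h, Nat.choose_succ_succ]
  push_cast
  rw [pow_succ]
  generalize quot α₁ α₂ α₃ s n (k + 1) = Q
  generalize numer α₁ α₂ α₃ n = N
  generalize (n.choose k : ℝ) = b at *
  generalize (n.choose (k + 1) : ℝ) = b' at *
  have : N / (2 * n + s) = N * (2 * n + 1 + s) / ((2 * n + s) * (2 * n + 1 + s)) := by
    rw [mul_div_mul_right _ _ h4]
  rw [this]
  linear_combination (-1) ^ k * Q * N / ((2 * n + s) * (2 * n + 1 + s)) * hb

theorem wcoef_recOdd_zero (hs : ∀ m : ℕ, s + m ≠ 0) (n : ℕ) :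
    wcoef α₁ α₂ α₃ s (n + 1) 0 + recOdd α₁ α₂ α₃ s n * wcoef α₁ α₂ α₃ s n 0 = 0 := by
  simp only [wcoef, recOdd]
  rw [quot_succ_top hs (Nat.zero_le n)]
  simp
  ring

/-- The comparison of coefficients of `newtonBasis (q + 1) x k` in `monicWilson_recEven`. The
condition `hq` says that the ₄F₃ is balanced; without it there would be no two-term relation. -/
theorem wcoef_recEven (hs : ∀ m : ℕ, s + m ≠ 0) {q : ℝ} (hq : s = α₁ + α₂ + α₃ - 2 * q - 1)
    {n k : ℕ} (h : k ≤ n) :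
    wcoef (α₁ + 1) (α₂ + 1) (α₃ + 1) (s + 1) (n + 1) k +
        recEven α₁ α₂ α₃ s (n + 1) * wcoef (α₁ + 1) (α₂ + 1) (α₃ + 1) (s + 1) n k =
      wcoef α₁ α₂ α₃ s (n + 1) k -
        (k + 1) * (2 * q + k + 1) * wcoef α₁ α₂ α₃ s (n + 1) (k + 1) := by
  have h4 : (2 * n + 1 + s : ℝ) ≠ 0 := by
    have := hs (2 * n + 1); push_cast at this; convert this using 1; ring
  have h3 : (2 * n + 2 + s : ℝ) ≠ 0 := by
    have := hs (2 * n + 2); push_cast at this; convert this using 1; ring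
  have h5 : (n + 1 + s + k : ℝ) ≠ 0 := by
    have := hs (n + k + 1); push_cast at this; convert this using 1; ring
  have hb : ((n + 1).choose (k + 1) : ℝ) * (k + 1) = (n + 1).choose k * (n + 1 - k) := by
    have := Nat.choose_succ_right_eq (n + 1) k
    rw [show (n : ℝ) + 1 - k = ((n + 1 - k : ℕ) : ℝ) by
      rw [Nat.cast_sub (by omega)]; push_cast; ring]
    exact_mod_cast this
  have hc : (n.choose k : ℝ) * (n + 1) = (n + 1).choose k * (n + 1 - k) := by
    have := Nat.choose_mul_succ_eq n k
    rw [show (n : ℝ) + 1 - k = ((n + 1 - k : ℕ) : ℝ) by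
      rw [Nat.cast_sub (by omega)]; push_cast; ring]
    exact_mod_cast this
  have e1 := quot_succ_shift (α₁ := α₁) (α₂ := α₂) (α₃ := α₃) (s := s) (show k + 1 ≤ n + 1 by omega)
  have e2 := quot_pred_shift (α₁ := α₁) (α₂ := α₂) (α₃ := α₃) hs h
  have e3 := quot_left (α₁ := α₁) (α₂ := α₂) (α₃ := α₃) (s := s) (show k < n + 1 by omega)
  simp only [wcoef]
  rw [e1, e2, e3]
  have hu : recEven α₁ α₂ α₃ s (n + 1) * ((-1) ^ k * (n.choose k) *
      (quot α₁ α₂ α₃ s (n + 1) (k + 1) * ((2 * n + 1 + s) / (n + 1 + s + k)))) =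
      -((-1) ^ k * quot α₁ α₂ α₃ s (n + 1) (k + 1) * ((n + 1).choose k * (n + 1 - k)) *
        ((n + 1 + s - α₁) * (n + 1 + s - α₂) * (n + 1 + s - α₃)) /
          ((2 * n + 2 + s) * (n + 1 + s + k))) := by
    rw [← hc, recEven]
    push_cast
    rw [show 2 * ((n : ℝ) + 1) + s - 1 = 2 * n + 1 + s by ring,
      show 2 * ((n : ℝ) + 1) + s = 2 * n + 2 + s by ring]
    generalize (n + 1 + s + k : ℝ) = d₁ at *
    generalize (2 * n + 1 + s : ℝ) = d₂ at *
    generalize (2 * n + 2 + s : ℝ) = d₃ at *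
    field_simp
  have hv : ((k : ℝ) + 1) * (2 * q + k + 1) * ((-1) ^ (k + 1) * ((n + 1).choose (k + 1)) *
      quot α₁ α₂ α₃ s (n + 1) (k + 1)) =
      -((2 * q + k + 1) * (-1) ^ k * quot α₁ α₂ α₃ s (n + 1) (k + 1) *
        ((n + 1).choose k * (n + 1 - k))) := by
    rw [← hb, pow_succ]; ring
  rw [hu, hv]
  simp only [numer]
  push_cast
  rw [show 2 * ((n : ℝ) + 1) + s = 2 * n + 2 + s by ring]
  have hq' : 2 * q + k + 1 = α₁ + α₂ + α₃ - s + k := by rw [hq]; ring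
  rw [hq']
  generalize ((n + 1).choose k : ℝ) = b
  generalize quot α₁ α₂ α₃ s (n + 1) (k + 1) = Q
  -- What remains after the common binomial and product are removed; by `hq'` the factor α₁ + α₂ +
  -- α₃ - s + k stands for 2q + k + 1.
  have key : (α₁ + (n + 1)) * (α₂ + (n + 1)) * (α₃ + (n + 1)) * (n + 1 + s + k) -
      (n + 1 - k) * ((n + 1 + s - α₁) * (n + 1 + s - α₂) * (n + 1 + s - α₃)) =
      (α₁ + k) * (α₂ + k) * (α₃ + k) * (2 * n + 2 + s) +
        (α₁ + α₂ + α₃ - s + k) * (n + 1 - k) * ((2 * n + 2 + s) * (n + 1 + s + k)) := by ring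
  generalize (n + 1 + s + k : ℝ) = d₁ at *
  generalize (2 * n + 2 + s : ℝ) = d₃ at *
  field_simp
  linear_combination b * Q * key

theorem monicWilson_recEven (hs : ∀ m : ℕ, s + m ≠ 0) {q : ℝ}
    (hq : s = α₁ + α₂ + α₃ - 2 * q - 1) (n : ℕ) (x : ℝ) :
    monicWilson (q + 1) (α₁ + 1) (α₂ + 1) (α₃ + 1) (s + 1) (n + 1) x +
        recEven α₁ α₂ α₃ s (n + 1) *
          monicWilson (q + 1) (α₁ + 1) (α₂ + 1) (α₃ + 1) (s + 1) n x =
      monicWilson q α₁ α₂ α₃ s (n + 1) x := by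
  have hR : monicWilson q α₁ α₂ α₃ s (n + 1) x =
      ∑ k ∈ Finset.range (n + 1), (wcoef α₁ α₂ α₃ s (n + 1) k -
        (k + 1) * (2 * q + k + 1) * wcoef α₁ α₂ α₃ s (n + 1) (k + 1)) * newtonBasis (q + 1) x k +
        wcoef α₁ α₂ α₃ s (n + 1) (n + 1) * newtonBasis (q + 1) x (n + 1) := by
    have h0 : newtonBasis q x 0 = newtonBasis (q + 1) x 0 := by simp [newtonBasis_zero]
    rw [monicWilson, Finset.sum_range_succ']
    have : ∀ k ∈ Finset.range (n + 1), wcoef α₁ α₂ α₃ s (n + 1) (k + 1) * newtonBasis q x (k + 1) =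
        wcoef α₁ α₂ α₃ s (n + 1) (k + 1) * newtonBasis (q + 1) x (k + 1) -
          (k + 1) * (2 * q + k + 1) * wcoef α₁ α₂ α₃ s (n + 1) (k + 1) *
            newtonBasis (q + 1) x k := fun k _ => by
      rw [newtonBasis_shift]; ring
    rw [Finset.sum_congr rfl this]
    simp only [Finset.sum_sub_distrib, sub_mul]
    rw [h0, sub_add_eq_add_sub, ← Finset.sum_range_succ'
      (fun k => wcoef α₁ α₂ α₃ s (n + 1) k * newtonBasis (q + 1) x k), Finset.sum_range_succ,
      sub_add_eq_add_sub]
  rw [hR]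
  have hlast : wcoef (α₁ + 1) (α₂ + 1) (α₃ + 1) (s + 1) (n + 1) (n + 1) =
      wcoef α₁ α₂ α₃ s (n + 1) (n + 1) := by simp [wcoef, quot_self]
  rw [monicWilson, Finset.sum_range_succ, monicWilson, Finset.mul_sum, hlast, add_right_comm,
    ← Finset.sum_add_distrib]
  congr 1
  refine Finset.sum_congr rfl fun k hk => ?_
  rw [← wcoef_recEven hs hq (by simpa [Nat.lt_succ_iff] using hk)]
  ring

theorem monicWilson_recOdd (hs : ∀ m : ℕ, s + m ≠ 0) (q : ℝ) (n : ℕ) (x : ℝ) :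
    (x ^ 2 - q ^ 2) * monicWilson (q + 1) (α₁ + 1) (α₂ + 1) (α₃ + 1) (s + 1) n x =
      monicWilson q α₁ α₂ α₃ s (n + 1) x +
        recOdd α₁ α₂ α₃ s n * monicWilson q α₁ α₂ α₃ s n x := by
  have hL : (x ^ 2 - q ^ 2) * monicWilson (q + 1) (α₁ + 1) (α₂ + 1) (α₃ + 1) (s + 1) n x =
      ∑ k ∈ Finset.range (n + 1), -wcoef (α₁ + 1) (α₂ + 1) (α₃ + 1) (s + 1) n k *
        newtonBasis q x (k + 1) := by
    rw [monicWilson, Finset.mul_sum]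
    refine Finset.sum_congr rfl fun k _ => ?_
    rw [newtonBasis_succ']; ring
  have hW : ∀ m, monicWilson q α₁ α₂ α₃ s m x =
      ∑ k ∈ Finset.range m, wcoef α₁ α₂ α₃ s m (k + 1) * newtonBasis q x (k + 1) +
        wcoef α₁ α₂ α₃ s m 0 * newtonBasis q x 0 := fun m => by
    rw [monicWilson, Finset.sum_range_succ']
  rw [hL, hW, hW, Finset.sum_range_succ, Finset.sum_range_succ]
  have hlast : -wcoef (α₁ + 1) (α₂ + 1) (α₃ + 1) (s + 1) n n =
      wcoef α₁ α₂ α₃ s (n + 1) (n + 1) := by simp [wcoef, quot_self, pow_succ]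
  have hz := wcoef_recOdd_zero (α₁ := α₁) (α₂ := α₂) (α₃ := α₃) hs n
  rw [hlast]
  have hsum : ∑ k ∈ Finset.range n, -wcoef (α₁ + 1) (α₂ + 1) (α₃ + 1) (s + 1) n k *
        newtonBasis q x (k + 1) =
      ∑ k ∈ Finset.range n, wcoef α₁ α₂ α₃ s (n + 1) (k + 1) * newtonBasis q x (k + 1) +
        recOdd α₁ α₂ α₃ s n *
          ∑ k ∈ Finset.range n, wcoef α₁ α₂ α₃ s n (k + 1) * newtonBasis q x (k + 1) := by
    rw [Finset.mul_sum, ← Finset.sum_add_distrib]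
    refine Finset.sum_congr rfl fun k hk => ?_
    rw [wcoef_recOdd hs (by simpa using hk)]
    ring
  rw [hsum]
  linear_combination -newtonBasis q x 0 * hz

end Generic

/-! ### The CBI polynomials and the limit t → 0 -/

section Truncation

theorem poch_eq_prod (x : ℝ) (k : ℕ) : poch x k = ∏ i ∈ Finset.range k, (x + i) := by
  induction k with
  | zero => simp [poch]
  | succ k ih => rw [Finset.prod_range_succ, ← ih, poch, ascPochhammer_succ_eval, poch]

theorem poch_succ (x : ℝ) (k : ℕ) : poch x (k + 1) = poch x k * (x + k) := by
  rw [poch_eq_prod, poch_eq_prod, Finset.prod_range_succ]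

theorem poch_one_pos (k : ℕ) : 0 < poch 1 k := by
  rw [poch_eq_prod]; exact Finset.prod_pos fun i _ => by positivity

theorem poch_neg_natCast (n k : ℕ) : poch (-(n : ℝ)) k = (-1) ^ k * n.choose k * poch 1 k := by
  induction k with
  | zero => simp [poch]
  | succ k ih =>
    have hb : (n.choose (k + 1) : ℝ) * (k + 1) = n.choose k * (n - k) := by
      rcases le_or_gt k n with h | h
      · have := Nat.choose_succ_right_eq n k
        rw [← Nat.cast_sub h]
        exact_mod_cast this
      · rw [Nat.choose_eq_zero_of_lt h, Nat.choose_eq_zero_of_lt (by omega)]; simp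
    rw [poch_succ, poch_succ, ih]
    linear_combination (-1) ^ k * poch 1 k * hb

theorem leadingCoeff_prod_sq_sub (c : ℕ → ℝ) (k : ℕ) :
    (∏ m ∈ Finset.range k, (C (c m) - X ^ 2)).leadingCoeff = (-1) ^ k ∧
      (∏ m ∈ Finset.range k, (C (c m) - X ^ 2)).natDegree = 2 * k := by
  have h : ∀ m, C (c m) - X ^ 2 = -(X ^ 2 - C (c m)) := fun m => by ring
  have h1 : ∀ m, (C (c m) - X ^ 2).leadingCoeff = -1 := fun m => by
    rw [h, leadingCoeff_neg, (monic_X_pow_sub_C (c m) two_ne_zero).leadingCoeff]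
  have h2 : ∀ m, (C (c m) - X ^ 2).natDegree = 2 := fun m => by
    rw [h, natDegree_neg, natDegree_X_pow_sub_C]
  constructor
  · simp [leadingCoeff_prod, h1]
  · rw [natDegree_prod _ _ fun m _ => ?_]
    · simp [h2, mul_comm]
    · intro h0; have := h1 m; simp [h0] at this

theorem natDegree_lt_leadingCoeff_sum (a c : ℕ → ℝ) (n : ℕ) (ha : a n ≠ 0) :
    (∑ k ∈ Finset.range (n + 1), C (a k) *
      ∏ m ∈ Finset.range k, (C (c m) - X ^ 2)).leadingCoeff = (-1) ^ n * a n := by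
  rw [Finset.sum_range_succ]
  have h1 := leadingCoeff_prod_sq_sub c n
  have hne : (C (a n) * ∏ m ∈ Finset.range n, (C (c m) - X ^ 2)) ≠ 0 := by
    rw [← leadingCoeff_ne_zero, leadingCoeff_mul, h1.1, leadingCoeff_C]
    exact mul_ne_zero ha (by positivity)
  rw [leadingCoeff_add_of_degree_lt]
  · rw [leadingCoeff_mul, h1.1, leadingCoeff_C, mul_comm]
  · rw [degree_mul, degree_C ha, zero_add]
    have hd : (∏ m ∈ Finset.range n, (C (c m) - X ^ 2)).degree = ((2 * n : ℕ) : WithBot ℕ) := by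
      rw [degree_eq_natDegree (right_ne_zero_of_mul hne), h1.2]
    rw [hd]
    refine (degree_sum_le _ _).trans_lt ?_
    rw [Finset.sup_lt_iff (by exact_mod_cast WithBot.bot_lt_coe _)]
    intro k hk
    refine degree_le_natDegree.trans_lt ?_
    have h2 := natDegree_C_mul_le (a k) (∏ m ∈ Finset.range k, (C (c m) - X ^ 2))
    rw [(leadingCoeff_prod_sq_sub c k).2] at h2
    have := Finset.mem_range.1 hk
    exact_mod_cast (by omega : _ < 2 * n)

/-- The hypergeometric coefficients are (-1)^k C(n,k) / T k and the leading coefficient is 1 / T n,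
so making the polynomial monic produces T n / T k, which is the product `quot`. Nonvanishing
numerators are needed because the T k are divided by. -/
theorem eval_cbiEven_eq_monicWilson {n : ℕ} {ρ₁ ρ₂ r₁ r₂ α₁ α₂ α₃ s : ℝ}
    (h₁ : ρ₂ + (ρ₁ + 1) = α₁) (h₂ : ρ₂ + (-r₁ + 1 / 2) = α₂) (h₃ : ρ₂ + (-r₂ + 1 / 2) = α₃)
    (h₄ : ρ₁ + ρ₂ - r₁ - r₂ + 1 = s) (hs : ∀ m : ℕ, s + m ≠ 0)
    (hN : ∀ i < n, numer α₁ α₂ α₃ i ≠ 0) (x : ℝ) :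
    (cbiEven n ρ₁ ρ₂ r₁ r₂).eval x = monicWilson ρ₂ α₁ α₂ α₃ s n x := by
  set T : ℕ → ℝ := fun k => ∏ i ∈ Finset.range k, (numer α₁ α₂ α₃ i / (n + s + i)) with hT
  have hns : ∀ i : ℕ, (n + s + i : ℝ) ≠ 0 := fun i => by
    have := hs (n + i); push_cast at this; convert this using 1; ring
  have hTne : ∀ k ≤ n, T k ≠ 0 := fun k hk => Finset.prod_ne_zero_iff.2 fun i hi =>
    div_ne_zero (hN i ((Finset.mem_range.1 hi).trans_le hk)) (hns i)
  have hquot : ∀ k ≤ n, quot α₁ α₂ α₃ s n k = T n / T k := fun k hk => by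
    rw [eq_div_iff (hTne k hk), hT, quot, mul_comm]
    exact Finset.prod_range_mul_prod_Ico _ hk
  set c : ℕ → ℝ := fun k => (-1) ^ k * n.choose k / T k with hc
  have hW : wilsonAtIX n ρ₂ (ρ₁ + 1) (-r₁ + 1 / 2) (-r₂ + 1 / 2) =
      ∑ k ∈ Finset.range (n + 1), C (c k) *
        ∏ m ∈ Finset.range k, (C ((ρ₂ + m) ^ 2) - X ^ 2) := by
    refine Finset.sum_congr rfl fun k hk => ?_
    have hk' : k ≤ n := by simpa [Nat.lt_succ_iff] using hk
    congr 2
    have hs' : (n : ℝ) + ρ₂ + (ρ₁ + 1) + (-r₁ + 1 / 2) + (-r₂ + 1 / 2) - 1 = n + s := by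
      rw [← h₄]; ring
    rw [h₁, h₂, h₃, hs', poch_neg_natCast, hc]
    have hTk : T k = poch α₁ k * poch α₂ k * poch α₃ k / poch (n + s) k := by
      simp only [hT, numer, poch_eq_prod, Finset.prod_div_distrib, Finset.prod_mul_distrib]
    have hp := (poch_one_pos k).ne'
    simp only [hTk, div_div_eq_mul_div]
    rw [mul_right_comm _ (poch 1 k), mul_comm (poch 1 k), mul_div_mul_right _ _ hp]
  have hlead : (wilsonAtIX n ρ₂ (ρ₁ + 1) (-r₁ + 1 / 2) (-r₂ + 1 / 2)).leadingCoeff = (T n)⁻¹ := by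
    rw [hW, natDegree_lt_leadingCoeff_sum]
    · simp only [hc, Nat.choose_self]
      rw [← mul_div_assoc, ← mul_assoc, ← mul_pow]; simp
    · simp only [hc, Nat.choose_self]
      exact div_ne_zero (by simp) (hTne n le_rfl)
  rw [cbiEven, eval_mul, eval_C, hlead, inv_inv, hW, eval_finsetSum, monicWilson, Finset.mul_sum]
  refine Finset.sum_congr rfl fun k hk => ?_
  have hk' : k ≤ n := by simpa [Nat.lt_succ_iff] using hk
  rw [wcoef, hquot k hk', eval_mul, eval_C, eval_prod, newtonBasis]
  simp only [eval_sub, eval_pow, eval_X, eval_C, hc]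
  ring

/-- The complementary Bannai-Ito polynomials through the monic Wilson polynomials; this makes
sense also where numerator parameters vanish. -/
noncomputable def cbiValue (n : ℕ) (ρ₁ ρ₂ r₁ r₂ x : ℝ) : ℝ :=
  if Even n then
    monicWilson ρ₂ (ρ₁ + ρ₂ + 1) (ρ₂ - r₁ + 1 / 2) (ρ₂ - r₂ + 1 / 2) (ρ₁ + ρ₂ - r₁ - r₂ + 1)
      (n / 2) x
  else (x - ρ₂) * monicWilson (ρ₂ + 1) (ρ₁ + ρ₂ + 1 + 1) (ρ₂ - r₁ + 1 / 2 + 1)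
    (ρ₂ - r₂ + 1 / 2 + 1) (ρ₁ + ρ₂ - r₁ - r₂ + 1 + 1) (n / 2) x

theorem eval_cbi_eq_cbiValue {n : ℕ} {ρ₁ ρ₂ r₁ r₂ : ℝ}
    (hs : ∀ m : ℕ, ρ₁ + ρ₂ - r₁ - r₂ + 1 + m ≠ 0)
    (hN : ∀ i ≤ n, numer (ρ₁ + ρ₂ + 1) (ρ₂ - r₁ + 1 / 2) (ρ₂ - r₂ + 1 / 2) i ≠ 0) (x : ℝ) :
    (cbi n ρ₁ ρ₂ r₁ r₂).eval x = cbiValue n ρ₁ ρ₂ r₁ r₂ x := by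
  rw [cbi, cbiValue]
  split_ifs with h
  · refine eval_cbiEven_eq_monicWilson (by ring) (by ring) (by ring) rfl hs
      (fun i hi => hN i (by omega)) x
  · rw [eval_mul, eval_sub, eval_X, eval_C]
    congr 1
    refine eval_cbiEven_eq_monicWilson (by ring) (by ring) (by ring) (by ring) (fun m => ?_)
      (fun i hi => ?_) x
    · have := hs (m + 1); push_cast at this; convert this using 1; ring
    · have := hN (i + 1) (by rw [Nat.not_even_iff] at h; omega)
      simp only [numer] at this ⊢
      push_cast at this
      convert this using 1; ring

theorem cbiValue_zero (ρ₁ ρ₂ r₁ r₂ x : ℝ) : cbiValue 0 ρ₁ ρ₂ r₁ r₂ x = 1 := by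
  simp [cbiValue, monicWilson, wcoef, quot, newtonBasis]

theorem cbiValue_one (ρ₁ ρ₂ r₁ r₂ x : ℝ) : cbiValue 1 ρ₁ ρ₂ r₁ r₂ x = x - ρ₂ := by
  simp [cbiValue, monicWilson, wcoef, quot, newtonBasis]

theorem rho_sub_cbiA_sub_cbiC {ρ₁ ρ₂ r₁ r₂ : ℝ} {n : ℕ} (hs : (n + (ρ₁ + ρ₂ - r₁ - r₂) + 1 : ℝ) ≠ 0) :
    ρ₁ - cbiA n ρ₁ ρ₂ r₁ r₂ - cbiC n ρ₁ ρ₂ r₁ r₂ = if Even n then ρ₂ else -ρ₂ := by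
  simp only [cbiA, cbiC]
  split_ifs with h <;> field_simp <;> ring

/-- The diagonal coefficient alternates between ρ₂ and -ρ₂. For even n the factors x + ρ₂ and x - ρ₂
combine to x² - ρ₂² and `monicWilson_recOdd` applies; for odd n the relation is x - ρ₂ times
`monicWilson_recEven`. -/
theorem cbiValue_succ_succ {ρ₁ ρ₂ r₁ r₂ : ℝ} (hs : ∀ m : ℕ, ρ₁ + ρ₂ - r₁ - r₂ + 1 + m ≠ 0)
    (n : ℕ) (x : ℝ) :
    cbiValue (n + 2) ρ₁ ρ₂ r₁ r₂ x =
      (x - (ρ₁ - cbiA (n + 1) ρ₁ ρ₂ r₁ r₂ - cbiC (n + 1) ρ₁ ρ₂ r₁ r₂)) *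
          cbiValue (n + 1) ρ₁ ρ₂ r₁ r₂ x -
        cbiA n ρ₁ ρ₂ r₁ r₂ * cbiC (n + 1) ρ₁ ρ₂ r₁ r₂ * cbiValue n ρ₁ ρ₂ r₁ r₂ x := by
  have hs1 : ((n + 1 : ℕ) + (ρ₁ + ρ₂ - r₁ - r₂) + 1 : ℝ) ≠ 0 := by
    have := hs (n + 1); convert this using 1; ring
  have hs0 : ((n : ℕ) + (ρ₁ + ρ₂ - r₁ - r₂) + 1 : ℝ) ≠ 0 := by
    have := hs n; convert this using 1; ring
  rw [rho_sub_cbiA_sub_cbiC hs1]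
  rcases Nat.even_or_odd' n with ⟨m, rfl | rfl⟩
  · have e0 : Even (2 * m) := by simp
    have e1 : ¬ Even (2 * m + 1) := by simp
    have e2 : Even (2 * m + 2) := by simp [parity_simps]
    have d0 : 2 * m / 2 = m := by omega
    have d1 : (2 * m + 1) / 2 = m := by omega
    have d2 : (2 * m + 2) / 2 = m + 1 := by omega
    simp only [cbiValue, e0, e1, e2, d0, d1, d2, if_true, if_false]
    have key := monicWilson_recOdd (α₁ := ρ₁ + ρ₂ + 1) (α₂ := ρ₂ - r₁ + 1 / 2)
      (α₃ := ρ₂ - r₂ + 1 / 2) hs ρ₂ m x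
    have hu : cbiA (2 * m) ρ₁ ρ₂ r₁ r₂ * cbiC (2 * m + 1) ρ₁ ρ₂ r₁ r₂ =
        recOdd (ρ₁ + ρ₂ + 1) (ρ₂ - r₁ + 1 / 2) (ρ₂ - r₂ + 1 / 2) (ρ₁ + ρ₂ - r₁ - r₂ + 1) m := by
      simp only [cbiA, cbiC, recOdd, numer, e0, e1, if_true, if_false]
      push_cast at hs0 hs1 ⊢
      rw [show 2 * (m : ℝ) + (ρ₁ + ρ₂ - r₁ - r₂ + 1) = 2 * m + (ρ₁ + ρ₂ - r₁ - r₂) + 1 by ring,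
        show 2 * (m : ℝ) + 1 + (ρ₁ + ρ₂ - r₁ - r₂ + 1) =
          2 * m + 1 + (ρ₁ + ρ₂ - r₁ - r₂) + 1 by ring]
      rw [← neg_div, ← neg_div, div_mul_div_comm, div_eq_div_iff]
      · ring
      · exact mul_ne_zero (mul_ne_zero four_ne_zero hs0) (mul_ne_zero four_ne_zero hs1)
      · exact mul_ne_zero hs0 hs1
    rw [hu]
    linear_combination -key
  · have e0 : ¬ Even (2 * m + 1) := by simp
    have e1 : Even (2 * m + 1 + 1) := by simp [parity_simps]
    have e2 : ¬ Even (2 * m + 1 + 2) := by simp [parity_simps]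
    have d0 : (2 * m + 1) / 2 = m := by omega
    have d1 : (2 * m + 1 + 1) / 2 = m + 1 := by omega
    have d2 : (2 * m + 1 + 2) / 2 = m + 1 := by omega
    simp only [cbiValue, e0, e1, e2, d0, d1, d2, if_true, if_false]
    have key := monicWilson_recEven (α₁ := ρ₁ + ρ₂ + 1) (α₂ := ρ₂ - r₁ + 1 / 2)
      (α₃ := ρ₂ - r₂ + 1 / 2) hs (q := ρ₂) (by ring) m x
    have hu : cbiA (2 * m + 1) ρ₁ ρ₂ r₁ r₂ * cbiC (2 * m + 1 + 1) ρ₁ ρ₂ r₁ r₂ =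
        recEven (ρ₁ + ρ₂ + 1) (ρ₂ - r₁ + 1 / 2) (ρ₂ - r₂ + 1 / 2) (ρ₁ + ρ₂ - r₁ - r₂ + 1)
          (m + 1) := by
      simp only [cbiA, cbiC, recEven, e0, e1, if_true, if_false]
      push_cast at hs0 hs1 ⊢
      rw [show 2 * ((m : ℝ) + 1) + (ρ₁ + ρ₂ - r₁ - r₂ + 1) - 1 =
          2 * m + 1 + (ρ₁ + ρ₂ - r₁ - r₂) + 1 by ring,
        show 2 * ((m : ℝ) + 1) + (ρ₁ + ρ₂ - r₁ - r₂ + 1) =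
          2 * m + 1 + 1 + (ρ₁ + ρ₂ - r₁ - r₂) + 1 by ring]
      rw [← neg_div, ← neg_div, div_mul_div_comm, div_eq_div_iff]
      · ring
      · exact mul_ne_zero (mul_ne_zero four_ne_zero hs0) (mul_ne_zero four_ne_zero hs1)
      · exact mul_ne_zero hs0 hs1
    rw [hu]
    linear_combination (x - ρ₂) * key

/-! ### The limit -/

variable {j : ℕ} {a b α e₁ e₂ : ℝ}

theorem rho1_add_rho2 (t : ℝ) : rho1 j a b + rho2 j a b e₁ t = -((j : ℝ) + 1) / 2 + e₁ * t := by
  rw [rho2]; ring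

theorem cbi_g_eq (t : ℝ) :
    rho1 j a b + rho2 j a b e₁ t - r1 j a b - r2 j a b e₂ t + 1 = -j + (e₁ + e₂) * t := by
  simp only [rho2, r2]; ring

theorem eventually_cbi_g_ne (he : e₁ + e₂ ≠ 0) :
    ∀ᶠ t in 𝓝[≠] (0 : ℝ), ∀ m : ℕ,
      rho1 j a b + rho2 j a b e₁ t - r1 j a b - r2 j a b e₂ t + 1 + m ≠ 0 := by
  have h1 : Tendsto (fun t : ℝ => (e₁ + e₂) * t) (𝓝[≠] 0) (𝓝 0) := by
    have : ContinuousAt (fun t : ℝ => (e₁ + e₂) * t) 0 := by fun_prop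
    simpa using this.tendsto.mono_left nhdsWithin_le_nhds
  filter_upwards [h1.eventually (Metric.ball_mem_nhds 0 one_pos), self_mem_nhdsWithin]
    with t ht ht0 m hm
  rw [cbi_g_eq] at hm
  -- A pole would force the small nonzero number (e₁ + e₂) t to be an integer.
  have hz : (e₁ + e₂) * t = ((j - m : ℤ) : ℝ) := by push_cast; linarith
  have habs : |(e₁ + e₂) * t| < 1 := by simpa [Real.dist_eq] using ht
  rw [hz] at habs
  have : |(j - m : ℤ)| < 1 := by exact_mod_cast habs
  rw [Int.abs_lt_one_iff] at this
  rw [this] at hz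
  exact mul_ne_zero he ht0 (by simpa using hz)

theorem natCast_sub_ne_of_even (hj : Odd j) {n : ℕ} (hn : Even n) : (n : ℝ) - j ≠ 0 := by
  rw [sub_ne_zero, Ne, Nat.cast_inj]
  rintro rfl
  exact (Nat.not_even_iff_odd.2 hj) hn

theorem tendsto_cbiA (hj : Odd j) (he : e₁ + e₂ ≠ 0) (hα : e₁ / (e₁ + e₂) = α) (n : ℕ) :
    Tendsto (fun t => cbiA n (rho1 j a b) (rho2 j a b e₁ t) (r1 j a b) (r2 j a b e₂ t))
      (𝓝[≠] 0) (𝓝 (coefA j a b α n)) := by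
  by_cases hn : Even n
  · have hd := natCast_sub_ne_of_even hj hn
    have hd' : (4 * (n + -j) : ℝ) ≠ 0 := by simpa [← sub_eq_add_neg] using hd
    have hf : ContinuousAt (fun t : ℝ => -((n - j - b + 2 * (e₁ + e₂) * t) *
        (n - j - a + 2 * e₁ * t) / (4 * (n + (-j + (e₁ + e₂) * t))))) 0 := by
      refine ContinuousAt.neg (ContinuousAt.div (by fun_prop) (by fun_prop) (by simpa using hd'))
    have hl := hf.tendsto.mono_left (nhdsWithin_le_nhds (s := {0}ᶜ))
    convert hl using 2 with t
    · simp only [cbiA, hn, if_true]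
      rw [show (n : ℝ) + (rho1 j a b + rho2 j a b e₁ t - r1 j a b - r2 j a b e₂ t) + 1 =
        n + (-j + (e₁ + e₂) * t) by rw [← cbi_g_eq (a := a) (b := b)]; ring]
      congr 3
      · simp only [rho2, r2, rho1, r1]; ring
      · simp only [rho2, r1, rho1]; ring
    · simp only [coefA, hn, if_true, mul_zero, add_zero]
      rw [← sub_eq_add_neg]; field_simp
  · by_cases hnj : n = j
    -- At n = j both n + g + 1 and the factor n - 2r₁ - 2r₂ + 1 are multiples of t, so the quotient
    -- does not depend on t ≠ 0; here e₂ / (e₁ + e₂) = 1 - α enters.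
    · subst hnj
      have hl : Tendsto (fun _ : ℝ => -(1 / 2) * (1 - α) * (n + 1 : ℝ)) (𝓝[≠] 0)
        (𝓝 (-(1 / 2) * (1 - α) * (n + 1 : ℝ))) := tendsto_const_nhds
      simp only [coefA, hn, if_true, if_false]
      refine hl.congr' ?_
      filter_upwards [self_mem_nhdsWithin] with t ht
      have ht : t ≠ 0 := ht
      simp only [cbiA, hn, if_false]
      rw [show (n : ℝ) + (rho1 n a b + rho2 n a b e₁ t - r1 n a b - r2 n a b e₂ t) + 1 =
        (e₁ + e₂) * t by
          rw [show (e₁ + e₂) * t = n + (-n + (e₁ + e₂) * t) by ring,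
            ← cbi_g_eq (a := a) (b := b)]; ring]
      rw [show (n : ℝ) - 2 * r1 n a b - 2 * r2 n a b e₂ t + 1 = 2 * e₂ * t by
        simp only [r2, r1]; ring, ← hα]
      field_simp
      ring
    · have hd : (n : ℝ) - j ≠ 0 := by rwa [sub_ne_zero, Ne, Nat.cast_inj]
      have hd' : (4 * (n + -j) : ℝ) ≠ 0 := by simpa [← sub_eq_add_neg] using hd
      have hf : ContinuousAt (fun t : ℝ => -((n + 1) *
          (n - j + 2 * e₂ * t) / (4 * (n + (-j + (e₁ + e₂) * t))))) 0 := by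
        refine ContinuousAt.neg (ContinuousAt.div (by fun_prop) (by fun_prop) (by simpa using hd'))
      have hl := hf.tendsto.mono_left (nhdsWithin_le_nhds (s := {0}ᶜ))
      convert hl using 2 with t
      · simp only [cbiA, hn, if_false]
        rw [show (n : ℝ) + (rho1 j a b + rho2 j a b e₁ t - r1 j a b - r2 j a b e₂ t) + 1 =
          n + (-j + (e₁ + e₂) * t) by rw [← cbi_g_eq (a := a) (b := b)]; ring]
        congr 3
        simp only [r2, r1]; ring
      · simp only [coefA, hn, hnj, if_false, mul_zero, add_zero]
        rw [← sub_eq_add_neg]; field_simp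

theorem tendsto_cbiC (hj : Odd j) (he : e₁ + e₂ ≠ 0) (hα : e₁ / (e₁ + e₂) = α) (n : ℕ) :
    Tendsto (fun t => cbiC n (rho1 j a b) (rho2 j a b e₁ t) (r1 j a b) (r2 j a b e₂ t))
      (𝓝[≠] 0) (𝓝 (coefC j a b α n)) := by
  by_cases hn : Even n
  · have hd := natCast_sub_ne_of_even hj hn
    have hd' : (4 * (n + -j) : ℝ) ≠ 0 := by simpa [← sub_eq_add_neg] using hd
    have hf : ContinuousAt (fun t : ℝ => (n - j + b) *
        (n - j + a + 2 * e₂ * t) / (4 * (n + (-j + (e₁ + e₂) * t)))) 0 := by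
      refine ContinuousAt.div (by fun_prop) (by fun_prop) (by simpa using hd')
    have hl := hf.tendsto.mono_left (nhdsWithin_le_nhds (s := {0}ᶜ))
    convert hl using 2 with t
    · simp only [cbiC, hn, if_true]
      rw [show (n : ℝ) + (rho1 j a b + rho2 j a b e₁ t - r1 j a b - r2 j a b e₂ t) + 1 =
        n + (-j + (e₁ + e₂) * t) by rw [← cbi_g_eq (a := a) (b := b)]; ring]
      congr 2
      · simp only [rho1, r1]; ring
      · simp only [r2, r1, rho1]; ring
    · simp only [coefC, hn, if_true, mul_zero, add_zero]
      rw [← sub_eq_add_neg]; field_simp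
  · by_cases hnj : n = j
    · subst hnj
      have hf : ContinuousAt (fun t : ℝ => (-(n : ℝ) - 1 + 2 * (e₁ + e₂) * t) * α / 2) 0 := by
        fun_prop
      have hl := hf.tendsto.mono_left (nhdsWithin_le_nhds (s := {0}ᶜ))
      simp only [coefC, hn, if_true, if_false]
      rw [show -(1 / 2) * α * ((n : ℝ) + 1) = (-(n : ℝ) - 1 + 2 * (e₁ + e₂) * 0) * α / 2 by ring]
      refine hl.congr' ?_
      filter_upwards [self_mem_nhdsWithin] with t ht
      have ht : t ≠ 0 := ht
      simp only [cbiC, hn, if_false]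
      rw [show (n : ℝ) + (rho1 n a b + rho2 n a b e₁ t - r1 n a b - r2 n a b e₂ t) + 1 =
        (e₁ + e₂) * t by
          rw [show (e₁ + e₂) * t = n + (-n + (e₁ + e₂) * t) by ring,
            ← cbi_g_eq (a := a) (b := b)]; ring]
      rw [show (n : ℝ) + 2 * rho1 n a b + 2 * rho2 n a b e₁ t + 1 = 2 * e₁ * t by
        simp only [rho1, rho2]; ring,
        show (n : ℝ) + 2 * (rho1 n a b + rho2 n a b e₁ t - r1 n a b - r2 n a b e₂ t) + 1 =
          -n - 1 + 2 * (e₁ + e₂) * t by simp only [rho1, rho2, r1, r2]; ring, ← hα]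
      field_simp
      ring
    · have hd : (n : ℝ) - j ≠ 0 := by rwa [sub_ne_zero, Ne, Nat.cast_inj]
      have hd' : (4 * (n + -j) : ℝ) ≠ 0 := by simpa [← sub_eq_add_neg] using hd
      have hf : ContinuousAt (fun t : ℝ => (n - 2 * j - 1 + 2 * (e₁ + e₂) * t) *
          (n - j + 2 * e₁ * t) / (4 * (n + (-j + (e₁ + e₂) * t)))) 0 := by
        refine ContinuousAt.div (by fun_prop) (by fun_prop) (by simpa using hd')
      have hl := hf.tendsto.mono_left (nhdsWithin_le_nhds (s := {0}ᶜ))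
      convert hl using 2 with t
      · simp only [cbiC, hn, if_false]
        rw [show (n : ℝ) + (rho1 j a b + rho2 j a b e₁ t - r1 j a b - r2 j a b e₂ t) + 1 =
          n + (-j + (e₁ + e₂) * t) by rw [← cbi_g_eq (a := a) (b := b)]; ring]
        congr 2
        · simp only [r2, r1, rho1, rho2]; ring
        · simp only [rho1, rho2]; ring
      · simp only [coefC, hn, hnj, if_false, mul_zero, add_zero]
        rw [← sub_eq_add_neg]; field_simp

theorem eval_paraBI_succ_succ (n : ℕ) (x : ℝ) :
    (paraBI j a b α (n + 2)).eval x =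
      (x - (rho1 j a b - coefA j a b α (n + 1) - coefC j a b α (n + 1))) *
          (paraBI j a b α (n + 1)).eval x -
        coefA j a b α n * coefC j a b α (n + 1) * (paraBI j a b α n).eval x := by
  simp [paraBI]

theorem rho1_sub_coefA_sub_coefC (hj : Odd j) (n : ℕ) :
    rho1 j a b - coefA j a b α n - coefC j a b α n =
      if Even n then -(a + b + j + 1) / 4 else (a + b + j + 1) / 4 := by
  by_cases hn : Even n
  · have hd := natCast_sub_ne_of_even hj hn
    simp only [coefA, coefC, hn, if_true, rho1]
    field_simp
    ring
  · simp only [coefA, coefC, hn, if_false, rho1]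
    split_ifs with h <;> ring

/-- The limits of the recurrence coefficients propagate along the three-term recurrence. Working
with `cbiValue` keeps α = 0 allowed, which the explicit formulas for all α rely on. -/
theorem tendsto_cbiValue (hj : Odd j) (he : e₁ + e₂ ≠ 0) (hα : e₁ / (e₁ + e₂) = α) (n : ℕ)
    (x : ℝ) :
    Tendsto (fun t => cbiValue n (rho1 j a b) (rho2 j a b e₁ t) (r1 j a b) (r2 j a b e₂ t) x)
      (𝓝[≠] 0) (𝓝 ((paraBI j a b α n).eval x)) := by
  induction n using Nat.twoStepInduction with
  | zero =>
    simp only [cbiValue_zero, paraBI, eval_one]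
    exact tendsto_const_nhds
  | one =>
    have hf : ContinuousAt (fun t : ℝ => x - rho2 j a b e₁ t) 0 := by
      unfold rho2; fun_prop
    have hl := hf.tendsto.mono_left (nhdsWithin_le_nhds (s := {0}ᶜ))
    simp only [cbiValue_one]
    convert hl using 2
    rw [paraBI, eval_sub, eval_X, eval_C, rho1_sub_coefA_sub_coefC hj, if_pos Even.zero, rho2, rho1]
    ring
  | more n ih1 ih2 =>
    rw [eval_paraBI_succ_succ]
    have hl := ((tendsto_const_nhds (x := x)).sub (((tendsto_const_nhds (x := rho1 j a b)).sub
      (tendsto_cbiA (a := a) (b := b) hj he hα (n + 1))).sub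
      (tendsto_cbiC (a := a) (b := b) hj he hα (n + 1)))).mul ih2 |>.sub
      (((tendsto_cbiA (a := a) (b := b) hj he hα n).mul
        (tendsto_cbiC (a := a) (b := b) hj he hα (n + 1))).mul ih1)
    refine hl.congr' ?_
    filter_upwards [eventually_cbi_g_ne (j := j) (a := a) (b := b) he] with t ht
    rw [cbiValue_succ_succ ht]

theorem eventually_add_mul_ne_zero (c : ℝ) {e : ℝ} (he : e ≠ 0) :
    ∀ᶠ t in 𝓝[≠] (0 : ℝ), c + e * t ≠ 0 := by
  by_cases hc : c = 0
  · filter_upwards [self_mem_nhdsWithin] with t ht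
    rw [hc, zero_add]; exact mul_ne_zero he ht
  · have : ContinuousAt (fun t : ℝ => c + e * t) 0 := by fun_prop
    exact (this.eventually_ne (by simpa using hc)).filter_mono nhdsWithin_le_nhds

theorem tendsto_cbi (hj : Odd j) (he : e₁ + e₂ ≠ 0) (hα : e₁ / (e₁ + e₂) = α) (hα0 : α ≠ 0)
    (n : ℕ) (x : ℝ) :
    Tendsto (fun t => (cbi n (rho1 j a b) (rho2 j a b e₁ t) (r1 j a b) (r2 j a b e₂ t)).eval x)
      (𝓝[≠] 0) (𝓝 ((paraBI j a b α n).eval x)) := by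
  -- With e₁ ≠ 0 every numerator factor moves with t, hence is nonzero for small t ≠ 0, and `cbi`
  -- agrees with `cbiValue` there.
  have he1 : e₁ ≠ 0 := by rintro rfl; simp at hα; exact hα0 hα.symm
  refine (tendsto_cbiValue hj he hα n x).congr' ?_
  have hN : ∀ᶠ t in 𝓝[≠] (0 : ℝ), ∀ i ∈ Finset.range (n + 1),
      numer (rho1 j a b + rho2 j a b e₁ t + 1) (rho2 j a b e₁ t - r1 j a b + 1 / 2)
        (rho2 j a b e₁ t - r2 j a b e₂ t + 1 / 2) i ≠ 0 := by
    refine (Finset.eventually_all _).2 fun i _ => ?_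
    filter_upwards [eventually_add_mul_ne_zero (-((j : ℝ) + 1) / 2 + 1 + i) he1,
      eventually_add_mul_ne_zero (-(j + a) / 2 + i) he1,
      eventually_add_mul_ne_zero (-(j + b) / 2 + i) he] with t h1 h2 h3
    refine mul_ne_zero (mul_ne_zero ?_ ?_) ?_
    · convert h1 using 1; rw [rho1_add_rho2]; ring
    · convert h2 using 1; simp only [rho1, rho2, r1]; ring
    · convert h3 using 1; simp only [rho1, rho2, r1, r2]; ring
  filter_upwards [eventually_cbi_g_ne (j := j) (a := a) (b := b) he, hN] with t ht hNt
  rw [eval_cbi_eq_cbiValue ht fun i hi => hNt i (by simpa [Nat.lt_succ_iff] using hi)]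

end Truncation

/-! ### Termwise limits of the explicit coefficients -/

section LimitCoefficients

/-- The limit of `∏ (i - M + α t) / (i - L + t)` over `k ≤ i < n` as `t → 0`. -/
noncomputable def limitQuot (α : ℝ) (M L k n : ℕ) : ℝ :=
  if k ≤ L ∧ L < n then
    α * ((∏ i ∈ Finset.Ico k M, ((i : ℝ) - M)) * ∏ i ∈ Finset.Ico (M + 1) n, ((i : ℝ) - M)) /
      ((∏ i ∈ Finset.Ico k L, ((i : ℝ) - L)) * ∏ i ∈ Finset.Ico (L + 1) n, ((i : ℝ) - L))
  else ∏ i ∈ Finset.Ico k n, (((i : ℝ) - M) / ((i : ℝ) - L))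

theorem prod_Ico_split (f : ℕ → ℝ) {k M n : ℕ} (h1 : k ≤ M) (h2 : M < n) :
    ∏ i ∈ Finset.Ico k n, f i =
      f M * ((∏ i ∈ Finset.Ico k M, f i) * ∏ i ∈ Finset.Ico (M + 1) n, f i) := by
  rw [← Finset.prod_Ico_consecutive f h1 h2.le, Finset.prod_eq_prod_Ico_succ_bot h2]
  ring

theorem natCast_sub_ne {i L : ℕ} (h : i ≠ L) : (i : ℝ) - L ≠ 0 := by
  rwa [sub_ne_zero, Ne, Nat.cast_inj]

/-- If L lies in the window, the denominator at i = L is t, and `h` guarantees the numerator α t at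
i = M to cancel it. Otherwise no denominator vanishes and the quotient is continuous at 0. -/
theorem tendsto_limitQuot (α : ℝ) {M L k n : ℕ} (h : k ≤ L → L < n → k ≤ M ∧ M < n) :
    Tendsto (fun t : ℝ => ∏ i ∈ Finset.Ico k n, (((i : ℝ) - M + α * t) / ((i : ℝ) - L + t)))
      (𝓝[≠] 0) (𝓝 (limitQuot α M L k n)) := by
  by_cases hL : k ≤ L ∧ L < n
  · have hM := h hL.1 hL.2
    have hne : (∏ i ∈ Finset.Ico k L, ((i : ℝ) - L)) * ∏ i ∈ Finset.Ico (L + 1) n, ((i : ℝ) - L)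
        ≠ 0 := by
      refine mul_ne_zero ?_ ?_ <;> refine Finset.prod_ne_zero_iff.2 fun i hi => natCast_sub_ne ?_
      all_goals have := Finset.mem_Ico.1 hi; omega
    have hf : ContinuousAt (fun t : ℝ => α * ((∏ i ∈ Finset.Ico k M, ((i : ℝ) - M + α * t)) *
        ∏ i ∈ Finset.Ico (M + 1) n, ((i : ℝ) - M + α * t)) /
        ((∏ i ∈ Finset.Ico k L, ((i : ℝ) - L + t)) *
          ∏ i ∈ Finset.Ico (L + 1) n, ((i : ℝ) - L + t))) 0 := by
      refine ContinuousAt.div (by fun_prop) (by fun_prop) (by simpa using hne)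
    have hl := hf.tendsto.mono_left (nhdsWithin_le_nhds (s := {0}ᶜ))
    rw [limitQuot, if_pos hL]
    simp only [mul_zero, add_zero] at hl
    refine hl.congr' ?_
    filter_upwards [self_mem_nhdsWithin] with t ht
    have ht : t ≠ 0 := ht
    rw [Finset.prod_div_distrib, prod_Ico_split _ hM.1 hM.2, prod_Ico_split _ hL.1 hL.2]
    rw [sub_self, sub_self, zero_add, zero_add, mul_right_comm, mul_comm t,
      mul_div_mul_right _ _ ht]
  · rw [limitQuot, if_neg hL]
    refine tendsto_finsetProd _ fun i hi => ?_
    have hi := Finset.mem_Ico.1 hi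
    have hf : ContinuousAt (fun t : ℝ => ((i : ℝ) - M + α * t) / ((i : ℝ) - L + t)) 0 := by
      refine ContinuousAt.div (by fun_prop) (by fun_prop) ?_
      rw [add_zero]; exact natCast_sub_ne (by omega)
    have hl := hf.tendsto.mono_left (nhdsWithin_le_nhds (s := {0}ᶜ))
    simpa only [mul_zero, add_zero] using hl

/-- The coefficients of `P_{2n}` in the basis `(q + x)_k (q - x)_k`, for `j = 2 M + 1`. -/
noncomputable def coefEven (M : ℕ) (a b α : ℝ) (n k : ℕ) : ℝ :=
  (-1) ^ k * n.choose k * (limitQuot α M (2 * M + 1 - n) k n *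
    ∏ i ∈ Finset.Ico k n, ((-((2 * M + 1 : ℕ) + a) / 2 + i) * (-((2 * M + 1 : ℕ) + b) / 2 + i)))

/-- The coefficients of `P_{2n+1} / (x - q)` in the basis `(q + 1 + x)_k (q + 1 - x)_k`, for
`j = 2 M + 1`. -/
noncomputable def coefOdd (M : ℕ) (a b α : ℝ) (n k : ℕ) : ℝ :=
  (-1) ^ k * n.choose k * (limitQuot α M (2 * M + 1 - n) (k + 1) (n + 1) *
    ∏ i ∈ Finset.Ico k n,
      ((-((2 * M + 1 : ℕ) + a) / 2 + 1 + i) * (-((2 * M + 1 : ℕ) + b) / 2 + 1 + i)))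

/-- The paths of the parameters of the Wilson polynomials: `α₁, α₂, α₃, s` at time `t`. -/
theorem tendsto_wcoef_even {M : ℕ} (a b α : ℝ) {n : ℕ} (hn : n ≤ 2 * M + 1) (k : ℕ) :
    Tendsto (fun t : ℝ => wcoef (-(M : ℝ) + α * t) (-((2 * M + 1 : ℕ) + a) / 2 + α * t)
      (-((2 * M + 1 : ℕ) + b) / 2 + t) (-((2 * M + 1 : ℕ) : ℝ) + t) n k)
      (𝓝[≠] 0) (𝓝 (coefEven M a b α n k)) := by
  have h1 := tendsto_limitQuot α (M := M) (L := 2 * M + 1 - n) (k := k) (n := n) (by omega)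
  have hf : ContinuousAt (fun t : ℝ => ∏ i ∈ Finset.Ico k n,
      ((-((2 * M + 1 : ℕ) + a) / 2 + i + α * t) * (-((2 * M + 1 : ℕ) + b) / 2 + i + t))) 0 := by
    fun_prop
  have hl := hf.tendsto.mono_left (nhdsWithin_le_nhds (s := {0}ᶜ))
  simp only [mul_zero, add_zero] at hl
  refine ((h1.mul hl).const_mul ((-1) ^ k * (n.choose k : ℝ))).congr fun t => ?_
  rw [wcoef, quot, ← Finset.prod_mul_distrib]
  congr 1
  refine Finset.prod_congr rfl fun i _ => ?_
  rw [numer, Nat.cast_sub hn, div_mul_eq_mul_div]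
  congr 1 <;> ring

/-- The shift of the parameters by one is absorbed into the window, now k + 1 ≤ i < n + 1, so the
critical indices M and L = j - n stay the same. -/
theorem tendsto_wcoef_odd {M : ℕ} (a b α : ℝ) {n : ℕ} (hn : n ≤ 2 * M + 1) (k : ℕ) :
    Tendsto (fun t : ℝ => wcoef (-(M : ℝ) + α * t + 1) (-((2 * M + 1 : ℕ) + a) / 2 + α * t + 1)
      (-((2 * M + 1 : ℕ) + b) / 2 + t + 1) (-((2 * M + 1 : ℕ) : ℝ) + t + 1) n k)
      (𝓝[≠] 0) (𝓝 (coefOdd M a b α n k)) := by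
  have h1 := tendsto_limitQuot α (M := M) (L := 2 * M + 1 - n) (k := k + 1) (n := n + 1)
    (by omega)
  have hf : ContinuousAt (fun t : ℝ => ∏ i ∈ Finset.Ico k n,
      ((-((2 * M + 1 : ℕ) + a) / 2 + 1 + i + α * t) *
        (-((2 * M + 1 : ℕ) + b) / 2 + 1 + i + t))) 0 := by
    fun_prop
  have hl := hf.tendsto.mono_left (nhdsWithin_le_nhds (s := {0}ᶜ))
  simp only [mul_zero, add_zero] at hl
  refine ((h1.mul hl).const_mul ((-1) ^ k * (n.choose k : ℝ))).congr fun t => ?_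
  rw [wcoef, quot, ← Finset.prod_Ico_add', ← Finset.prod_mul_distrib]
  congr 1
  refine Finset.prod_congr rfl fun i _ => ?_
  rw [numer, Nat.cast_sub hn, div_mul_eq_mul_div]
  push_cast
  congr 1 <;> ring

theorem continuous_newtonBasis (x : ℝ) (k : ℕ) : Continuous fun q => newtonBasis q x k := by
  unfold newtonBasis; fun_prop

/-- Along the path e₁ = α, e₂ = 1 - α the same values `cbiValue` converge to P_{2n}(x) by the
recurrence and to the sum by termwise limits. -/
theorem eval_paraBI_even (M : ℕ) (a b α : ℝ) {n : ℕ} (hn : n ≤ 2 * M + 1) (x : ℝ) :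
    (paraBI (2 * M + 1) a b α (2 * n)).eval x =
      ∑ k ∈ Finset.range (n + 1), coefEven M a b α n k *
        newtonBasis (-(a + b + (2 * M + 1 : ℕ) + 1) / 4) x k := by
  refine tendsto_nhds_unique (tendsto_cbiValue (j := 2 * M + 1) (e₁ := α) (e₂ := 1 - α) (by simp)
    (by simp) (by simp) (2 * n) x) ?_
  have hq : Tendsto (fun t => rho2 (2 * M + 1) a b α t) (𝓝[≠] 0)
      (𝓝 (-(a + b + (2 * M + 1 : ℕ) + 1) / 4)) := by
    have hf : ContinuousAt (fun t : ℝ => rho2 (2 * M + 1) a b α t) 0 := by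
      unfold rho2; fun_prop
    convert hf.tendsto.mono_left (nhdsWithin_le_nhds (s := {0}ᶜ)) using 2
    simp only [rho2, rho1]; ring
  have hsum : Tendsto (fun t : ℝ => ∑ k ∈ Finset.range (n + 1),
      wcoef (-(M : ℝ) + α * t) (-((2 * M + 1 : ℕ) + a) / 2 + α * t)
      (-((2 * M + 1 : ℕ) + b) / 2 + t) (-((2 * M + 1 : ℕ) : ℝ) + t) n k *
        newtonBasis (rho2 (2 * M + 1) a b α t) x k) (𝓝[≠] 0)
      (𝓝 (∑ k ∈ Finset.range (n + 1), coefEven M a b α n k *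
        newtonBasis (-(a + b + (2 * M + 1 : ℕ) + 1) / 4) x k)) :=
    tendsto_finsetSum _ fun k _ => (tendsto_wcoef_even a b α hn k).mul
      (((continuous_newtonBasis x k).tendsto _).comp hq)
  refine hsum.congr fun t => ?_
  have e : 2 * n / 2 = n := by omega
  rw [cbiValue, if_pos (by simp), e, monicWilson]
  refine Finset.sum_congr rfl fun k _ => ?_
  congr 2 <;> simp only [rho1, rho2, r1, r2] <;> push_cast <;> ring

theorem eval_paraBI_odd (M : ℕ) (a b α : ℝ) {n : ℕ} (hn : n ≤ 2 * M + 1) (x : ℝ) :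
    (paraBI (2 * M + 1) a b α (2 * n + 1)).eval x =
      (x - -(a + b + (2 * M + 1 : ℕ) + 1) / 4) *
        ∑ k ∈ Finset.range (n + 1), coefOdd M a b α n k *
          newtonBasis (-(a + b + (2 * M + 1 : ℕ) + 1) / 4 + 1) x k := by
  refine tendsto_nhds_unique (tendsto_cbiValue (j := 2 * M + 1) (e₁ := α) (e₂ := 1 - α) (by simp)
    (by simp) (by simp) (2 * n + 1) x) ?_
  have hq : Tendsto (fun t => rho2 (2 * M + 1) a b α t) (𝓝[≠] 0)
      (𝓝 (-(a + b + (2 * M + 1 : ℕ) + 1) / 4)) := by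
    have hf : ContinuousAt (fun t : ℝ => rho2 (2 * M + 1) a b α t) 0 := by
      unfold rho2; fun_prop
    convert hf.tendsto.mono_left (nhdsWithin_le_nhds (s := {0}ᶜ)) using 2
    simp only [rho2, rho1]; ring
  have hsum : Tendsto (fun t : ℝ => (x - rho2 (2 * M + 1) a b α t) *
      ∑ k ∈ Finset.range (n + 1),
      wcoef (-(M : ℝ) + α * t + 1) (-((2 * M + 1 : ℕ) + a) / 2 + α * t + 1)
      (-((2 * M + 1 : ℕ) + b) / 2 + t + 1) (-((2 * M + 1 : ℕ) : ℝ) + t + 1) n k *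
        newtonBasis (rho2 (2 * M + 1) a b α t + 1) x k) (𝓝[≠] 0)
      (𝓝 ((x - -(a + b + (2 * M + 1 : ℕ) + 1) / 4) *
        ∑ k ∈ Finset.range (n + 1), coefOdd M a b α n k *
        newtonBasis (-(a + b + (2 * M + 1 : ℕ) + 1) / 4 + 1) x k)) :=
    (tendsto_const_nhds.sub hq).mul (tendsto_finsetSum _ fun k _ =>
      (tendsto_wcoef_odd a b α hn k).mul
      (((continuous_newtonBasis x k).tendsto _).comp (hq.add_const 1)))
  refine hsum.congr fun t => ?_
  have e : (2 * n + 1) / 2 = n := by omega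
  rw [cbiValue, if_neg (by simp), e, monicWilson]
  congr 1
  refine Finset.sum_congr rfl fun k _ => ?_
  congr 2 <;> simp only [rho1, rho2, r1, r2] <;> push_cast <;> ring

/-- The hypergeometric term ratio, cleared of denominators so that it passes to the limit. For k ≥ n
both sides are zero. -/
theorem wcoef_step {α₁ α₂ α₃ s : ℝ} {n : ℕ} (k : ℕ) (h : (n + s + k : ℝ) ≠ 0) :
    wcoef α₁ α₂ α₃ s n k * ((n - k) * (n + s + k)) =
      -((k + 1) * numer α₁ α₂ α₃ k * wcoef α₁ α₂ α₃ s n (k + 1)) := by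
  rcases lt_or_ge k n with hk | hk
  · have hb : (n.choose (k + 1) : ℝ) * (k + 1) = n.choose k * (n - k) := by
      have := Nat.choose_succ_right_eq n k
      rw [← Nat.cast_sub (by omega)]
      exact_mod_cast this
    rw [wcoef, wcoef, quot_left hk, pow_succ]
    field_simp
    linear_combination -(quot α₁ α₂ α₃ s n (k + 1)) * numer α₁ α₂ α₃ k * hb
  · rw [wcoef, wcoef, Nat.choose_eq_zero_of_lt (by omega : n < k + 1)]
    rcases hk.eq_or_lt with rfl | hk
    · simp
    · rw [Nat.choose_eq_zero_of_lt hk]; simp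

theorem eventually_natCast_sub_add_ne (c : ℝ) : ∀ᶠ t in 𝓝[≠] (0 : ℝ), c + t ≠ 0 := by
  simpa using eventually_add_mul_ne_zero c one_ne_zero

/-- The limit of `wcoef_step`. It holds even when n - j + k = 0, because for small t ≠ 0 the
corresponding factor is nonzero. -/
theorem coefEven_step (M : ℕ) (a b α : ℝ) {n : ℕ} (hn : n ≤ 2 * M + 1) (k : ℕ) :
    coefEven M a b α n k * ((n - k) * (n - (2 * M + 1 : ℕ) + k)) =
      -((k + 1) * numer (-(M : ℝ)) (-((2 * M + 1 : ℕ) + a) / 2) (-((2 * M + 1 : ℕ) + b) / 2) k *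
        coefEven M a b α n (k + 1)) := by
  have hf : ContinuousAt (fun t : ℝ => ((n : ℝ) - k) * (n + (-((2 * M + 1 : ℕ) : ℝ) + t) + k)) 0 := by
    fun_prop
  have hg : ContinuousAt (fun t : ℝ => ((k : ℝ) + 1) * numer (-(M : ℝ) + α * t)
      (-((2 * M + 1 : ℕ) + a) / 2 + α * t) (-((2 * M + 1 : ℕ) + b) / 2 + t) k) 0 := by
    unfold numer; fun_prop
  have h1 := (tendsto_wcoef_even a b α hn k).mul
    (hf.tendsto.mono_left (nhdsWithin_le_nhds (s := {0}ᶜ)))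
  have h2 := ((hg.tendsto.mono_left (nhdsWithin_le_nhds (s := {0}ᶜ))).mul
    (tendsto_wcoef_even a b α hn (k + 1))).neg
  simp only [mul_zero, add_zero, ← sub_eq_add_neg] at h1 h2
  refine tendsto_nhds_unique (h1.congr' ?_) h2
  filter_upwards [eventually_natCast_sub_add_ne ((n : ℝ) - (2 * M + 1 : ℕ) + k)] with t ht
  refine wcoef_step k ?_
  convert ht using 1; ring

theorem coefOdd_step (M : ℕ) (a b α : ℝ) {n : ℕ} (hn : n ≤ 2 * M + 1) (k : ℕ) :
    coefOdd M a b α n k * ((n - k) * (n - (2 * M + 1 : ℕ) + 1 + k)) =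
      -((k + 1) * numer (-(M : ℝ) + 1) (-((2 * M + 1 : ℕ) + a) / 2 + 1)
        (-((2 * M + 1 : ℕ) + b) / 2 + 1) k * coefOdd M a b α n (k + 1)) := by
  have hf : ContinuousAt (fun t : ℝ => ((n : ℝ) - k) *
      (n + (-((2 * M + 1 : ℕ) : ℝ) + t + 1) + k)) 0 := by
    fun_prop
  have hg : ContinuousAt (fun t : ℝ => ((k : ℝ) + 1) * numer (-(M : ℝ) + α * t + 1)
      (-((2 * M + 1 : ℕ) + a) / 2 + α * t + 1) (-((2 * M + 1 : ℕ) + b) / 2 + t + 1) k) 0 := by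
    unfold numer; fun_prop
  have h1 := (tendsto_wcoef_odd a b α hn k).mul
    (hf.tendsto.mono_left (nhdsWithin_le_nhds (s := {0}ᶜ)))
  have h2 := ((hg.tendsto.mono_left (nhdsWithin_le_nhds (s := {0}ᶜ))).mul
    (tendsto_wcoef_odd a b α hn (k + 1))).neg
  simp only [mul_zero, add_zero] at h1 h2
  rw [show (n : ℝ) - (2 * M + 1 : ℕ) + 1 + k = n + (-((2 * M + 1 : ℕ) : ℝ) + 1) + k by ring]
  refine tendsto_nhds_unique (h1.congr' ?_) h2
  filter_upwards [eventually_natCast_sub_add_ne ((n : ℝ) - (2 * M + 1 : ℕ) + 1 + k)] with t ht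
  refine wcoef_step k ?_
  convert ht using 1; ring

end LimitCoefficients

/-! ### Identification with the truncated hypergeometric sums -/

section Explicit

theorem poch_mul_prod_Ico (x : ℝ) {k m : ℕ} (h : k ≤ m) :
    poch x k * ∏ i ∈ Finset.Ico k m, (x + i) = poch x m := by
  rw [poch_eq_prod, poch_eq_prod, Finset.prod_range_mul_prod_Ico _ h]

theorem poch_one_mul_prod_Ico {M k m : ℕ} (h1 : M < k) (h2 : k ≤ m) :
    poch 1 (k - M - 1) * ∏ i ∈ Finset.Ico k m, ((i : ℝ) - M) = poch 1 (m - M - 1) := by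
  induction m, h2 using Nat.le_induction with
  | base => simp
  | succ m h ih =>
    rw [Finset.prod_Ico_succ_top h, ← mul_assoc, ih, show m + 1 - M - 1 = (m - M - 1) + 1 by omega,
      poch_succ, Nat.sub_sub, Nat.cast_sub (by omega)]
    push_cast; ring

theorem poch_ne_zero {x : ℝ} {k : ℕ} (h : ∀ i < k, x + i ≠ 0) : poch x k ≠ 0 := by
  rw [poch_eq_prod]
  exact Finset.prod_ne_zero_iff.2 fun i hi => h i (Finset.mem_range.1 hi)

theorem poch_eq_zero {x : ℝ} {k i : ℕ} (h : i < k) (hx : x + i = 0) : poch x k = 0 := by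
  rw [poch_eq_prod]
  exact Finset.prod_eq_zero (Finset.mem_range.2 h) hx

theorem poch_neg_ne_zero {M k : ℕ} (h : k ≤ M) : poch (-(M : ℝ)) k ≠ 0 :=
  poch_ne_zero fun i hi => by
    rw [neg_add_eq_sub]; exact natCast_sub_ne (by omega)

theorem poch_one_sub_ne_zero {M k : ℕ} (h : k < M) : poch (1 - (M : ℝ)) k ≠ 0 :=
  poch_ne_zero fun i hi => by
    have := natCast_sub_ne (i := i + 1) (L := M) (by omega)
    push_cast at this; convert this using 1; ring

theorem prod_Ico_neg (M k m : ℕ) :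
    ∏ i ∈ Finset.Ico k m, ((i : ℝ) - M) = ∏ i ∈ Finset.Ico k m, (-(M : ℝ) + i) :=
  Finset.prod_congr rfl fun i _ => by ring

theorem newtonBasis_eq_poch (q x : ℝ) (k : ℕ) :
    newtonBasis q x k = poch (q + x) k * poch (q - x) k := by
  rw [newtonBasis, poch_eq_prod, poch_eq_prod, ← Finset.prod_mul_distrib]
  exact Finset.prod_congr rfl fun i _ => by ring

theorem prod_Ico_poch (x : ℝ) {k m : ℕ} (h : k ≤ m) (hx : poch x k ≠ 0) :
    ∏ i ∈ Finset.Ico k m, (x + i) = poch x m / poch x k := by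
  rw [eq_div_iff hx, mul_comm, poch_mul_prod_Ico x h]

theorem prod_Ico_poch_one {M k m : ℕ} (h1 : M < k) (h2 : k ≤ m) :
    ∏ i ∈ Finset.Ico k m, ((i : ℝ) - M) = poch 1 (m - M - 1) / poch 1 (k - M - 1) := by
  rw [eq_div_iff (poch_one_pos _).ne', mul_comm, poch_one_mul_prod_Ico h1 h2]

theorem limitQuot_small {α : ℝ} {M L k n : ℕ} (hkn : k ≤ n) (hM : n ≤ M) (hL : n ≤ L) :
    limitQuot α M L k n =
      poch (-(M : ℝ)) n / poch (-(M : ℝ)) k / (poch (-(L : ℝ)) n / poch (-(L : ℝ)) k) := by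
  rw [limitQuot, if_neg (by omega), Finset.prod_div_distrib, prod_Ico_neg, prod_Ico_neg,
    prod_Ico_poch _ hkn (poch_neg_ne_zero (hkn.trans hM)),
    prod_Ico_poch _ hkn (poch_neg_ne_zero (hkn.trans hL))]

theorem limitQuot_large {α : ℝ} {M L k n : ℕ} (hkn : k ≤ n) (hM : M < k) (hL : L < k) :
    limitQuot α M L k n =
      poch 1 (n - M - 1) / poch 1 (k - M - 1) / (poch 1 (n - L - 1) / poch 1 (k - L - 1)) := by
  rw [limitQuot, if_neg (by omega), Finset.prod_div_distrib, prod_Ico_poch_one hM hkn,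
    prod_Ico_poch_one hL hkn]

/-- The factor (-L)_k is kept outside the fraction so that one formula serves both cases: for k > L
it vanishes, in agreement with the uncancelled zero numerator at i = M. -/
theorem limitQuot_middle {α : ℝ} {M L k n : ℕ} (hM : k ≤ M) (hM' : M < n) (hL' : L < n) :
    limitQuot α M L k n =
      α * (poch (-(M : ℝ)) M / poch (-(M : ℝ)) k * poch 1 (n - M - 1)) /
        (poch (-(L : ℝ)) L * poch 1 (n - L - 1)) * poch (-(L : ℝ)) k := by
  by_cases hk : k ≤ L
  · have e : ∀ N, N < n → ∏ i ∈ Finset.Ico (N + 1) n, ((i : ℝ) - N) = poch 1 (n - N - 1) :=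
      fun N hN => by
        rw [prod_Ico_poch_one (by omega) (by omega)]; simp [poch]
    rw [limitQuot, if_pos ⟨hk, hL'⟩, e M hM', e L hL', prod_Ico_neg, prod_Ico_neg,
      prod_Ico_poch _ hM (poch_neg_ne_zero hM), prod_Ico_poch _ hk (poch_neg_ne_zero hk)]
    have := poch_neg_ne_zero hk
    have := poch_neg_ne_zero hM
    have := poch_neg_ne_zero (le_refl L)
    have := (poch_one_pos (n - L - 1)).ne'
    field_simp
  · rw [poch_eq_zero (x := -(L : ℝ)) (by omega : L < k) (by ring), mul_zero, limitQuot,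
      if_neg (by omega)]
    exact Finset.prod_eq_zero (Finset.mem_Ico.2 ⟨hM, hM'⟩) (by simp)

theorem poch_neg_succ {L : ℕ} (k : ℕ) : poch (-(L : ℝ)) (k + 1) = -L * poch (1 - (L : ℝ)) k := by
  rw [poch_eq_prod, Finset.prod_range_succ', poch_eq_prod, mul_comm]
  congr 1
  · simp
  · exact Finset.prod_congr rfl fun i _ => by push_cast; ring

/-- Three ranges: for n ≤ M no zero occurs; for k ≤ M < n the cancelled pair leaves the factor α of
κ; for k > M the window lies above both zeros, and α cancels against the 1/α in the summand. -/
theorem kappa1_mul_sumA {M : ℕ} {a b α : ℝ} (hα : α ≠ 0)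
    (hab : ∀ i < 2 * M + 1, -((2 * M + 1 : ℕ) + a) / 2 + (i : ℝ) ≠ 0 ∧
      -((2 * M + 1 : ℕ) + b) / 2 + (i : ℝ) ≠ 0)
    {n k : ℕ} (hn : n ≤ 2 * M + 1) (hk : k ≤ n) (x : ℝ) :
    kappa1 (2 * M + 1) a b α n * sumA (2 * M + 1) a b α n k x =
      coefEven M a b α n k * newtonBasis (-(a + b + (2 * M + 1 : ℕ) + 1) / 4) x k := by
  have e1 : (2 * M + 1 - 1) / 2 = M := by omega
  have e2 : (2 * M + 1 + 1) / 2 = M + 1 := by omega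
  have e3 : (1 - ((2 * M + 1 : ℕ) : ℝ)) / 2 = -(M : ℝ) := by push_cast; ring
  have e4 : (n : ℝ) - (2 * M + 1 : ℕ) = -((2 * M + 1 - n : ℕ) : ℝ) := by
    rw [Nat.cast_sub hn]; ring
  have e5 : -(b + (2 * M + 1 : ℕ) + 1 + a) / 4 = -(a + b + (2 * M + 1 : ℕ) + 1) / 4 := by ring
  have e6 : -(b + (2 * M + 1 : ℕ)) / 2 = -((2 * M + 1 : ℕ) + b) / 2 := by ring
  have ha : ∀ m ≤ n, poch (-((2 * M + 1 : ℕ) + a) / 2) m ≠ 0 := fun m hm =>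
    poch_ne_zero fun i hi => (hab i (by omega)).1
  have hb : ∀ m ≤ n, poch (-((2 * M + 1 : ℕ) + b) / 2) m ≠ 0 := fun m hm =>
    poch_ne_zero fun i hi => (hab i (by omega)).2
  have h1 := (poch_one_pos k).ne'
  simp only [kappa1, sumA, coefEven, newtonBasis_eq_poch, e1, e2, e3, e4, e5, e6,
    poch_neg_natCast n]
  rw [Finset.prod_mul_distrib, prod_Ico_poch _ hk (ha k hk), prod_Ico_poch _ hk (hb k hk)]
  have hak := ha k hk
  have hbk := hb k hk
  have := poch_neg_ne_zero (le_refl M)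
  generalize poch (-((2 * M + 1 : ℕ) + a) / 2) k = ak at *
  generalize poch (-((2 * M + 1 : ℕ) + b) / 2) k = bk at *
  generalize poch (-((2 * M + 1 : ℕ) + a) / 2) n = an at *
  generalize poch (-((2 * M + 1 : ℕ) + b) / 2) n = bn at *
  generalize (-(a + b + (2 * M + 1 : ℕ) + 1) / 4) = q at *
  generalize poch (q + x) k = X₁
  generalize poch (q - x) k = X₂
  by_cases hnM : n ≤ M
  · rw [if_pos hnM, if_pos (hk.trans hnM), limitQuot_small hk hnM (by omega)]
    have := poch_neg_ne_zero (show n ≤ 2 * M + 1 - n by omega)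
    have := poch_neg_ne_zero (show k ≤ 2 * M + 1 - n by omega)
    have := poch_neg_ne_zero (show k ≤ M by omega)
    field_simp
  · rw [if_neg hnM]
    have := poch_neg_ne_zero (le_refl (2 * M + 1 - n))
    have := (poch_one_pos (2 * n - (2 * M + 1) - 1)).ne'
    by_cases hkM : k ≤ M
    · rw [if_pos hkM, limitQuot_middle hkM (by omega) (by omega)]
      rw [show n - (2 * M + 1 - n) - 1 = 2 * n - (2 * M + 1) - 1 by omega,
        show n - M - 1 = n - (M + 1) by omega]
      have := poch_neg_ne_zero hkM
      field_simp
    · rw [if_neg hkM, limitQuot_large hk (by omega) (by omega)]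
      rw [show n - (2 * M + 1 - n) - 1 = 2 * n - (2 * M + 1) - 1 by omega,
        show n - M - 1 = n - (M + 1) by omega, show k - M - 1 = k - (M + 1) by omega,
        show k - (2 * M + 1 - n) - 1 = n + k - (2 * M + 1) - 1 by omega]
      have := (poch_one_pos (k - (M + 1))).ne'
      have := (poch_one_pos (n + k - (2 * M + 1) - 1)).ne'
      field_simp

set_option maxHeartbeats 800000 in
theorem kappa2_mul_sumB {M : ℕ} {a b α : ℝ} (hα : α ≠ 0)
    (hab : ∀ i < 2 * M + 1, -((2 * M + 1 : ℕ) + a) / 2 + (i : ℝ) ≠ 0 ∧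
      -((2 * M + 1 : ℕ) + b) / 2 + (i : ℝ) ≠ 0)
    {n k : ℕ} (hn : n < 2 * M + 1) (hnM : n ≠ M) (hk : k ≤ n) (x : ℝ) :
    kappa2 (2 * M + 1) a b α n * sumB (2 * M + 1) a b α n k x =
      coefOdd M a b α n k * newtonBasis (-(a + b + (2 * M + 1 : ℕ) + 1) / 4 + 1) x k := by
  have e1 : (2 * M + 1 - 1) / 2 = M := by omega
  have e2 : (2 * M + 1 - 3) / 2 = M - 1 := by omega
  have e3 : (3 - ((2 * M + 1 : ℕ) : ℝ)) / 2 = 1 - (M : ℝ) := by push_cast; ring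
  have e4 : (n : ℝ) + 1 - (2 * M + 1 : ℕ) = 1 - ((2 * M + 1 - n : ℕ) : ℝ) := by
    rw [Nat.cast_sub hn.le]; ring
  have e5 : -(b + (2 * M + 1 : ℕ) - 3 + a) / 4 = -(a + b + (2 * M + 1 : ℕ) + 1) / 4 + 1 := by ring
  have e6 : (2 - (2 * M + 1 : ℕ) - a) / 2 = -((2 * M + 1 : ℕ) + a) / 2 + 1 := by ring
  have e7 : (2 - (2 * M + 1 : ℕ) - b) / 2 = -((2 * M + 1 : ℕ) + b) / 2 + 1 := by ring
  have ha : ∀ m ≤ n, poch (-((2 * M + 1 : ℕ) + a) / 2 + 1) m ≠ 0 := fun m hm =>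
    poch_ne_zero fun i hi => by
      have := (hab (i + 1) (by omega)).1; push_cast at this ⊢; convert this using 1; ring
  have hb : ∀ m ≤ n, poch (-((2 * M + 1 : ℕ) + b) / 2 + 1) m ≠ 0 := fun m hm =>
    poch_ne_zero fun i hi => by
      have := (hab (i + 1) (by omega)).2; push_cast at this ⊢; convert this using 1; ring
  have h1 := (poch_one_pos k).ne'
  simp only [kappa2, sumB, coefOdd, newtonBasis_eq_poch, e1, e2, e3, e4, e5, e6, e7,
    poch_neg_natCast n]
  rw [Finset.prod_mul_distrib, prod_Ico_poch _ hk (ha k hk), prod_Ico_poch _ hk (hb k hk)]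
  have hak := ha k hk
  have hbk := hb k hk
  generalize poch (-((2 * M + 1 : ℕ) + a) / 2 + 1) k = ak at *
  generalize poch (-((2 * M + 1 : ℕ) + b) / 2 + 1) k = bk at *
  generalize poch (-((2 * M + 1 : ℕ) + a) / 2 + 1) n = an at *
  generalize poch (-((2 * M + 1 : ℕ) + b) / 2 + 1) n = bn at *
  generalize (-(a + b + (2 * M + 1 : ℕ) + 1) / 4 + 1) = q at *
  generalize poch (q + x) k = X₁
  generalize poch (q - x) k = X₂
  have hL : 0 < 2 * M + 1 - n := by omega
  have hLR : ((2 * M + 1 - n : ℕ) : ℝ) ≠ 0 := by positivity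
  rcases lt_or_gt_of_ne hnM with hnM | hnM
  · have hM : (M : ℝ) ≠ 0 := by rw [Nat.cast_ne_zero]; omega
    rw [if_pos hnM, if_pos (by omega), limitQuot_small (by omega) (by omega) (by omega)]
    simp only [poch_neg_succ]
    have := poch_one_sub_ne_zero (show n < 2 * M + 1 - n by omega)
    have := poch_one_sub_ne_zero (show k < 2 * M + 1 - n by omega)
    have := poch_one_sub_ne_zero (show k < M by omega)
    field_simp
  · have hM : (M : ℝ) ≠ 0 := by rw [Nat.cast_ne_zero]; omega
    rw [if_neg (by omega)]
    have := poch_one_sub_ne_zero (show 2 * M + 1 - n - 1 < 2 * M + 1 - n by omega)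
    have := poch_one_sub_ne_zero (show M - 1 < M by omega)
    have := (poch_one_pos (2 * n - (2 * M + 1))).ne'
    by_cases hkM : k < M
    · rw [if_pos hkM, limitQuot_middle (by omega) (by omega) (by omega)]
      -- Writing M = N + 1 and L = l + 1 removes the truncated subtractions, so that `poch_neg_succ`
      -- turns the symbols at -M and -L into those at 1 - M and 1 - L.
      obtain ⟨N, rfl⟩ : ∃ N, M = N + 1 := ⟨M - 1, by omega⟩
      obtain ⟨l, hl⟩ : ∃ l, 2 * (N + 1) + 1 - n = l + 1 := ⟨2 * (N + 1) + 1 - n - 1, by omega⟩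
      have hp : poch (-((N + 1 : ℕ) : ℝ)) (N + 1) =
        -((N + 1 : ℕ) : ℝ) * poch (1 - ((N + 1 : ℕ) : ℝ)) N := poch_neg_succ N
      have hp' : poch (-((l + 1 : ℕ) : ℝ)) (l + 1) =
        -((l + 1 : ℕ) : ℝ) * poch (1 - ((l + 1 : ℕ) : ℝ)) l := poch_neg_succ l
      rw [show 2 * (N + 1) + 1 - n - 1 = l by omega] at *
      rw [show n + 1 - (2 * (N + 1) + 1 - n) - 1 = 2 * n - (2 * (N + 1) + 1) by omega,
        show n + 1 - (N + 1) - 1 = n - (N + 1) by omega]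
      rw [hl] at *
      rw [hp, hp', poch_neg_succ, poch_neg_succ]
      have h2 := poch_one_sub_ne_zero (show k < N + 1 by omega)
      have hd : ((l + 1 : ℕ) : ℝ) ≠ 0 := by positivity
      rw [Nat.add_sub_cancel] at *
      clear hab ha hb hp hp'
      generalize poch (1 - ((N + 1 : ℕ) : ℝ)) N = p at *
      generalize poch (1 - ((N + 1 : ℕ) : ℝ)) k = pk at *
      generalize poch (1 - ((l + 1 : ℕ) : ℝ)) l = r at *
      generalize poch (1 - ((l + 1 : ℕ) : ℝ)) k = rk at *
      generalize poch 1 (2 * n - (2 * (N + 1) + 1)) = f₁ at *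
      generalize poch 1 (n - (N + 1)) = f₂ at *
      generalize poch 1 k = f₃ at *
      generalize ((N + 1 : ℕ) : ℝ) = c at *
      generalize ((l + 1 : ℕ) : ℝ) = d at *
      generalize (n.choose k : ℝ) = ch at *
      field_simp
    · rw [if_neg hkM, limitQuot_large (by omega) (by omega) (by omega)]
      rw [show n + 1 - (2 * M + 1 - n) - 1 = 2 * n - (2 * M + 1) by omega,
        show n + 1 - M - 1 = n - M by omega, show k + 1 - M - 1 = k - M by omega,
        show k + 1 - (2 * M + 1 - n) - 1 = n + k - (2 * M + 1) by omega]
      have h2 := (poch_one_pos (k - M)).ne'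
      have h3 := (poch_one_pos (n + k - (2 * M + 1))).ne'
      clear hab ha hb e3 e4 e5 e6 e7 hLR hM
      generalize poch (1 - ((2 * M + 1 - n : ℕ) : ℝ)) (2 * M + 1 - n - 1) = r at *
      generalize poch (1 - (M : ℝ)) (M - 1) = p at *
      generalize poch 1 (2 * n - (2 * M + 1)) = f₁ at *
      generalize poch 1 (n + k - (2 * M + 1)) = f₂ at *
      generalize poch 1 (n - M) = f₄ at *
      generalize poch 1 (k - M) = f₅ at *
      generalize poch 1 k = f₃ at *
      generalize (n.choose k : ℝ) = ch at *
      field_simp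

theorem limitQuot_self (α : ℝ) {M L n : ℕ} : limitQuot α M L n n = 1 := by
  rw [limitQuot, if_neg (by omega)]; simp

/-- For n = M the window k + 1 ≤ i ≤ M contains the zero numerator i = M whenever k < M, while L = M
+ 1 lies outside it; only the term k = M survives. -/
theorem eval_paraBI_middle (M : ℕ) (a b α x : ℝ) :
    (paraBI (2 * M + 1) a b α (2 * M + 1)).eval x =
      (x - -(a + b + (2 * M + 1 : ℕ) + 1) / 4) *
        ((-1) ^ M * newtonBasis (-(a + b + (2 * M + 1 : ℕ) + 1) / 4 + 1) x M) := by
  rw [eval_paraBI_odd M a b α (by omega), Finset.sum_range_succ, Finset.sum_eq_zero, zero_add]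
  · simp [coefOdd, limitQuot_self]
  · intro k hk
    have hk := Finset.mem_range.1 hk
    rw [coefOdd, limitQuot, if_neg (by omega),
      Finset.prod_eq_zero (Finset.mem_Ico.2 ⟨hk, M.lt_succ_self⟩) (by simp)]
    ring

end Explicit

/-! ### The Dunkl-difference equation -/

section Dunkl

/-- The coefficient of the forward shift in the difference operator of the Wilson polynomials. -/
noncomputable def wilsonShift (q α₁ α₂ α₃ x : ℝ) : ℝ :=
  (x + q) * ((x - q + α₁) * (x - q + α₂) * (x - q + α₃)) / (2 * x * (2 * x + 1))

/-- The difference operator of the Wilson polynomials. -/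
noncomputable def wilsonOp (q α₁ α₂ α₃ : ℝ) (f : ℝ → ℝ) (x : ℝ) : ℝ :=
  wilsonShift q α₁ α₂ α₃ x * (f (x + 1) - f x) + wilsonShift q α₁ α₂ α₃ (-x) * (f (x - 1) - f x)

theorem poch_succ_left (x : ℝ) (k : ℕ) : poch x (k + 1) = x * poch (x + 1) k := by
  rw [poch_eq_prod, Finset.prod_range_succ', poch_eq_prod, mul_comm]
  congr 1
  · simp
  · exact Finset.prod_congr rfl fun i _ => by push_cast; ring

/-- Multiplication by x + q completes (q+x+1)_k to (q+x)_{k+1}, so no division is needed. The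
backward difference is obtained by replacing x with -x. -/
theorem newtonBasis_forward (q x : ℝ) (k : ℕ) :
    (x + q) * (newtonBasis q (x + 1) (k + 1) - newtonBasis q x (k + 1)) =
      -((k + 1) * (2 * x + 1) * (q + x + k)) * newtonBasis q x k := by
  simp only [newtonBasis_eq_poch]
  have h1 : poch (q + x) (k + 1) = (q + x) * poch (q + x + 1) k := poch_succ_left _ _
  have h2 : poch (q - (x + 1)) (k + 1) = (q - x - 1) * poch (q - x) k := by
    rw [poch_succ_left]; congr 1
    · ring
    · congr 1; ring
  have h3 : poch (q + (x + 1)) (k + 1) = poch (q + x + 1) k * (q + x + 1 + k) := by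
    rw [poch_succ, ← add_assoc]
  have h4 : poch (q - x) (k + 1) = poch (q - x) k * (q - x + k) := poch_succ _ _
  have h5 : (q + x) * poch (q + x + 1) k = poch (q + x) k * (q + x + k) := by
    rw [← h1, poch_succ]
  rw [h1, h2, h3, h4]
  linear_combination ((q + x + 1 + k) * (q - x - 1) - (q + x) * (q - x + k)) * poch (q - x) k * h5

theorem newtonBasis_neg (q x : ℝ) (k : ℕ) : newtonBasis q (-x) k = newtonBasis q x k := by
  simp [newtonBasis]

theorem wilsonOp_newtonBasis {q α₁ α₂ α₃ s x : ℝ} (hs : s = α₁ + α₂ + α₃ - 2 * q - 1)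
    (hx : x ≠ 0) (hx1 : 2 * x + 1 ≠ 0) (hx2 : 2 * -x + 1 ≠ 0) (k : ℕ) :
    wilsonOp q α₁ α₂ α₃ (fun y => newtonBasis q y (k + 1)) x =
      (k + 1) * (k + 1 + s) * newtonBasis q x (k + 1) -
        (k + 1) * numer α₁ α₂ α₃ k * newtonBasis q x k := by
  have h1 := newtonBasis_forward q x k
  have h2 := newtonBasis_forward q (-x) k
  rw [newtonBasis_neg, newtonBasis_neg, show -x + 1 = -(x - 1) by ring, newtonBasis_neg] at h2
  have e1 : wilsonShift q α₁ α₂ α₃ x * (newtonBasis q (x + 1) (k + 1) - newtonBasis q x (k + 1)) =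
      -((k + 1) * (q + x + k) * ((x - q + α₁) * (x - q + α₂) * (x - q + α₃)) / (2 * x)) *
        newtonBasis q x k := by
    rw [wilsonShift, div_mul_eq_mul_div, mul_right_comm, h1]
    field_simp
  have hx3 : -x ≠ 0 := neg_ne_zero.2 hx
  have e2 : wilsonShift q α₁ α₂ α₃ (-x) *
      (newtonBasis q (x - 1) (k + 1) - newtonBasis q x (k + 1)) =
      -((k + 1) * (q - x + k) * ((-x - q + α₁) * (-x - q + α₂) * (-x - q + α₃)) / (2 * -x)) *
        newtonBasis q x k := by
    rw [wilsonShift, div_mul_eq_mul_div, mul_right_comm, h2]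
    generalize 2 * -x + 1 = d at *
    generalize hy : -x = y at *
    rw [sub_eq_add_neg q x, hy]
    field_simp
  rw [wilsonOp, e1, e2, newtonBasis_succ, hs, numer]
  generalize newtonBasis q x k = Φ
  rw [mul_neg, div_neg]
  field_simp
  ring

theorem wilsonOp_newtonBasis_zero (q α₁ α₂ α₃ x : ℝ) :
    wilsonOp q α₁ α₂ α₃ (fun y => newtonBasis q y 0) x = 0 := by
  simp [wilsonOp, newtonBasis_zero]

theorem wilsonOp_sum (q α₁ α₂ α₃ x : ℝ) (c : ℕ → ℝ) (n : ℕ) (f : ℕ → ℝ → ℝ) :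
    wilsonOp q α₁ α₂ α₃ (fun y => ∑ k ∈ Finset.range n, c k * f k y) x =
      ∑ k ∈ Finset.range n, c k * wilsonOp q α₁ α₂ α₃ (f k) x := by
  simp only [wilsonOp, ← Finset.sum_sub_distrib, Finset.mul_sum, ← Finset.sum_add_distrib]
  exact Finset.sum_congr rfl fun k _ => by ring

/-- The operator is bidiagonal with diagonal k(k+s), and n(n+s) - k(k+s) = (n-k)(n+s+k); thus `hc`
is the eigenvalue equation read coefficientwise. -/
theorem wilsonOp_eigen {q α₁ α₂ α₃ s x : ℝ} (hs : s = α₁ + α₂ + α₃ - 2 * q - 1)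
    (hx : x ≠ 0) (hx1 : 2 * x + 1 ≠ 0) (hx2 : 2 * -x + 1 ≠ 0) {c : ℕ → ℝ} {n : ℕ}
    (hc : ∀ k, c k * ((n - k) * (n + s + k)) = -((k + 1) * numer α₁ α₂ α₃ k * c (k + 1))) :
    wilsonOp q α₁ α₂ α₃ (fun y => ∑ k ∈ Finset.range (n + 1), c k * newtonBasis q y k) x =
      n * (n + s) * ∑ k ∈ Finset.range (n + 1), c k * newtonBasis q x k := by
  rw [wilsonOp_sum, Finset.sum_range_succ', wilsonOp_newtonBasis_zero, mul_zero, add_zero]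
  simp only [wilsonOp_newtonBasis hs hx hx1 hx2]
  have h1 : ∀ k ∈ Finset.range n, c (k + 1) * ((k + 1) * (k + 1 + s) * newtonBasis q x (k + 1) -
      (k + 1) * numer α₁ α₂ α₃ k * newtonBasis q x k) =
      ((k + 1 : ℕ) * ((k + 1 : ℕ) + s)) * (c (k + 1) * newtonBasis q x (k + 1)) +
        (n - k) * (n + s + k) * (c k * newtonBasis q x k) := fun k _ => by
    push_cast
    linear_combination -newtonBasis q x k * hc k
  rw [Finset.sum_congr rfl h1, Finset.sum_add_distrib]
  have h2 : ∑ k ∈ Finset.range n,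
      ((k + 1 : ℕ) * ((k + 1 : ℕ) + s)) * (c (k + 1) * newtonBasis q x (k + 1)) =
      ∑ k ∈ Finset.range (n + 1), ((k : ℝ) * (k + s)) * (c k * newtonBasis q x k) := by
    rw [Finset.sum_range_succ' _ n]; simp
  have h3 : ∑ k ∈ Finset.range n, ((n : ℝ) - k) * (n + s + k) * (c k * newtonBasis q x k) =
      ∑ k ∈ Finset.range (n + 1), ((n : ℝ) - k) * (n + s + k) * (c k * newtonBasis q x k) := by
    rw [Finset.sum_range_succ _ n]; simp
  rw [h2, h3, ← Finset.sum_add_distrib, Finset.mul_sum]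
  exact Finset.sum_congr rfl fun k _ => by ring

variable {j : ℕ} {a b : ℝ}

/-- On even functions R is the identity, so C drops out and A + D is the coefficient of the forward
difference. -/
theorem dunklZero_even {f : ℝ → ℝ} (hf : ∀ y, f (-y) = f y) {x : ℝ} (hx : x ≠ 0) (hx0 : x + 1 ≠ 0)
    (hx1 : 2 * x + 1 ≠ 0) (hx2 : 2 * -x + 1 ≠ 0) :
    dunklZero j a b f x = wilsonOp (-(a + b + j + 1) / 4) ((1 - j) / 2) (-(j + a) / 2)
      (-(j + b) / 2) f x := by
  have hB : 2 * x - 1 ≠ 0 := fun h => hx2 (by linarith)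
  have h1 : dunklA j a b x + dunklD j a b x = wilsonShift (-(a + b + j + 1) / 4) ((1 - j) / 2)
      (-(j + a) / 2) (-(j + b) / 2) x := by
    simp only [dunklA, dunklD, wilsonShift, rho1, r1]
    field_simp
    ring
  have h2 : dunklB j a b x = wilsonShift (-(a + b + j + 1) / 4) ((1 - j) / 2)
      (-(j + a) / 2) (-(j + b) / 2) (-x) := by
    simp only [dunklB, wilsonShift, rho1, r1]
    rw [show 2 * -x * (2 * -x + 1) = 2 * x * (2 * x - 1) by ring]
    field_simp
    ring
  rw [dunklZero, wilsonOp, ← h1, ← h2]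
  simp only [shiftUp, shiftDown, refl, hf]
  ring

/-- Equivalently, `dunklZero` annihilates the function x ↦ x. This is where the value of
`dunklOmega` matters. -/
theorem two_mul_dunklC {x : ℝ} (hx : x ≠ 0) (hx0 : x + 1 ≠ 0) (hx1 : 2 * x + 1 ≠ 0)
    (hB : 2 * x - 1 ≠ 0) :
    2 * x * dunklC j a b x = dunklA j a b x - dunklB j a b x - dunklD j a b x * (2 * x + 1) := by
  simp only [dunklC, dunklA, dunklB, dunklD, dunklOmega]
  generalize rho1 j a b = ρ
  generalize r1 j a b = r
  generalize (j : ℝ) = J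
  field_simp
  ring

/-- The terms in f(x ± 1) match the shifted Wilson operator by `h1` and `h2`; what is left over is a
multiple of f(x), and it vanishes by `two_mul_dunklC`. -/
theorem dunklZero_odd {f : ℝ → ℝ} (hf : ∀ y, f (-y) = f y) {x : ℝ} (hx : x ≠ 0) (hx0 : x + 1 ≠ 0)
    (hx1 : 2 * x + 1 ≠ 0) (hx2 : 2 * -x + 1 ≠ 0) :
    dunklZero j a b (fun y => (y - -(a + b + j + 1) / 4) * f y) x =
      (x - -(a + b + j + 1) / 4) * wilsonOp (-(a + b + j + 1) / 4 + 1) ((1 - j) / 2 + 1)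
        (-(j + a) / 2 + 1) (-(j + b) / 2 + 1) f x := by
  have hB : 2 * x - 1 ≠ 0 := fun h => hx2 (by linarith)
  set q : ℝ := -(a + b + j + 1) / 4 with hq
  have h1 : dunklA j a b x * (x + 1 - q) - dunklD j a b x * (x + 1 + q) =
      (x - q) * wilsonShift (q + 1) ((1 - j) / 2 + 1) (-(j + a) / 2 + 1) (-(j + b) / 2 + 1) x := by
    simp only [dunklA, dunklD, wilsonShift, rho1, r1, hq]
    field_simp
    ring
  have h2 : dunklB j a b x * (x - 1 - q) =
      (x - q) * wilsonShift (q + 1) ((1 - j) / 2 + 1) (-(j + a) / 2 + 1) (-(j + b) / 2 + 1)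
        (-x) := by
    simp only [dunklB, wilsonShift, rho1, r1, hq]
    rw [show 2 * -x * (2 * -x + 1) = 2 * x * (2 * x - 1) by ring]
    field_simp
    ring
  have h3 := two_mul_dunklC (a := a) (b := b) (j := j) hx hx0 hx1 hB
  rw [dunklZero, wilsonOp]
  simp only [shiftUp, shiftDown, refl, hf]
  linear_combination (f (x + 1) - f x) * h1 + (f (x - 1) - f x) * h2 - f x * h3

theorem dunkl_paraBI (M : ℕ) (a b α β : ℝ) {n : ℕ} (hn : n ≤ 2 * (2 * M + 1)) {x : ℝ} (hx : x ≠ 0)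
    (hx0 : x ≠ -1) (hx2 : x ≠ 1 / 2) (hx1 : x ≠ -1 / 2) :
    dunkl (2 * M + 1) a b β (fun y => (paraBI (2 * M + 1) a b α n).eval y) x =
      dunklEigenvalue (2 * M + 1) β n * (paraBI (2 * M + 1) a b α n).eval x := by
  have hx0' : x + 1 ≠ 0 := fun h => hx0 (by linarith)
  have hx1' : 2 * x + 1 ≠ 0 := fun h => hx1 (by linarith)
  have hx2' : 2 * -x + 1 ≠ 0 := fun h => hx2 (by linarith)
  have eM : -(M : ℝ) = (1 - ((2 * M + 1 : ℕ) : ℝ)) / 2 := by push_cast; ring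
  rcases Nat.even_or_odd' n with ⟨m, rfl | rfl⟩
  · have hm : m ≤ 2 * M + 1 := by omega
    have e : 2 * m / 2 = m := by omega
    simp only [eval_paraBI_even M a b α hm, dunkl, dunklEigenvalue, e, refl, newtonBasis_neg,
      sub_self, mul_zero, add_zero, if_pos (even_two_mul m)]
    rw [dunklZero_even (fun y => by simp only [newtonBasis_neg]) hx hx0' hx1' hx2',
      wilsonOp_eigen (s := -((2 * M + 1 : ℕ) : ℝ)) (by ring) hx hx1' hx2' fun k => ?_]
    · ring
    · have := coefEven_step M a b α hm k
      rwa [eM] at this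
  · have hm : m ≤ 2 * M + 1 := by omega
    have e : (2 * m + 1) / 2 = m := by omega
    simp only [eval_paraBI_odd M a b α hm, dunkl, dunklEigenvalue, e, refl, newtonBasis_neg,
      if_neg (Nat.not_even_two_mul_add_one m)]
    rw [dunklZero_odd (f := fun y => ∑ k ∈ Finset.range (m + 1), coefOdd M a b α m k *
        newtonBasis (-(a + b + (2 * M + 1 : ℕ) + 1) / 4 + 1) y k)
        (fun y => by simp only [newtonBasis_neg]) hx hx0' hx1' hx2',
      wilsonOp_eigen (s := -((2 * M + 1 : ℕ) : ℝ) + 1) (by ring) hx hx1' hx2' fun k => ?_]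
    -- The coefficient of β is (x - q)/(2x), and I - R turns (x - q) f into 2x f for even f; so the
    -- β-term adds exactly β to the eigenvalue.
    · field_simp
      ring
    · have := coefOdd_step M a b α hm k
      rw [eM] at this
      rw [← this]; ring

end Dunkl

/-! ### Signs of the recurrence coefficients u_n -/

section Positivity

variable {M : ℕ} {a b α : ℝ}

theorem coefU_even {m : ℕ} (hm : m ≠ M) : coefU (2 * M + 1) a b α (2 * m + 2) =
    (m + 1) / 8 * ((2 * (m - M) + 1 + a) * (2 * (m - M) + 1 + b) / -(2 * (m - M) + 1)) := by
  have h1 : ¬ Even (2 * m + 1) := Nat.not_even_two_mul_add_one m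
  have h2 : Even (2 * m + 2) := by simp [parity_simps]
  rw [coefU, coefA, coefC, show 2 * m + 2 - 1 = 2 * m + 1 by omega, if_neg h1, if_pos h2,
    if_neg (by omega)]
  push_cast
  rw [show (2 * m + 2 - (2 * M + 1) : ℝ) = 2 * (m - M) + 1 by ring, div_neg]
  ring

theorem coefU_even_middle : coefU (2 * M + 1) a b α (2 * M + 2) =
    (1 - α) * (M + 1) / 4 * (-(1 + a) * (1 + b)) := by
  have h1 : ¬ Even (2 * M + 1) := Nat.not_even_two_mul_add_one M
  have h2 : Even (2 * M + 2) := by simp [parity_simps]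
  rw [coefU, coefA, coefC, show 2 * M + 2 - 1 = 2 * M + 1 by omega, if_neg h1, if_pos h2,
    if_pos rfl]
  push_cast
  rw [show (2 * M + 2 - (2 * M + 1) : ℝ) = 1 by ring]
  ring

theorem coefU_odd {m : ℕ} (hm : m ≠ M) : coefU (2 * M + 1) a b α (2 * m + 1) =
    (2 * M + 1 - m) / 8 * ((2 * (m - M) - 1 - a) * (2 * (m - M) - 1 - b) / (2 * (m - M) - 1)) := by
  have h1 : ¬ Even (2 * m + 1) := Nat.not_even_two_mul_add_one m
  have h2 : Even (2 * m) := by simp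
  rw [coefU, coefA, coefC, show 2 * m + 1 - 1 = 2 * m by omega, if_neg h1, if_pos h2,
    if_neg (by omega)]
  push_cast
  rw [show (2 * m - (2 * M + 1) : ℝ) = 2 * (m - M) - 1 by ring]
  ring

theorem coefU_odd_middle : coefU (2 * M + 1) a b α (2 * M + 1) =
    α * (M + 1) / 4 * (-(1 + a) * (1 + b)) := by
  have h1 : ¬ Even (2 * M + 1) := Nat.not_even_two_mul_add_one M
  have h2 : Even (2 * M) := by simp
  rw [coefU, coefA, coefC, show 2 * M + 1 - 1 = 2 * M by omega, if_neg h1, if_pos h2,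
    if_pos rfl]
  push_cast
  rw [show (2 * M - (2 * M + 1) : ℝ) = -1 by ring]
  ring

theorem coefU_comm (j : ℕ) (a b α : ℝ) (n : ℕ) : coefU j a b α n = coefU j b a α n := by
  rw [coefU, coefU, coefA, coefA, coefC, coefC, mul_comm (_ - a), mul_comm (_ + a)]

theorem coefU_truncation (j : ℕ) (a b α : ℝ) : coefU j a b α (2 * j + 1) = 0 := by
  have h1 : ¬ Even (2 * j + 1) := Nat.not_even_two_mul_add_one j
  rw [coefU, coefC, if_neg h1, if_neg (by omega)]
  push_cast; ring

theorem exists_index {n : ℕ} (h1 : 1 ≤ n) (h2 : n ≤ 2 * (2 * M + 1)) :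
    ∃ m ≤ 2 * M, n = 2 * m + 1 ∨ n = 2 * m + 2 :=
  ⟨(n - 1) / 2, by omega, by omega⟩

theorem coefU_nonneg_aux (hS : a ≤ -(2 * M + 1 : ℕ) ∧ |b| ≤ 1) (h0 : 0 ≤ α) (h1 : α ≤ 1) {n : ℕ}
    (hn : 1 ≤ n) (hn' : n ≤ 2 * (2 * M + 1)) : 0 ≤ coefU (2 * M + 1) a b α n := by
  obtain ⟨ha, hb⟩ := hS
  obtain ⟨hb1, hb2⟩ := abs_le.1 hb
  push_cast at ha
  have hM : (0 : ℝ) ≤ M := M.cast_nonneg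
  obtain ⟨m, hm, rfl | rfl⟩ := exists_index hn hn'
  all_goals
    have hm0 : (0 : ℝ) ≤ m := m.cast_nonneg
    have hmM : (m : ℝ) ≤ 2 * M := by exact_mod_cast hm
    rcases lt_trichotomy m M with h | rfl | h
  · have h' : (m : ℝ) + 1 ≤ M := by exact_mod_cast h
    rw [coefU_odd h.ne]
    exact mul_nonneg (by linarith) (div_nonneg_of_nonpos
      (mul_nonpos_of_nonneg_of_nonpos (by linarith) (by linarith)) (by linarith))
  · rw [coefU_odd_middle]
    exact mul_nonneg (by positivity) (mul_nonneg (by linarith) (by linarith))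
  · have h' : (M : ℝ) + 1 ≤ m := by exact_mod_cast h
    rw [coefU_odd h.ne']
    exact mul_nonneg (by linarith) (div_nonneg (mul_nonneg (by linarith) (by linarith))
      (by linarith))
  · have h' : (m : ℝ) + 1 ≤ M := by exact_mod_cast h
    rw [coefU_even h.ne]
    exact mul_nonneg (by linarith) (div_nonneg (mul_nonneg_of_nonpos_of_nonpos (by linarith)
      (by linarith)) (by linarith))
  · rw [coefU_even_middle]
    exact mul_nonneg (div_nonneg (mul_nonneg (by linarith) (by linarith)) (by norm_num))
      (mul_nonneg (by linarith) (by linarith))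
  · have h' : (M : ℝ) + 1 ≤ m := by exact_mod_cast h
    rw [coefU_even h.ne']
    exact mul_nonneg (by linarith) (div_nonneg_of_nonpos
      (mul_nonpos_of_nonpos_of_nonneg (by linarith) (by linarith)) (by linarith))

theorem coefU_pos_aux (hS : a < -(2 * M + 1 : ℕ) ∧ |b| < 1) (h0 : 0 < α) (h1 : α < 1) {n : ℕ}
    (hn : 1 ≤ n) (hn' : n ≤ 2 * (2 * M + 1)) : 0 < coefU (2 * M + 1) a b α n := by
  obtain ⟨ha, hb⟩ := hS
  obtain ⟨hb1, hb2⟩ := abs_lt.1 hb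
  push_cast at ha
  have hM : (0 : ℝ) ≤ M := M.cast_nonneg
  obtain ⟨m, hm, rfl | rfl⟩ := exists_index hn hn'
  all_goals
    have hm0 : (0 : ℝ) ≤ m := m.cast_nonneg
    have hmM : (m : ℝ) ≤ 2 * M := by exact_mod_cast hm
    rcases lt_trichotomy m M with h | rfl | h
  · have h' : (m : ℝ) + 1 ≤ M := by exact_mod_cast h
    rw [coefU_odd h.ne]
    exact mul_pos (by linarith) (div_pos_of_neg_of_neg
      (mul_neg_of_pos_of_neg (by linarith) (by linarith)) (by linarith))
  · rw [coefU_odd_middle]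
    exact mul_pos (by positivity) (mul_pos (by linarith) (by linarith))
  · have h' : (M : ℝ) + 1 ≤ m := by exact_mod_cast h
    rw [coefU_odd h.ne']
    exact mul_pos (by linarith) (div_pos (mul_pos (by linarith) (by linarith)) (by linarith))
  · have h' : (m : ℝ) + 1 ≤ M := by exact_mod_cast h
    rw [coefU_even h.ne]
    exact mul_pos (by linarith) (div_pos (mul_pos_of_neg_of_neg (by linarith) (by linarith))
      (by linarith))
  · rw [coefU_even_middle]
    exact mul_pos (div_pos (mul_pos (by linarith) (by linarith)) (by norm_num))
      (mul_pos (by linarith) (by linarith))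
  · have h' : (M : ℝ) + 1 ≤ m := by exact_mod_cast h
    rw [coefU_even h.ne']
    exact mul_pos (by linarith) (div_pos_of_neg_of_neg
      (mul_neg_of_neg_of_pos (by linarith) (by linarith)) (by linarith))

theorem coefU_nonneg (hS : (a ≤ -(2 * M + 1 : ℕ) ∧ |b| ≤ 1) ∨ (|a| ≤ 1 ∧ b ≤ -(2 * M + 1 : ℕ)))
    (h0 : 0 ≤ α) (h1 : α ≤ 1) {n : ℕ} (hn : 1 ≤ n) (hn' : n ≤ 2 * (2 * M + 1)) :
    0 ≤ coefU (2 * M + 1) a b α n := by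
  rcases hS with hS | hS
  · exact coefU_nonneg_aux hS h0 h1 hn hn'
  · rw [coefU_comm]; exact coefU_nonneg_aux hS.symm h0 h1 hn hn'

theorem coefU_pos (hS : (a < -(2 * M + 1 : ℕ) ∧ |b| < 1) ∨ (|a| < 1 ∧ b < -(2 * M + 1 : ℕ)))
    (h0 : 0 < α) (h1 : α < 1) {n : ℕ} (hn : 1 ≤ n) (hn' : n ≤ 2 * (2 * M + 1)) :
    0 < coefU (2 * M + 1) a b α n := by
  rcases hS with hS | hS
  · exact coefU_pos_aux hS h0 h1 hn hn'
  · rw [coefU_comm]; exact coefU_pos_aux hS.symm h0 h1 hn hn'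

/-- `h1` separates p < -1 < r, then `h2` gives r < 1, and `h3` pushes p below -c. -/
theorem positivity_converse_aux {p r : ℝ} (hpr : p ≤ r) {c : ℝ} (hc : 1 ≤ c)
    (h1 : 0 < -(1 + p) * (1 + r)) (h2 : 0 < (1 - p) * (1 - r)) (h3 : (c + p) * (c + r) < 0) :
    p < -c ∧ |r| < 1 := by
  have hp : 1 + p < 0 := by
    by_contra! h
    nlinarith [mul_nonneg h (by linarith : 0 ≤ 1 + r)]
  have hr : 0 < 1 + r := by
    by_contra! h
    nlinarith [mul_nonneg (neg_nonneg.2 hp.le) (neg_nonneg.2 h)]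
  have hr' : 0 < 1 - r := (mul_pos_iff_of_pos_left (by linarith)).1 h2
  refine ⟨?_, abs_lt.2 ⟨by linarith, by linarith⟩⟩
  have : c + p < 0 := by
    by_contra! h
    nlinarith [mul_nonneg h (by linarith : 0 ≤ c + r)]
  linarith

theorem positivity_converse (hM : 3 ≤ 2 * M + 1)
    (h : ∀ n ∈ Finset.Icc 1 (2 * (2 * M + 1)), 0 < coefU (2 * M + 1) a b α n) :
    ((a < -(2 * M + 1 : ℕ) ∧ |b| < 1) ∨ (|a| < 1 ∧ b < -(2 * M + 1 : ℕ))) ∧ 0 < α ∧ α < 1 := by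
  have hM1 : (1 : ℝ) ≤ M := by exact_mod_cast (by omega : 1 ≤ M)
  -- Only n = j, j + 1, j + 2 and 2j are used; j ≥ 3 is needed for j + 2 ≤ 2j.
  have e1 := h (2 * M + 1) (Finset.mem_Icc.2 ⟨by omega, by omega⟩)
  have e2 := h (2 * M + 2) (Finset.mem_Icc.2 ⟨by omega, by omega⟩)
  have e3 := h (2 * (M + 1) + 1) (Finset.mem_Icc.2 ⟨by omega, by omega⟩)
  have e4 := h (2 * (2 * M) + 2) (Finset.mem_Icc.2 ⟨by omega, by omega⟩)
  rw [coefU_odd_middle] at e1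
  rw [coefU_even_middle] at e2
  rw [coefU_odd (by omega)] at e3
  rw [coefU_even (by omega)] at e4
  push_cast at e3 e4
  have h3 : 0 < (1 - a) * (1 - b) := by
    rw [show 2 * ((M : ℝ) + 1 - M) - 1 = 1 by ring, div_one] at e3
    exact (mul_pos_iff_of_pos_left (by linarith)).1 e3
  have h4 : (2 * M + 1 + a) * (2 * M + 1 + b) < 0 := by
    rw [show 2 * (2 * (M : ℝ) - M) + 1 = 2 * M + 1 by ring] at e4
    have := (mul_pos_iff_of_pos_left (by positivity)).1 e4
    rw [div_neg, neg_pos] at this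
    by_contra! h5
    exact absurd (div_nonneg h5 (by positivity : (0 : ℝ) ≤ 2 * M + 1)) (not_le.2 this)
  set Q := -(1 + a) * (1 + b) with hQdef
  -- The sum u_j + u_{j+1} is free of α and a positive multiple of Q.
  have hQ : 0 < Q := by nlinarith
  have hα : 0 < α := by
    have := (mul_pos_iff_of_pos_right hQ).1 e1
    by_contra! h5
    nlinarith
  have hα' : α < 1 := by
    have := (mul_pos_iff_of_pos_right hQ).1 e2
    by_contra! h5
    nlinarith
  refine ⟨?_, hα, hα'⟩
  push_cast
  rcases le_total a b with hab | hab
  · exact Or.inl (positivity_converse_aux hab (by linarith) hQ h3 h4)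
  · refine Or.inr (positivity_converse_aux hab (by linarith) ?_ (by linarith) (by linarith)).symm
    rw [hQdef] at hQ; linarith

end Positivity

/-! ### Factorization in the middle and the mirror relation -/

section Mirror

variable {M : ℕ} {a b α : ℝ}

theorem prod_Ico_reflect_sub (c : ℝ) {k n : ℕ} (h : k ≤ n) :
    ∏ i ∈ Finset.Ico k n, (c + 1 - n + i) = ∏ i ∈ Finset.range (n - k), (c - i) := by
  rw [Finset.prod_Ico_eq_prod_range, ← Finset.prod_range_reflect]
  refine Finset.prod_congr rfl fun i hi => ?_
  have hi := Finset.mem_range.1 hi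
  rw [show k + (n - k - 1 - i) = n - 1 - i by omega, Nat.sub_sub, Nat.cast_sub (by omega)]
  push_cast; ring

/-- The coefficients of `∏ (x ^ 2 - (γ + i) ^ 2)` in the basis `newtonBasis`. -/
noncomputable def saalCoef (q γ : ℝ) (n k : ℕ) : ℝ :=
  (-1) ^ k * n.choose k * ((∏ i ∈ Finset.Ico k n, (q + γ + i)) *
    ∏ i ∈ Finset.range (n - k), (q - γ - i))

theorem saalCoef_zero_step (q γ : ℝ) (n : ℕ) :
    saalCoef q γ (n + 1) 0 = (q ^ 2 - (γ + n) ^ 2) * saalCoef q γ n 0 := by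
  simp only [saalCoef, Nat.Ico_zero_eq_range, Nat.sub_zero, Finset.prod_range_succ]
  simp; ring

/-- The effect of the factor x² - (γ+n)² = ((q+k)² - (γ+n)²) - ((q+k)² - x²) on the basis: a
diagonal term and a step up. -/
theorem saalCoef_step (q γ : ℝ) {n k : ℕ} (h : k + 1 ≤ n) :
    saalCoef q γ (n + 1) (k + 1) =
      ((q + (k + 1 : ℕ)) ^ 2 - (γ + n) ^ 2) * saalCoef q γ n (k + 1) - saalCoef q γ n k := by
  have hb : (n.choose (k + 1) : ℝ) * (k + 1) = n.choose k * (n - k) := by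
    have := Nat.choose_succ_right_eq n k
    rw [← Nat.cast_sub (by omega)]
    exact_mod_cast this
  have e1 : n + 1 - (k + 1) = (n - (k + 1)) + 1 := by omega
  have e2 : n - k = (n - (k + 1)) + 1 := by omega
  have e3 : ((n - (k + 1) : ℕ) : ℝ) = n - (k + 1) := by rw [Nat.cast_sub h]; push_cast; ring
  simp only [saalCoef]
  rw [Finset.prod_Ico_succ_top h, e1, e2, Finset.prod_range_succ, e3,
    Finset.prod_eq_prod_Ico_succ_bot (show k < n by omega), Nat.choose_succ_succ', pow_succ]
  push_cast
  linear_combination -(-1) ^ k * (∏ i ∈ Finset.Ico (k + 1) n, (q + γ + i)) *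
    (∏ i ∈ Finset.range (n - (k + 1)), (q - γ - i)) * (q - γ - (n - (k + 1))) * (-1) * hb

/-- A form of the Pfaff-Saalschütz summation. -/
theorem sum_saalCoef (q γ x : ℝ) (n : ℕ) :
    ∑ k ∈ Finset.range (n + 1), saalCoef q γ n k * newtonBasis q x k =
      ∏ i ∈ Finset.range n, (x ^ 2 - (γ + i) ^ 2) := by
  induction n with
  | zero => simp [saalCoef, newtonBasis]
  | succ n ih =>
    have hx : ∀ k ∈ Finset.range (n + 1), saalCoef q γ n k * newtonBasis q x k *
        (x ^ 2 - (γ + n) ^ 2) = ((q + k) ^ 2 - (γ + n) ^ 2) * saalCoef q γ n k *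
          newtonBasis q x k - saalCoef q γ n k * newtonBasis q x (k + 1) := fun k _ => by
      rw [newtonBasis_succ]; ring
    rw [Finset.prod_range_succ, ← ih, Finset.sum_mul, Finset.sum_congr rfl hx,
      Finset.sum_sub_distrib, Finset.sum_range_succ' _ (n + 1),
      Finset.sum_range_succ' (fun k : ℕ => ((q + k) ^ 2 - (γ + n) ^ 2) * saalCoef q γ n k *
        newtonBasis q x k) n, Finset.sum_range_succ _ n,
      Finset.sum_range_succ (fun k => saalCoef q γ n k * newtonBasis q x (k + 1)) n]
    have hlast : saalCoef q γ (n + 1) (n + 1) = -saalCoef q γ n n := by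
      simp [saalCoef, pow_succ]
    have hmid : ∑ k ∈ Finset.range n, saalCoef q γ (n + 1) (k + 1) * newtonBasis q x (k + 1) =
        ∑ k ∈ Finset.range n, ((q + (k + 1 : ℕ)) ^ 2 - (γ + n) ^ 2) * saalCoef q γ n (k + 1) *
          newtonBasis q x (k + 1) -
        ∑ k ∈ Finset.range n, saalCoef q γ n k * newtonBasis q x (k + 1) := by
      rw [← Finset.sum_sub_distrib]
      refine Finset.sum_congr rfl fun k hk => ?_
      rw [saalCoef_step q γ (Finset.mem_range.1 hk)]; ring
    rw [hmid, hlast, saalCoef_zero_step]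
    push_cast; ring

theorem limitQuot_one_self (L k n : ℕ) (hn : n ≤ L + 1) :
    limitQuot 1 L L k n = 1 := by
  by_cases hc : k ≤ L ∧ L < n
  · have hne : (∏ i ∈ Finset.Ico k L, ((i : ℝ) - L)) * ∏ i ∈ Finset.Ico (L + 1) n, ((i : ℝ) - L)
        ≠ 0 := by
      refine mul_ne_zero ?_ ?_ <;> refine Finset.prod_ne_zero_iff.2 fun i hi => natCast_sub_ne ?_
      all_goals have := Finset.mem_Ico.1 hi; omega
    rw [limitQuot, if_pos hc, one_mul, div_self hne]
  · rw [limitQuot, if_neg hc]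
    refine Finset.prod_eq_one fun i hi => div_self (natCast_sub_ne ?_)
    have := Finset.mem_Ico.1 hi; omega

/-- For n = M + 1 the critical indices M and L coincide, and at α = 1 the factors cancel
identically. The ₄F₃ drops to a balanced ₃F₂, which `sum_saalCoef` evaluates as a product. -/
theorem eval_paraBI_one_middle (M : ℕ) (a b x : ℝ) :
    (paraBI (2 * M + 1) a b 1 (2 * M + 2)).eval x =
      ∏ i ∈ Finset.range (M + 1), (x ^ 2 - ((b - a - 2 * M) / 4 + i) ^ 2) := by
  rw [show 2 * M + 2 = 2 * (M + 1) by ring, eval_paraBI_even M a b 1 (by omega),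
    ← sum_saalCoef (-(a + b + (2 * M + 1 : ℕ) + 1) / 4)]
  refine Finset.sum_congr rfl fun k hk => ?_
  have hk : k ≤ M + 1 := by simpa [Nat.lt_succ_iff] using hk
  rw [coefEven, saalCoef, show 2 * M + 1 - (M + 1) = M by omega,
    limitQuot_one_self _ _ _ le_rfl, one_mul, Finset.prod_mul_distrib,
    ← prod_Ico_reflect_sub _ hk]
  congr 3 <;> refine Finset.prod_congr rfl fun i _ => ?_ <;> push_cast <;> ring

theorem eval_paraBI_one (hj : Odd M) (x : ℝ) :
    (paraBI M a b α 1).eval x = x - -(a + b + M + 1) / 4 := by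
  rw [paraBI, eval_sub, eval_X, eval_C, rho1_sub_coefA_sub_coefC hj, if_pos Even.zero]

/-- The diagonal coefficients do not depend on α; fixing them at α = 1/2 leaves the dependence on α
to u_n alone. -/
theorem eval_paraBI_rec (M : ℕ) (a b α : ℝ) (n : ℕ) (x : ℝ) :
    (paraBI (2 * M + 1) a b α (n + 2)).eval x =
      (x - (rho1 (2 * M + 1) a b - coefA (2 * M + 1) a b (1 / 2) (n + 1) -
        coefC (2 * M + 1) a b (1 / 2) (n + 1))) * (paraBI (2 * M + 1) a b α (n + 1)).eval x -
        coefU (2 * M + 1) a b α (n + 1) * (paraBI (2 * M + 1) a b α n).eval x := by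
  rw [eval_paraBI_succ_succ, rho1_sub_coefA_sub_coefC (by simp),
    rho1_sub_coefA_sub_coefC (by simp), coefU, Nat.add_sub_cancel]

theorem coefU_eq_half {n : ℕ} (h1 : n ≠ 2 * M + 1) (h2 : n ≠ 2 * M + 2) :
    coefU (2 * M + 1) a b α n = coefU (2 * M + 1) a b (1 / 2) n := by
  rcases Nat.eq_zero_or_pos n with rfl | h
  · simp [coefU, coefA, coefC]
  · obtain ⟨m, rfl | rfl⟩ : ∃ m, n = 2 * m + 1 ∨ n = 2 * m + 2 := ⟨(n - 1) / 2, by omega⟩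
    · rw [coefU_odd (by omega), coefU_odd (by omega)]
    · rw [coefU_even (by omega), coefU_even (by omega)]

theorem coefU_middle_left :
    coefU (2 * M + 1) a b α (2 * M + 1) = 2 * α * coefU (2 * M + 1) a b (1 / 2) (2 * M + 1) := by
  rw [coefU_odd_middle, coefU_odd_middle]; ring

theorem coefU_middle_right : coefU (2 * M + 1) a b α (2 * M + 2) =
    2 * (1 - α) * coefU (2 * M + 1) a b (1 / 2) (2 * M + 1) := by
  rw [coefU_even_middle, coefU_odd_middle]; ring

theorem coefU_mirror {l : ℕ} (hl : l < 2 * M) : coefU (2 * M + 1) a b α (2 * M + 3 + l) =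
    coefU (2 * M + 1) a b (1 / 2) (2 * M - l) := by
  rcases Nat.even_or_odd' l with ⟨e, rfl | rfl⟩
  · rw [show 2 * M + 3 + 2 * e = 2 * (M + 1 + e) + 1 by ring,
      show 2 * M - 2 * e = 2 * (M - e - 1) + 2 by omega, coefU_odd (by omega), coefU_even (by omega),
      show ((M - e - 1 : ℕ) : ℝ) = M - e - 1 by
        rw [Nat.cast_sub (by omega), Nat.cast_sub (by omega)]; simp]
    push_cast
    rw [show 2 * ((M : ℝ) + 1 + e - M) - 1 = 2 * e + 1 by ring,
      show -(2 * ((M : ℝ) - e - 1 - M) + 1) = 2 * e + 1 by ring]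
    ring
  · rw [show 2 * M + 3 + (2 * e + 1) = 2 * (M + 1 + e) + 2 by ring,
      show 2 * M - (2 * e + 1) = 2 * (M - e - 1) + 1 by omega, coefU_odd (by omega),
      coefU_even (by omega), show ((M - e - 1 : ℕ) : ℝ) = M - e - 1 by
        rw [Nat.cast_sub (by omega), Nat.cast_sub (by omega)]; simp]
    push_cast
    rw [show -(2 * ((M : ℝ) + 1 + e - M) + 1) = -(2 * e + 3) by ring,
      show 2 * ((M : ℝ) - e - 1 - M) - 1 = -(2 * e + 3) by ring]
    ring

/-- The constants relating `P_{j+1+l}` and `P_{j-1-l}` on the grid, with `j = 2 M + 1`. -/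
noncomputable def mirrorConst (M : ℕ) (a b : ℝ) (l : ℕ) : ℝ :=
  ∏ i ∈ Finset.Ico (2 * M + 1 - l) (2 * M + 2), coefU (2 * M + 1) a b (1 / 2) i

theorem mirrorConst_zero : mirrorConst M a b 0 = coefU (2 * M + 1) a b (1 / 2) (2 * M + 1) := by
  simp [mirrorConst]

theorem mirrorConst_succ {l : ℕ} (hl : l < 2 * M) :
    mirrorConst M a b (l + 1) = mirrorConst M a b l * coefU (2 * M + 1) a b (1 / 2) (2 * M - l) := by
  rw [mirrorConst, Finset.prod_eq_prod_Ico_succ_bot (by omega), mul_comm, mirrorConst,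
    show 2 * M + 1 - (l + 1) + 1 = 2 * M + 1 - l by omega,
    show 2 * M + 1 - (l + 1) = 2 * M - l by omega]

/-- The property of a grid point `x` which makes the mirror relation hold with factor `lam`. -/
def IsMirrorPoint (M : ℕ) (a b α x lam : ℝ) : Prop :=
  ((paraBI (2 * M + 1) a b 1 (2 * M + 2)).eval x = 0 ∧ lam = 2 * (1 - α)) ∨
    ((paraBI (2 * M + 1) a b α (2 * M + 1)).eval x = 0 ∧ lam = -(2 * α))

theorem paraBI_congr (α α' : ℝ) {n : ℕ} (hn : n ≤ 2 * M + 1) :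
    paraBI (2 * M + 1) a b α n = paraBI (2 * M + 1) a b α' n := by
  refine Polynomial.funext fun x => ?_
  induction n using Nat.twoStepInduction with
  | zero => simp [paraBI]
  | one => rw [eval_paraBI_one (by simp), eval_paraBI_one (by simp)]
  | more n ih1 ih2 =>
    rw [eval_paraBI_rec, eval_paraBI_rec, ih1 (by omega), ih2 (by omega),
      coefU_eq_half (by omega) (by omega), ← coefU_eq_half (α := α') (by omega) (by omega)]

/-- Two consecutive relations are carried together, since the recurrence has order two. Above the
middle it has the coefficients of the one below in reverse order (`coefU_mirror`). -/
theorem eval_paraBI_mirror {x lam : ℝ} (hx : IsMirrorPoint M a b α x lam) {l : ℕ}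
    (hl : l ≤ 2 * M) :
    (paraBI (2 * M + 1) a b α (2 * M + 2 + l)).eval x =
        lam * mirrorConst M a b l * (paraBI (2 * M + 1) a b α (2 * M - l)).eval x ∧
      coefU (2 * M + 1) a b α (2 * M + 2 + l) *
          (paraBI (2 * M + 1) a b α (2 * M + 1 + l)).eval x =
        lam * mirrorConst M a b l * (paraBI (2 * M + 1) a b α (2 * M + 1 - l)).eval x := by
  induction l with
  | zero =>
    simp only [add_zero, Nat.sub_zero, mirrorConst_zero]
    rw [coefU_middle_right]
    have h1 := eval_paraBI_rec M a b α (2 * M) x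
    rw [coefU_middle_left] at h1
    rcases hx with ⟨hx, rfl⟩ | ⟨hx, rfl⟩
    -- Here P_{j+1} at α = 1 vanishes, so (x - β_j) P_j = 2 u_j(1/2) P_{j-1}; subtracting 2α
    -- u_j(1/2) P_{j-1} leaves the factor 2(1 - α).
    · have h2 := eval_paraBI_rec M a b 1 (2 * M) x
      rw [coefU_middle_left, hx, paraBI_congr 1 α (by omega), paraBI_congr 1 α (by omega)] at h2
      constructor
      · rw [h1]; linear_combination -h2
      · ring
    · rw [hx] at h1 ⊢
      constructor
      · rw [h1]; ring
      · ring
  | succ l ih =>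
    obtain ⟨ih1, ih2⟩ := ih (by omega)
    have hlt : l < 2 * M := by omega
    constructor
    · have h1 := eval_paraBI_rec M a b α (2 * M + 1 + l) x
      have h2 := eval_paraBI_rec M a b α (2 * M - l - 1) x
      rw [show 2 * M - l - 1 + 2 = 2 * M + 1 - l by omega,
        show 2 * M - l - 1 + 1 = 2 * M - l by omega,
        coefU_eq_half (n := 2 * M - l) (by omega) (by omega), rho1_sub_coefA_sub_coefC (by simp)] at h2
      rw [show 2 * M + 1 + l + 2 = 2 * M + 2 + (l + 1) by omega,
        show 2 * M + 1 + l + 1 = 2 * M + 2 + l by omega, ih1, ih2,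
        rho1_sub_coefA_sub_coefC (by simp)] at h1
      have hpar : Even (2 * M + 2 + l) ↔ Even (2 * M - l) := by
        rw [Nat.even_sub (by omega), Nat.even_add]; simp [parity_simps]
      rw [if_congr hpar rfl rfl] at h1
      rw [h1, mirrorConst_succ hlt, show 2 * M - (l + 1) = 2 * M - l - 1 by omega]
      linear_combination -lam * mirrorConst M a b l * h2
    · rw [show 2 * M + 2 + (l + 1) = 2 * M + 3 + l by omega, coefU_mirror hlt,
        show 2 * M + 1 + (l + 1) = 2 * M + 2 + l by omega, ih1, mirrorConst_succ hlt,
        show 2 * M + 1 - (l + 1) = 2 * M - l by omega]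
      ring

/-- At the end of the reflection P_{2j} and u_{2j} P_{2j-1} are the same multiple of P_0 and P_1, so
P_{2j+1} becomes that multiple of (x - β_0) - P_1 = 0. -/
theorem eval_paraBI_last {x lam : ℝ} (hx : IsMirrorPoint M a b α x lam) :
    (paraBI (2 * M + 1) a b α (4 * M + 3)).eval x = 0 := by
  obtain ⟨h1, h2⟩ := eval_paraBI_mirror hx (le_refl (2 * M))
  have h3 := eval_paraBI_rec M a b α (4 * M + 1) x
  rw [show 4 * M + 1 + 2 = 4 * M + 3 by omega, show 4 * M + 1 + 1 = 4 * M + 2 by omega,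
    rho1_sub_coefA_sub_coefC (by simp), if_pos (by simp [parity_simps])] at h3
  rw [show 2 * M + 2 + 2 * M = 4 * M + 2 by omega, Nat.sub_self] at h1
  rw [show 2 * M + 2 + 2 * M = 4 * M + 2 by omega, show 2 * M + 1 + 2 * M = 4 * M + 1 by omega,
    show 2 * M + 1 - 2 * M = 1 by omega, eval_paraBI_one (by simp)] at h2
  rw [h3, h1, h2]
  simp only [paraBI, eval_one]
  ring

end Mirror

/-! ### The bi-lattice and the weights -/

section Grid

variable {M : ℕ} {a b α : ℝ}

theorem grid_zero (M : ℕ) (a b : ℝ) (s : ℕ) :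
    grid (2 * M + 1) a b (4 * s) = (b - a + 2 * M) / 4 - s := by
  rw [grid, show 4 * s / 4 = s by omega, if_pos (by omega)]
  push_cast; ring

theorem grid_one (M : ℕ) (a b : ℝ) (s : ℕ) :
    grid (2 * M + 1) a b (4 * s + 1) = s - (a + b + 2 * M + 2) / 4 := by
  rw [grid, show (4 * s + 1) / 4 = s by omega, if_neg (by omega), if_pos (by omega)]
  push_cast; ring

theorem grid_two (M : ℕ) (a b : ℝ) (s : ℕ) :
    grid (2 * M + 1) a b (4 * s + 2) = s - (b - a + 2 * M) / 4 := by
  rw [grid, show (4 * s + 2) / 4 = s by omega, if_neg (by omega), if_neg (by omega),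
    if_pos (by omega)]
  push_cast; ring

theorem grid_three (M : ℕ) (a b : ℝ) (s : ℕ) :
    grid (2 * M + 1) a b (4 * s + 3) = (a + b + 2 * M + 2) / 4 - 1 - s := by
  rw [grid, show (4 * s + 3) / 4 = s by omega, if_neg (by omega), if_neg (by omega),
    if_neg (by omega)]
  push_cast; ring

theorem grid_index {i : ℕ} (h : i < 4 * M + 3) :
    (∃ s ≤ M, i = 4 * s) ∨ (∃ s ≤ M, i = 4 * s + 1) ∨ (∃ s ≤ M, i = 4 * s + 2) ∨
      ∃ s < M, i = 4 * s + 3 := by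
  obtain h' | h' | h' | h' : i % 4 = 0 ∨ i % 4 = 1 ∨ i % 4 = 2 ∨ i % 4 = 3 := by omega
  · exact Or.inl ⟨i / 4, by omega, by omega⟩
  · exact Or.inr (Or.inl ⟨i / 4, by omega, by omega⟩)
  · exact Or.inr (Or.inr (Or.inl ⟨i / 4, by omega, by omega⟩))
  · exact Or.inr (Or.inr (Or.inr ⟨i / 4, by omega, by omega⟩))

/-- The mirror factor at the grid point with index `i`. -/
noncomputable def mirrorFactor (α : ℝ) (i : ℕ) : ℝ := if Even i then 2 * (1 - α) else -(2 * α)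

/-- The numerator of the weight at the grid point with index `i`. -/
noncomputable def weightFactor (α : ℝ) (i : ℕ) : ℝ := if Even i then 2 * α else -(2 * (1 - α))

theorem isMirrorPoint_grid {i : ℕ} (h : i < 4 * M + 3) :
    IsMirrorPoint M a b α (grid (2 * M + 1) a b i) (mirrorFactor α i) := by
  have heven : ∀ s ≤ M, ∀ x : ℝ, x ^ 2 = ((b - a + 2 * M) / 4 - s) ^ 2 →
      (paraBI (2 * M + 1) a b 1 (2 * M + 2)).eval x = 0 := fun s hs x hx => by
    rw [eval_paraBI_one_middle]
    refine Finset.prod_eq_zero (i := M - s) (Finset.mem_range.2 (by omega)) ?_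
    rw [hx, Nat.cast_sub hs]; ring
  have hodd : ∀ m < M, ∀ x : ℝ, x ^ 2 = ((a + b + 2 * M + 2) / 4 - 1 - m) ^ 2 →
      (paraBI (2 * M + 1) a b α (2 * M + 1)).eval x = 0 := fun m hm x hx => by
    rw [eval_paraBI_middle, newtonBasis, Finset.prod_eq_zero (Finset.mem_range.2 hm)]
    · ring
    · rw [hx]; push_cast; ring
  obtain ⟨s, hs, rfl⟩ | ⟨s, hs, rfl⟩ | ⟨s, hs, rfl⟩ | ⟨s, hs, rfl⟩ := grid_index h
  · refine Or.inl ⟨heven s hs _ (by rw [grid_zero]), if_pos (by simp [parity_simps])⟩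
  · refine Or.inr ⟨?_, if_neg (by simp [parity_simps])⟩
    rcases s with _ | s
    · rw [eval_paraBI_middle, grid_one]; push_cast; ring
    · exact hodd s hs _ (by rw [grid_one]; push_cast; ring)
  · refine Or.inl ⟨heven s hs _ (by rw [grid_two]; ring), if_pos (by simp [parity_simps])⟩
  · exact Or.inr ⟨hodd s hs _ (by rw [grid_three]), if_neg (by simp [parity_simps])⟩

theorem eval_middle_grid_odd {i : ℕ} (h : i < 4 * M + 3) (hi : ¬ Even i) :
    (paraBI (2 * M + 1) a b α (2 * M + 1)).eval (grid (2 * M + 1) a b i) = 0 := by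
  -- P_j does not depend on α; at α = 0 the two possible mirror factors are 2 and 0, and an odd
  -- index has 0.
  have h0 := isMirrorPoint_grid (M := M) (a := a) (b := b) (α := 0) h
  rw [paraBI_congr α 0 le_rfl]
  rcases h0 with ⟨-, h2⟩ | ⟨h1, -⟩
  · rw [mirrorFactor, if_neg hi] at h2; norm_num at h2
  · exact h1

theorem prod_range_four (f : ℕ → ℝ) (M : ℕ) : ∏ i ∈ Finset.range (4 * M + 3), f i =
    (∏ s ∈ Finset.range (M + 1), f (4 * s)) * (∏ s ∈ Finset.range (M + 1), f (4 * s + 1)) *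
      (∏ s ∈ Finset.range (M + 1), f (4 * s + 2)) * ∏ s ∈ Finset.range M, f (4 * s + 3) := by
  induction M with
  | zero => simp [Finset.prod_range_succ]
  | succ M ih =>
    rw [show 4 * (M + 1) + 3 = 4 * M + 3 + 1 + 1 + 1 + 1 by ring, Finset.prod_range_succ,
      Finset.prod_range_succ, Finset.prod_range_succ, Finset.prod_range_succ, ih,
      Finset.prod_range_succ _ (M + 1), Finset.prod_range_succ (fun s => f (4 * s + 1)) (M + 1),
      Finset.prod_range_succ (fun s => f (4 * s + 2)) (M + 1),
      Finset.prod_range_succ (fun s => f (4 * s + 3)) M,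
      show 4 * (M + 1) = 4 * M + 3 + 1 by ring]
    ring

theorem prod_erase_eq_ite {S : Finset ℕ} {i : ℕ} (h : i ∈ S) (f : ℕ → ℝ) :
    ∏ t ∈ S.erase i, f t = ∏ t ∈ S, if t = i then 1 else f t := by
  rw [← Finset.mul_prod_erase S _ h, if_pos rfl, one_mul]
  exact Finset.prod_congr rfl fun t ht => by rw [if_neg (Finset.ne_of_mem_erase ht)]

theorem prod_diag {s N : ℕ} (h : s < N) :
    ∏ t ∈ Finset.range N, (if t = s then (1 : ℝ) else (t : ℝ) - s) =
      poch (-(s : ℝ)) s * poch 1 (N - 1 - s) := by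
  rw [← Finset.prod_range_mul_prod_Ico _ h.le, Finset.prod_eq_prod_Ico_succ_bot h, if_pos rfl,
    one_mul, poch_eq_prod]
  congr 1
  · refine Finset.prod_congr rfl fun t ht => ?_
    rw [if_neg (Finset.mem_range.1 ht).ne]; ring
  · rw [Nat.sub_right_comm, ← div_one (poch 1 (N - s - 1))]
    have := prod_Ico_poch_one (M := s) (k := s + 1) (m := N) (by omega) (by omega)
    rw [show s + 1 - s - 1 = 0 by omega, show poch 1 0 = 1 by simp [poch]] at this
    rw [← this]
    refine Finset.prod_congr rfl fun t ht => ?_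
    have := Finset.mem_Ico.1 ht
    rw [if_neg (by omega)]

theorem prod_diag_neg {s N : ℕ} (h : s < N + 1) :
    ∏ t ∈ Finset.range (N + 1), (if t = s then (1 : ℝ) else (s : ℝ) - t) =
      (-1) ^ N * (poch (-(s : ℝ)) s * poch 1 (N - s)) := by
  have h1 := prod_diag h
  rw [Nat.add_sub_cancel] at h1
  rw [← h1, ← prod_erase_eq_ite (Finset.mem_range.2 h), ← prod_erase_eq_ite (Finset.mem_range.2 h)]
  have hc : N = ((Finset.range (N + 1)).erase s).card := by
    rw [Finset.card_erase_of_mem (Finset.mem_range.2 h)]; simp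
  conv_rhs => rw [hc]
  rw [← Finset.prod_const, ← hc, ← Finset.prod_mul_distrib]
  exact Finset.prod_congr rfl fun t _ => by ring

theorem prod_range_add (c : ℝ) (n : ℕ) (f : ℕ → ℝ) (hf : ∀ t : ℕ, f t = c + t) :
    ∏ t ∈ Finset.range n, f t = poch c n := by
  rw [poch_eq_prod]; exact Finset.prod_congr rfl fun t _ => hf t

theorem prod_range_neg (c : ℝ) (n : ℕ) (f : ℕ → ℝ) (hf : ∀ t : ℕ, f t = -(c + t)) :
    ∏ t ∈ Finset.range n, f t = (-1) ^ n * poch c n := by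
  rw [poch_eq_prod, ← Finset.card_range n, ← Finset.prod_const, Finset.card_range,
    ← Finset.prod_mul_distrib]
  exact Finset.prod_congr rfl fun t _ => by rw [hf]; ring

/-- The weights are barycentric Lagrange weights up to a parity factor. Within a class mod 4 the
differences of grid points are ±(t - s); each other class contributes one Pochhammer symbol. -/
theorem weight_eq {i : ℕ} (h : i < 4 * M + 3) :
    weight (2 * M + 1) a b α i = weightFactor α i * norm (2 * M + 1) a b (1 / 2) (2 * (2 * M + 1)) /
      ∏ t ∈ (Finset.range (4 * M + 3)).erase i,
        (grid (2 * M + 1) a b i - grid (2 * M + 1) a b t) := by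
  rw [prod_erase_eq_ite (Finset.mem_range.2 h), prod_range_four]
  have e1 : (2 * M + 1 - 1) / 2 = M := by omega
  have e2 : (2 * M + 1 + 1) / 2 = M + 1 := by omega
  have e3 : (2 * M + 1 - 3) / 2 = M - 1 := by omega
  rw [weight]
  simp only [e1, e2, e3]
  generalize norm (2 * M + 1) a b (1 / 2) (2 * (2 * M + 1)) = H
  have hε := neg_one_pow_eq_or ℝ M
  obtain ⟨s, hs, rfl⟩ | ⟨s, hs, rfl⟩ | ⟨s, hs, rfl⟩ | ⟨s, hs, rfl⟩ := grid_index h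
  · rw [if_pos (by omega), show 4 * s / 4 = s by omega, weightFactor,
      if_pos (by simp [parity_simps])]
    have h0 : ∏ t ∈ Finset.range (M + 1), (if 4 * t = 4 * s then (1 : ℝ) else
        grid (2 * M + 1) a b (4 * s) - grid (2 * M + 1) a b (4 * t)) =
        poch (-(s : ℝ)) s * poch 1 (M - s) := by
      have hd := prod_diag (s := s) (N := M + 1) (by omega)
      rw [Nat.add_sub_cancel] at hd
      rw [← hd]
      refine Finset.prod_congr rfl fun t _ => ?_
      rw [grid_zero, grid_zero]
      exact if_congr (by omega) rfl (by ring)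
    rw [h0, prod_range_neg (s - (b + (2 * M + 1 : ℕ)) / 2) _ _ fun t => by
        rw [if_neg (by omega), grid_zero, grid_one]; push_cast; ring,
      prod_range_neg (s + (1 + a - b - (2 * M + 1 : ℕ)) / 2) _ _ fun t => by
        rw [if_neg (by omega), grid_zero, grid_two]; push_cast; ring,
      prod_range_add (-(s : ℝ) + (1 - a) / 2) _ _ fun t => by
        rw [if_neg (by omega), grid_zero, grid_three]; ring]
    congr 1
    rw [pow_succ]
    rcases hε with h | h <;> rw [h] <;> ring
  · rw [if_neg (by omega), if_pos (by omega), show (4 * s + 1) / 4 = s by omega, weightFactor,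
      if_neg (by simp [parity_simps])]
    have h0 : ∏ t ∈ Finset.range (M + 1), (if 4 * t + 1 = 4 * s + 1 then (1 : ℝ) else
        grid (2 * M + 1) a b (4 * s + 1) - grid (2 * M + 1) a b (4 * t + 1)) =
        (-1) ^ M * (poch (-(s : ℝ)) s * poch 1 (M - s)) := by
      rw [← prod_diag_neg (N := M) (by omega)]
      refine Finset.prod_congr rfl fun t _ => ?_
      rw [grid_one, grid_one]
      exact if_congr (by omega) rfl (by ring)
    rw [h0, prod_range_add (s - (b + (2 * M + 1 : ℕ)) / 2) _ _ fun t => by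
        rw [if_neg (by omega), grid_one, grid_zero]; push_cast; ring,
      prod_range_neg (-(s : ℝ) + (1 + a) / 2) _ _ fun t => by
        rw [if_neg (by omega), grid_one, grid_two]; ring,
      prod_range_add (s + (1 - a - b - (2 * M + 1 : ℕ)) / 2) _ _ fun t => by
        rw [if_neg (by omega), grid_one, grid_three]; push_cast; ring]
    rw [neg_mul, neg_div, ← div_neg]
    congr 1
    rw [pow_succ]
    rcases hε with h | h <;> rw [h] <;> ring
  · rw [if_neg (by omega), if_neg (by omega), if_pos (by omega), show (4 * s + 2) / 4 = s by omega,
      weightFactor, if_pos (by simp [parity_simps])]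
    have h0 : ∏ t ∈ Finset.range (M + 1), (if 4 * t + 2 = 4 * s + 2 then (1 : ℝ) else
        grid (2 * M + 1) a b (4 * s + 2) - grid (2 * M + 1) a b (4 * t + 2)) =
        (-1) ^ M * (poch (-(s : ℝ)) s * poch 1 (M - s)) := by
      rw [← prod_diag_neg (N := M) (by omega)]
      refine Finset.prod_congr rfl fun t _ => ?_
      rw [grid_two, grid_two]
      exact if_congr (by omega) rfl (by ring)
    rw [h0, prod_range_add (s + (1 + a - b - (2 * M + 1 : ℕ)) / 2) _ _ fun t => by
        rw [if_neg (by omega), grid_two, grid_zero]; push_cast; ring,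
      prod_range_neg (-(s : ℝ) - (1 + a) / 2) _ _ fun t => by
        rw [if_neg (by omega), grid_two, grid_one]; ring,
      prod_range_add (s + (2 - b - (2 * M + 1 : ℕ)) / 2) _ _ fun t => by
        rw [if_neg (by omega), grid_two, grid_three]; push_cast; ring]
    rw [neg_div, ← div_neg]
    congr 1
    rw [pow_succ]
    rcases hε with h | h <;> rw [h] <;> ring
  · rw [if_neg (by omega), if_neg (by omega), if_neg (by omega), show (4 * s + 3) / 4 = s by omega,
      weightFactor, if_neg (by simp [parity_simps])]
    have h0 : ∏ t ∈ Finset.range M, (if 4 * t + 3 = 4 * s + 3 then (1 : ℝ) else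
        grid (2 * M + 1) a b (4 * s + 3) - grid (2 * M + 1) a b (4 * t + 3)) =
        poch (-(s : ℝ)) s * poch 1 (M - 1 - s) := by
      rw [← prod_diag hs]
      refine Finset.prod_congr rfl fun t _ => ?_
      rw [grid_three, grid_three]
      exact if_congr (by omega) rfl (by ring)
    rw [h0, prod_range_add (-(s : ℝ) - (1 - a) / 2) _ _ fun t => by
        rw [if_neg (by omega), grid_three, grid_zero]; ring,
      prod_range_neg (s + (1 - a - b - (2 * M + 1 : ℕ)) / 2) _ _ fun t => by
        rw [if_neg (by omega), grid_three, grid_one]; push_cast; ring,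
      prod_range_neg (s + (2 - b - (2 * M + 1 : ℕ)) / 2) _ _ fun t => by
        rw [if_neg (by omega), grid_three, grid_two]; push_cast; ring]
    rw [neg_mul]
    congr 1
    rw [pow_succ]
    rcases hε with h | h <;> rw [h] <;> ring

theorem false_of_odd {c : ℝ} (h1 : -1 < c) (h2 : c < 1) (z : ℤ) (h : c = ((2 * z + 1 : ℤ) : ℝ)) :
    False := by
  rw [h] at h1 h2
  have h1 : (-1 : ℤ) < 2 * z + 1 := by exact_mod_cast h1
  have h2 : 2 * z + 1 < (1 : ℤ) := by exact_mod_cast h2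
  omega

/-- A coincidence between two classes makes one of a, b an odd integer, or fixes a ± b in a bounded
range. The first is excluded by |a| < 1 or |b| < 1 or by size, the second by size. -/
theorem grid_ne_of_class {i k : ℕ} (hi : i < 4 * M + 3) (hk : k < 4 * M + 3) (hmod : i % 4 < k % 4)
    (hS : (a < -(2 * M + 1 : ℕ) ∧ |b| < 1) ∨ (|a| < 1 ∧ b < -(2 * M + 1 : ℕ))) :
    grid (2 * M + 1) a b i ≠ grid (2 * M + 1) a b k := by
  simp only [abs_lt] at hS
  push_cast at hS
  intro he
  obtain ⟨s, hs, rfl⟩ | ⟨s, hs, rfl⟩ | ⟨s, hs, rfl⟩ | ⟨s, hs, rfl⟩ := grid_index hi <;>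
    obtain ⟨t, ht, rfl⟩ | ⟨t, ht, rfl⟩ | ⟨t, ht, rfl⟩ | ⟨t, ht, rfl⟩ := grid_index hk <;>
    try omega
  all_goals
    have hs0 : (0 : ℝ) ≤ s := s.cast_nonneg
    have ht0 : (0 : ℝ) ≤ t := t.cast_nonneg
    have hsM : (s : ℝ) ≤ M := by exact_mod_cast (by omega : s ≤ M)
    have htM : (t : ℝ) ≤ M := by exact_mod_cast (by omega : t ≤ M)
  · rw [grid_zero, grid_one] at he
    rcases hS with ⟨h1, h2, h3⟩ | ⟨⟨h2, h3⟩, h1⟩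
    · exact false_of_odd h2 h3 (s + t - M - 1) (by push_cast; linarith)
    · linarith
  · rw [grid_zero, grid_two] at he
    rcases hS with ⟨h1, h2, h3⟩ | ⟨⟨h2, h3⟩, h1⟩ <;> linarith
  · rw [grid_zero, grid_three] at he
    rcases hS with ⟨h1, h2, h3⟩ | ⟨⟨h2, h3⟩, h1⟩
    · linarith
    · exact false_of_odd h2 h3 (t - s) (by push_cast; linarith)
  · rw [grid_one, grid_two] at he
    rcases hS with ⟨h1, h2, h3⟩ | ⟨⟨h2, h3⟩, h1⟩
    · linarith
    · exact false_of_odd h2 h3 (s - t - 1) (by push_cast; linarith)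
  · rw [grid_one, grid_three] at he
    have htM' : (t : ℝ) + 1 ≤ M := by exact_mod_cast ht
    rcases hS with ⟨h1, h2, h3⟩ | ⟨⟨h2, h3⟩, h1⟩ <;> linarith
  · rw [grid_two, grid_three] at he
    rcases hS with ⟨h1, h2, h3⟩ | ⟨⟨h2, h3⟩, h1⟩
    · exact false_of_odd h2 h3 (s + t - M) (by push_cast; linarith)
    · linarith

theorem grid_injOn (hS : (a < -(2 * M + 1 : ℕ) ∧ |b| < 1) ∨ (|a| < 1 ∧ b < -(2 * M + 1 : ℕ))) :
    Set.InjOn (grid (2 * M + 1) a b) (Finset.range (4 * M + 3)) := by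
  intro i hi k hk he
  have hi : i < 4 * M + 3 := by simpa using hi
  have hk : k < 4 * M + 3 := by simpa using hk
  rcases lt_trichotomy (i % 4) (k % 4) with h | h | h
  · exact absurd he (grid_ne_of_class hi hk h hS)
  · have : i / 4 = k / 4 := by
      have hmul : i = 4 * (i / 4) + i % 4 := by omega
      have hmulk : k = 4 * (k / 4) + k % 4 := by omega
      rw [← h] at hmulk
      have hc : i % 4 < 4 := Nat.mod_lt _ (by norm_num)
      generalize i / 4 = s at *
      generalize k / 4 = t at *
      generalize i % 4 = c at *
      subst hmul hmulk
      have : (s : ℝ) = t := by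
        interval_cases c
        · simp only [add_zero, grid_zero] at he; linarith
        · rw [grid_one, grid_one] at he; linarith
        · rw [grid_two, grid_two] at he; linarith
        · rw [grid_three, grid_three] at he; linarith
      exact_mod_cast this
    omega
  · exact absurd he.symm (grid_ne_of_class hk hi h hS)

end Grid

/-! ### The norms as products of the u_n -/

section Norm

variable {M : ℕ} {a b α : ℝ}

/-- At α = 1/2 the generic formula also covers the middle index, so the products below need no case
distinction. -/
theorem coefU_half_odd (m : ℕ) : coefU (2 * M + 1) a b (1 / 2) (2 * m + 1) =
    (2 * M + 1 - m) / 8 * ((2 * (m - M) - 1 - a) * (2 * (m - M) - 1 - b) / (2 * (m - M) - 1)) := by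
  rcases eq_or_ne m M with rfl | h
  · rw [coefU_odd_middle, sub_self, mul_zero, zero_sub]; ring
  · exact coefU_odd h

theorem coefU_half_even (m : ℕ) : coefU (2 * M + 1) a b (1 / 2) (2 * m + 2) =
    (m + 1) / 8 * ((2 * (m - M) + 1 + a) * (2 * (m - M) + 1 + b) / -(2 * (m - M) + 1)) := by
  rcases eq_or_ne m M with rfl | h
  · rw [coefU_even_middle, sub_self, mul_zero, zero_add]; ring
  · exact coefU_even h

/-- The radicand of `h_{2m}`. -/
noncomputable def radicandEven (j : ℕ) (a b : ℝ) (m : ℕ) : ℝ :=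
  poch (-(j : ℝ)) m * poch 1 m * poch ((2 + a - j) / 2) m * poch (-(j + a) / 2) m *
      poch ((2 + b - j) / 2) m * poch (-(j + b) / 2) m /
    (poch ((2 - (j : ℝ)) / 2) m * poch (-(j : ℝ) / 2) m)

/-- The radicand of `h_{2m+1}`. -/
noncomputable def radicandOdd (j : ℕ) (a b : ℝ) (m : ℕ) : ℝ :=
  -1 * poch (-(j : ℝ)) (m + 1) * poch 1 m * poch ((2 + a - j) / 2) m *
      poch (-(j + a) / 2) (m + 1) * poch ((2 + b - j) / 2) m * poch (-(j + b) / 2) (m + 1) /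
    (poch ((2 - (j : ℝ)) / 2) m * poch (-(j : ℝ) / 2) (m + 1))

theorem radicandOdd_eq (m : ℕ) : radicandOdd (2 * M + 1) a b m =
    4 * coefU (2 * M + 1) a b (1 / 2) (2 * m + 1) * radicandEven (2 * M + 1) a b m := by
  rw [coefU_half_odd, radicandOdd, radicandEven]
  simp only [poch_succ]
  have h2 : -((2 * M + 1 : ℕ) : ℝ) / 2 + m = (2 * ((m : ℝ) - M) - 1) / 2 := by push_cast; ring
  have h3 : -((2 * M + 1 : ℕ) : ℝ) + m = -(2 * M + 1 - m) := by push_cast; ring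
  have h4 : ∀ c : ℝ, -((2 * M + 1 : ℕ) + c) / 2 + m = (2 * ((m : ℝ) - M) - 1 - c) / 2 :=
    fun c => by push_cast; ring
  rw [h2, h3, h4, h4]
  generalize 2 * ((m : ℝ) - M) - 1 = v
  generalize poch (-((2 * M + 1 : ℕ) : ℝ)) m = p₁
  generalize poch 1 m = p₂
  generalize poch ((2 + a - (2 * M + 1 : ℕ)) / 2) m = p₃
  generalize poch ((2 + b - (2 * M + 1 : ℕ)) / 2) m = p₄
  generalize poch (-((2 * M + 1 : ℕ) + a) / 2) m = p₅
  generalize poch (-((2 * M + 1 : ℕ) + b) / 2) m = p₆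
  generalize poch ((2 - ((2 * M + 1 : ℕ) : ℝ)) / 2) m = p₇
  generalize poch (-((2 * M + 1 : ℕ) : ℝ) / 2) m = p₈
  ring

theorem radicandEven_succ (m : ℕ) : radicandEven (2 * M + 1) a b (m + 1) =
    4 * coefU (2 * M + 1) a b (1 / 2) (2 * m + 2) * radicandOdd (2 * M + 1) a b m := by
  rw [coefU_half_even, radicandOdd, radicandEven]
  simp only [poch_succ]
  have h2 : (2 - ((2 * M + 1 : ℕ) : ℝ)) / 2 + m = (2 * ((m : ℝ) - M) + 1) / 2 := by
    push_cast; ring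
  have h4 : ∀ c : ℝ, (2 + c - (2 * M + 1 : ℕ)) / 2 + m = (2 * ((m : ℝ) - M) + 1 + c) / 2 :=
    fun c => by push_cast; ring
  rw [h2, h4, h4]
  generalize 2 * ((m : ℝ) - M) + 1 = v
  generalize poch (-((2 * M + 1 : ℕ) : ℝ)) m * (-((2 * M + 1 : ℕ) : ℝ) + m) = p₁
  generalize poch (-((2 * M + 1 : ℕ) + a) / 2) m * (-((2 * M + 1 : ℕ) + a) / 2 + m) = p₅
  generalize poch (-((2 * M + 1 : ℕ) + b) / 2) m * (-((2 * M + 1 : ℕ) + b) / 2 + m) = p₆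
  generalize poch (-((2 * M + 1 : ℕ) : ℝ) / 2) m * (-((2 * M + 1 : ℕ) : ℝ) / 2 + m) = p₈
  generalize poch 1 m = p₂
  generalize poch ((2 + a - (2 * M + 1 : ℕ)) / 2) m = p₃
  generalize poch ((2 + b - (2 * M + 1 : ℕ)) / 2) m = p₄
  generalize poch ((2 - ((2 * M + 1 : ℕ) : ℝ)) / 2) m = p₇
  ring

theorem prod_coefU_half (m : ℕ) :
    ∏ i ∈ Finset.Icc 1 (2 * m), coefU (2 * M + 1) a b (1 / 2) i =
      radicandEven (2 * M + 1) a b m / (2 ^ (2 * m)) ^ 2 := by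
  induction m with
  | zero => simp [radicandEven, poch]
  | succ m ih =>
    rw [show 2 * (m + 1) = 2 * m + 1 + 1 by ring, Finset.prod_Icc_succ_top (by omega),
      Finset.prod_Icc_succ_top (by omega), ih, radicandEven_succ, radicandOdd_eq]
    rw [pow_succ, pow_succ]
    field_simp
    ring

theorem prod_coefU_half_odd (m : ℕ) :
    ∏ i ∈ Finset.Icc 1 (2 * m + 1), coefU (2 * M + 1) a b (1 / 2) i =
      radicandOdd (2 * M + 1) a b m / (2 ^ (2 * m + 1)) ^ 2 := by
  rw [Finset.prod_Icc_succ_top (by omega), prod_coefU_half, radicandOdd_eq, pow_succ]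
  field_simp
  ring

theorem normBase_eq (n : ℕ) : normBase (2 * M + 1) a b n =
    Real.sqrt (∏ i ∈ Finset.Icc 1 n, coefU (2 * M + 1) a b (1 / 2) i) := by
  have h2 : ∀ n : ℕ, (0 : ℝ) ≤ 2 ^ n := fun n => by positivity
  rcases Nat.even_or_odd' n with ⟨m, rfl | rfl⟩
  · rw [prod_coefU_half, Real.sqrt_div' _ (by positivity), Real.sqrt_sq (h2 _), normBase,
      if_pos (by simp), show 2 * m / 2 = m by omega, radicandEven]
  · rw [prod_coefU_half_odd, Real.sqrt_div' _ (by positivity), Real.sqrt_sq (h2 _), normBase,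
      if_neg (by simp), show (2 * m + 1) / 2 = m by omega, radicandOdd]

theorem prod_coefU (M : ℕ) (a b α : ℝ) (n : ℕ) :
    ∏ i ∈ Finset.Icc 1 n, coefU (2 * M + 1) a b α i =
      (∏ i ∈ Finset.Icc 1 n, coefU (2 * M + 1) a b (1 / 2) i) *
        if n < 2 * M + 1 then 1 else if n = 2 * M + 1 then 2 * α else 4 * (α * (1 - α)) := by
  induction n with
  | zero => simp
  | succ n ih =>
    rw [Finset.prod_Icc_succ_top (by omega), Finset.prod_Icc_succ_top (by omega), ih]
    rcases lt_trichotomy (n + 1) (2 * M + 1) with h | h | h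
    · rw [if_pos (by omega), if_pos h, coefU_eq_half (by omega) (by omega)]; ring
    · rw [if_pos (by omega), if_neg (by omega), if_pos h, h, coefU_middle_left]; ring
    · rw [if_neg (show ¬ n < 2 * M + 1 by omega), if_neg (show ¬ n + 1 < 2 * M + 1 by omega),
        if_neg (show n + 1 ≠ 2 * M + 1 by omega)]
      by_cases h' : n = 2 * M + 1
      · rw [if_pos h', h', coefU_middle_right,
          coefU_middle_right (α := 1 / 2)]; ring
      · rw [if_neg h', coefU_eq_half (by omega) (by omega)]; ring

theorem normFactor_eq (n : ℕ) : normFactor (2 * M + 1) α n =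
    Real.sqrt (if n < 2 * M + 1 then 1 else if n = 2 * M + 1 then 2 * α else 4 * (α * (1 - α))) := by
  have h4 : Real.sqrt (4 * (α * (1 - α))) = 2 * Real.sqrt (α * (1 - α)) := by
    rw [Real.sqrt_mul (by norm_num), show (4 : ℝ) = 2 ^ 2 by norm_num, Real.sqrt_sq (by norm_num)]
  have e1 : (2 * M + 1 - 1) / 2 = M := by omega
  rw [normFactor]
  simp only [e1]
  rcases Nat.even_or_odd' n with ⟨m, rfl | rfl⟩
  · rw [if_pos (by simp), show 2 * m / 2 = m by omega]
    by_cases h : m ≤ M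
    · rw [if_pos h, if_pos (by omega), Real.sqrt_one]
    · rw [if_neg h, if_neg (by omega), if_neg (by omega), h4]
  · rw [if_neg (by simp), show (2 * m + 1) / 2 = m by omega]
    rcases lt_trichotomy m M with h | h | h
    · rw [if_pos h, if_pos (by omega), Real.sqrt_one]
    · rw [if_neg (by omega), if_pos h, if_neg (by omega), if_pos (by omega)]
    · rw [if_neg (by omega), if_neg (by omega), if_neg (by omega), if_neg (by omega), h4]

theorem norm_eq_sqrt (hS : (a < -(2 * M + 1 : ℕ) ∧ |b| < 1) ∨ (|a| < 1 ∧ b < -(2 * M + 1 : ℕ)))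
    {n : ℕ} (hn : n ≤ 2 * (2 * M + 1)) :
    norm (2 * M + 1) a b α n =
      Real.sqrt (∏ i ∈ Finset.Icc 1 n, coefU (2 * M + 1) a b α i) := by
  rw [norm, normBase_eq, normFactor_eq, prod_coefU M a b α n, Real.sqrt_mul]
  refine Finset.prod_nonneg fun i hi => ?_
  have hi := Finset.mem_Icc.1 hi
  exact (coefU_pos hS (by norm_num) (by norm_num) hi.1 (hi.2.trans hn)).le

theorem mirrorConst_pos (hS : (a < -(2 * M + 1 : ℕ) ∧ |b| < 1) ∨ (|a| < 1 ∧ b < -(2 * M + 1 : ℕ)))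
    {l : ℕ} (hl : l ≤ 2 * M) : 0 < mirrorConst M a b l :=
  Finset.prod_pos fun i hi => by
    have hi := Finset.mem_Ico.1 hi
    exact coefU_pos hS (by norm_num) (by norm_num) (by omega) (by omega)

/-- At α = 1/2 the sequence u_1, …, u_{2j} is a palindrome, so its product is the square of u_1 ⋯
u_j. -/
theorem norm_half_eq_mirrorConst
    (hS : (a < -(2 * M + 1 : ℕ) ∧ |b| < 1) ∨ (|a| < 1 ∧ b < -(2 * M + 1 : ℕ))) :
    norm (2 * M + 1) a b (1 / 2) (2 * (2 * M + 1)) = mirrorConst M a b (2 * M) := by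
  rw [norm_eq_sqrt hS le_rfl]
  have h : ∏ i ∈ Finset.Icc 1 (2 * (2 * M + 1)), coefU (2 * M + 1) a b (1 / 2) i =
      mirrorConst M a b (2 * M) ^ 2 := by
    have key : ∀ l ≤ 2 * M, ∏ i ∈ Finset.Ico (2 * M + 2) (2 * M + 3 + l),
        coefU (2 * M + 1) a b (1 / 2) i = mirrorConst M a b l := by
      intro l hl
      induction l with
      | zero =>
        rw [add_zero, Finset.prod_Ico_succ_top (by omega), Finset.Ico_self, Finset.prod_empty,
          one_mul, coefU_middle_right, mirrorConst_zero]
        ring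
      | succ l ih =>
        rw [← add_assoc, Finset.prod_Ico_succ_top (by omega), ih (by omega),
          mirrorConst_succ (by omega), coefU_mirror (by omega)]
    rw [← Finset.Ico_add_one_right_eq_Icc, ← Finset.prod_Ico_consecutive _
      (show 1 ≤ 2 * M + 2 by omega) (show 2 * M + 2 ≤ 2 * (2 * M + 1) + 1 by omega),
      show 2 * (2 * M + 1) + 1 = 2 * M + 3 + 2 * M by ring, key _ le_rfl, mirrorConst,
      show 2 * M + 1 - 2 * M = 1 by omega, sq]
  rw [h, Real.sqrt_sq (mirrorConst_pos hS le_rfl).le]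

end Norm

/-! ### Discrete orthogonality on the grid -/

section Orthogonality

variable {M : ℕ} {a b α : ℝ}

theorem paraBI_monic_natDegree (j : ℕ) (a b α : ℝ) (n : ℕ) :
    (paraBI j a b α n).Monic ∧ (paraBI j a b α n).natDegree = n := by
  induction n using Nat.twoStepInduction with
  | zero => simp [paraBI]
  | one =>
    rw [paraBI]
    exact ⟨monic_X_sub_C _, natDegree_X_sub_C _⟩
  | more n ih1 ih2 =>
    rw [paraBI]
    set c := rho1 j a b - coefA j a b α (n + 1) - coefC j a b α (n + 1)
    have hm : ((X - C c) * paraBI j a b α (n + 1)).Monic := (monic_X_sub_C c).mul ih2.1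
    have hd : ((X - C c) * paraBI j a b α (n + 1)).natDegree = n + 2 := by
      rw [(monic_X_sub_C c).natDegree_mul ih2.1, natDegree_X_sub_C, ih2.2]; ring
    have hlt : (C (coefA j a b α n * coefC j a b α (n + 1)) * paraBI j a b α n).natDegree <
        ((X - C c) * paraBI j a b α (n + 1)).natDegree := by
      rw [hd]
      exact (natDegree_C_mul_le _ _).trans_lt (by rw [ih1.2]; omega)
    exact ⟨hm.sub_of_left (degree_lt_degree hlt), by
      rw [natDegree_sub_eq_left_of_natDegree_lt hlt, hd]⟩

theorem coeff_paraBI_of_lt {j n N : ℕ} (h : n < N) : (paraBI j a b α n).coeff N = 0 :=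
  coeff_eq_zero_of_natDegree_lt (by rw [(paraBI_monic_natDegree j a b α n).2]; exact h)

theorem coeff_paraBI_self (j n : ℕ) : (paraBI j a b α n).coeff n = 1 := by
  have h := paraBI_monic_natDegree j a b α n
  have := h.1.coeff_natDegree
  rwa [h.2] at this

/-- On polynomials of degree at most 2j, the divided difference over the 2j + 1 nodes is the
coefficient of x^{2j}. -/
theorem sum_eval_div_grid
    (hS : (a < -(2 * M + 1 : ℕ) ∧ |b| < 1) ∨ (|a| < 1 ∧ b < -(2 * M + 1 : ℕ)))
    {n : ℕ} (hn : n < 4 * M + 3) (α : ℝ) :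
    ∑ i ∈ Finset.range (4 * M + 3), (paraBI (2 * M + 1) a b α n).eval (grid (2 * M + 1) a b i) /
      ∏ t ∈ (Finset.range (4 * M + 3)).erase i,
        (grid (2 * M + 1) a b i - grid (2 * M + 1) a b t) =
      (paraBI (2 * M + 1) a b α n).coeff (4 * M + 2) := by
  have h := Lagrange.coeff_eq_sum (s := Finset.range (4 * M + 3)) (grid_injOn hS)
    (P := paraBI (2 * M + 1) a b α n) ?_
  · rw [← h, Finset.card_range]; rfl
  · refine degree_le_natDegree.trans_lt ?_
    rw [(paraBI_monic_natDegree _ a b α n).2, Finset.card_range]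
    exact_mod_cast hn

theorem sum_weight_paraBI
    (hS : (a < -(2 * M + 1 : ℕ) ∧ |b| < 1) ∨ (|a| < 1 ∧ b < -(2 * M + 1 : ℕ)))
    {n : ℕ} (hn : n ≤ 4 * M + 3) :
    ∑ i ∈ Finset.range (4 * M + 3), weight (2 * M + 1) a b α i *
      (paraBI (2 * M + 1) a b α n).eval (grid (2 * M + 1) a b i) = if n = 0 then 1 else 0 := by
  set K := norm (2 * M + 1) a b (1 / 2) (2 * (2 * M + 1)) with hK
  set D : ℕ → ℝ := fun i => ∏ t ∈ (Finset.range (4 * M + 3)).erase i,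
        (grid (2 * M + 1) a b i - grid (2 * M + 1) a b t) with hD
  set x := grid (2 * M + 1) a b with hx
  have hw : ∀ i ∈ Finset.range (4 * M + 3), weight (2 * M + 1) a b α i =
      weightFactor α i * K / D i := fun i hi => weight_eq (Finset.mem_range.1 hi)
  have hsum := fun (α : ℝ) (m : ℕ) (hm : m < 4 * M + 3) => sum_eval_div_grid hS hm α
  obtain h | rfl | ⟨l, hl, rfl⟩ | rfl : n < 2 * M + 1 ∨ n = 2 * M + 1 ∨
      (∃ l ≤ 2 * M, n = 2 * M + 2 + l) ∨ n = 4 * M + 3 := by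
    by_cases h1 : n ≤ 2 * M + 1
    · omega
    · by_cases h2 : n = 4 * M + 3
      · exact Or.inr (Or.inr (Or.inr h2))
      · exact Or.inr (Or.inr (Or.inl ⟨n - (2 * M + 2), by omega, by omega⟩))
  · obtain ⟨l, hl, rfl⟩ : ∃ l ≤ 2 * M, n = 2 * M - l := ⟨2 * M - n, by omega, by omega⟩
    have hκ := mirrorConst_pos hS hl
    -- The parity factor of the weight is (±1) + (2α - 1), with ±1 the mirror factor at α = 1/2. The
    -- first part replaces P_n by a multiple of P_{2j-n}, whose coefficient of x^{2j} is 1 only for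
    -- n = 0; the second part has too low a degree.
    have hterm : ∀ i ∈ Finset.range (4 * M + 3),
        mirrorConst M a b l * (weight (2 * M + 1) a b α i *
          (paraBI (2 * M + 1) a b α (2 * M - l)).eval (x i)) =
        K * ((paraBI (2 * M + 1) a b (1 / 2) (2 * M + 2 + l)).eval (x i) / D i) +
          K * (2 * α - 1) * mirrorConst M a b l *
            ((paraBI (2 * M + 1) a b (1 / 2) (2 * M - l)).eval (x i) / D i) := fun i hi => by
      have hm := (eval_paraBI_mirror (isMirrorPoint_grid (M := M) (a := a) (b := b) (α := 1 / 2)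
        (Finset.mem_range.1 hi)) hl).1
      rw [hx, hm, hw i hi, paraBI_congr α (1 / 2) (by omega), weightFactor, mirrorFactor]
      split_ifs <;> ring
    have hS' : mirrorConst M a b l * ∑ i ∈ Finset.range (4 * M + 3),
        weight (2 * M + 1) a b α i * (paraBI (2 * M + 1) a b α (2 * M - l)).eval (x i) =
        K * (paraBI (2 * M + 1) a b (1 / 2) (2 * M + 2 + l)).coeff (4 * M + 2) := by
      rw [Finset.mul_sum, Finset.sum_congr rfl hterm, Finset.sum_add_distrib, ← Finset.mul_sum,
        ← Finset.mul_sum, hsum _ _ (by omega), hsum _ _ (by omega),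
        coeff_paraBI_of_lt (show 2 * M - l < 4 * M + 2 by omega)]
      ring
    rcases hl.eq_or_lt with rfl | hl'
    · rw [show 2 * M + 2 + 2 * M = 4 * M + 2 by ring, coeff_paraBI_self, hK,
        norm_half_eq_mirrorConst hS, mul_one] at hS'
      rw [if_pos (by omega)]
      exact mul_left_cancel₀ hκ.ne' (by rw [hS', mul_one])
    · rw [coeff_paraBI_of_lt (by omega), mul_zero] at hS'
      rw [if_neg (by omega)]
      exact (mul_eq_zero.1 hS').resolve_left hκ.ne'
  -- P_j vanishes at the points of odd index, so the parity factor may be replaced by the constant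
  -- 2α.
  · have hterm : ∀ i ∈ Finset.range (4 * M + 3), weight (2 * M + 1) a b α i *
          (paraBI (2 * M + 1) a b α (2 * M + 1)).eval (x i) =
        2 * α * K * ((paraBI (2 * M + 1) a b α (2 * M + 1)).eval (x i) / D i) := fun i hi => by
      by_cases he : Even i
      · rw [hw i hi, weightFactor, if_pos he]; ring
      · rw [hx, eval_middle_grid_odd (Finset.mem_range.1 hi) he]; simp
    rw [Finset.sum_congr rfl hterm, ← Finset.mul_sum, hsum _ _ (by omega),
      coeff_paraBI_of_lt (by omega), mul_zero, if_neg (by omega)]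
  -- The weight factor times the mirror factor is 4α(1 - α) for both parities, and the reflected
  -- polynomial has low degree.
  · have hterm : ∀ i ∈ Finset.range (4 * M + 3), weight (2 * M + 1) a b α i *
          (paraBI (2 * M + 1) a b α (2 * M + 2 + l)).eval (x i) =
        4 * α * (1 - α) * K * mirrorConst M a b l *
          ((paraBI (2 * M + 1) a b α (2 * M - l)).eval (x i) / D i) := fun i hi => by
      have hm := (eval_paraBI_mirror (isMirrorPoint_grid (M := M) (a := a) (b := b) (α := α)
        (Finset.mem_range.1 hi)) hl).1
      rw [hx, hm, hw i hi, weightFactor, mirrorFactor]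
      split_ifs <;> ring
    rw [Finset.sum_congr rfl hterm, ← Finset.mul_sum, hsum _ _ (by omega),
      coeff_paraBI_of_lt (by omega), mul_zero, if_neg (by omega)]
  · rw [if_neg (by omega)]
    refine Finset.sum_eq_zero fun i hi => ?_
    rw [hx, eval_paraBI_last (isMirrorPoint_grid (Finset.mem_range.1 hi)), mul_zero]

/-- Polynomials with a three-term recurrence which terminates on the nodes `x i` are orthogonal
as soon as the functional kills all but the first of them. -/
theorem orthogonal_of_recurrence {ι : Type*} (S : Finset ι) (w : ι → ℝ) (p : ℕ → ι → ℝ) (x : ι → ℝ)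
    (β u : ℕ → ℝ) {N : ℕ} (h0 : ∀ i ∈ S, p 0 i = 1) (h1 : ∀ i ∈ S, p 1 i = x i - β 0)
    (hrec : ∀ n, ∀ i ∈ S, p (n + 2) i = (x i - β (n + 1)) * p (n + 1) i - u (n + 1) * p n i)
    (hN : ∀ i ∈ S, p (N + 1) i = 0)
    (hw : ∀ n ≤ N + 1, ∑ i ∈ S, w i * p n i = if n = 0 then 1 else 0) {n m : ℕ} (hn : n ≤ N)
    (hm : m ≤ N + 1) :
    ∑ i ∈ S, w i * p n i * p m i = if n = m then ∏ k ∈ Finset.Icc 1 n, u k else 0 := by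
  set B : ℕ → ℕ → ℝ := fun n m => ∑ i ∈ S, w i * p n i * p m i with hB
  set Y : ℕ → ℕ → ℝ := fun n m => ∑ i ∈ S, w i * (x i * p n i) * p m i with hY
  have hsymm : ∀ n m, Y n m = Y m n := fun n m => Finset.sum_congr rfl fun i _ => by ring
  have hY0 : ∀ m, Y 0 m = B 1 m + β 0 * B 0 m := fun m => by
    simp only [hY, hB, Finset.mul_sum, ← Finset.sum_add_distrib]
    refine Finset.sum_congr rfl fun i hi => ?_
    rw [h0 i hi, h1 i hi]; ring
  have hY1 : ∀ n m, Y (n + 1) m = B (n + 2) m + β (n + 1) * B (n + 1) m + u (n + 1) * B n m :=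
    fun n m => by
      simp only [hY, hB, Finset.mul_sum, ← Finset.sum_add_distrib]
      refine Finset.sum_congr rfl fun i hi => ?_
      rw [hrec n i hi]; ring
  have hBsymm : ∀ n m, B n m = B m n := fun n m => Finset.sum_congr rfl fun i _ => by ring
  have hlast : ∀ n, B n (N + 1) = 0 := fun n =>
    Finset.sum_eq_zero fun i hi => by rw [hN i hi, mul_zero]
  set H : ℕ → ℝ := fun n => ∏ k ∈ Finset.Icc 1 n, u k with hH
  have hH1 : ∀ n, H (n + 1) = H n * u (n + 1) := fun n => Finset.prod_Icc_succ_top (by omega) _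
  have hH0 : H 0 = 1 := by simp [hH]
  have hB0 : ∀ m ≤ N + 1, B 0 m = if 0 = m then H 0 else 0 := fun m hm => by
    rw [hH0, if_congr (eq_comm : 0 = m ↔ m = 0) rfl rfl, ← hw m hm]
    exact Finset.sum_congr rfl fun i hi => by rw [h0 i hi, mul_one]
  -- Row n + 1 follows from the earlier rows by expanding ∑ w x p_n p_m with the recurrence in n and
  -- in m. The column m = N + 1 is zero by `hlast`; for m ≤ N the index m + 1 stays in range.
  have main : ∀ n, (n ≤ N → ∀ m ≤ N + 1, B n m = if n = m then H n else 0) := by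
    intro n
    induction n using Nat.strong_induction_on with
    | _ n ih =>
      intro hn m hm
      rcases n with _ | n
      · exact hB0 m hm
      · rcases hm.eq_or_lt with rfl | hm
        · rw [hlast, if_neg (by omega)]
        · have hA : ∀ k ≤ N + 1, B n k = if n = k then H n else 0 := ih n (by omega) (by omega)
          have hL : Y n m = B (n + 1) m + β n * B n m +
              if n = m + 1 then H n else 0 := by
            rcases n with _ | n
            · rw [hY0, if_neg (by omega), add_zero]
            · rw [hY1, ih n (by omega) (by omega) m hm.le]
              congr 1
              by_cases h : n = m
              · rw [if_pos h, if_pos (by omega), hH1, mul_comm]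
              · rw [if_neg h, if_neg (by omega), mul_zero]
          have hR : Y m n = (if n = m + 1 then H n else 0) + β m * (if n = m then H n else 0) +
              if n + 1 = m then H (n + 1) else 0 := by
            rcases m with _ | m
            · rw [hY0, hBsymm 1, hBsymm 0, hA _ (by omega), hA _ (by omega),
                if_neg (show n + 1 ≠ 0 by omega), add_zero]
            · rw [hY1, hBsymm (m + 2), hBsymm (m + 1), hBsymm m, hA _ (by omega), hA _ (by omega),
                hA _ (by omega)]
              congr 1
              by_cases h : n = m
              · rw [if_pos h, if_pos (by omega), hH1, h, mul_comm]
              · rw [if_neg h, if_neg (by omega), mul_zero]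
          rw [hsymm, hR, hA m hm.le] at hL
          by_cases h : n = m
          · subst h
            rw [if_pos rfl, if_neg (by omega), if_neg (by omega)] at hL
            rw [if_neg (by omega)]
            linarith
          · rw [if_neg h] at hL
            linarith
  exact main n hn m hm

theorem sum_weight_mul_paraBI
    (hS : (a < -(2 * M + 1 : ℕ) ∧ |b| < 1) ∨ (|a| < 1 ∧ b < -(2 * M + 1 : ℕ)))
    (h0 : 0 ≤ α) (h1 : α ≤ 1) {n m : ℕ} (hn : n ≤ 2 * (2 * M + 1)) (hm : m ≤ 2 * (2 * M + 1)) :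
    ∑ i ∈ Finset.range (2 * (2 * M + 1) + 1), weight (2 * M + 1) a b α i *
        (paraBI (2 * M + 1) a b α n).eval (grid (2 * M + 1) a b i) *
        (paraBI (2 * M + 1) a b α m).eval (grid (2 * M + 1) a b i) =
      if n = m then norm (2 * M + 1) a b α n ^ 2 else 0 := by
  have hsq : norm (2 * M + 1) a b α n ^ 2 =
      ∏ k ∈ Finset.Icc 1 n, coefU (2 * M + 1) a b α k := by
    rw [norm_eq_sqrt hS hn, Real.sq_sqrt]
    refine Finset.prod_nonneg fun i hi => ?_
    have hi := Finset.mem_Icc.1 hi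
    refine coefU_nonneg ?_ h0 h1 hi.1 (hi.2.trans hn)
    exact hS.imp (fun h => ⟨h.1.le, h.2.le⟩) (fun h => ⟨h.1.le, h.2.le⟩)
  rw [hsq, show 2 * (2 * M + 1) + 1 = 4 * M + 3 by ring]
  refine orthogonal_of_recurrence (Finset.range (4 * M + 3)) (weight (2 * M + 1) a b α)
    (fun n i => (paraBI (2 * M + 1) a b α n).eval (grid (2 * M + 1) a b i)) (grid (2 * M + 1) a b)
    (fun n => rho1 (2 * M + 1) a b - coefA (2 * M + 1) a b α n - coefC (2 * M + 1) a b α n)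
    (coefU (2 * M + 1) a b α) (N := 4 * M + 2) ?_ ?_ ?_ ?_ ?_ (by omega) (by omega)
  · intro i _; simp [paraBI]
  · intro i _; simp [paraBI]
  · intro n i _
    rw [eval_paraBI_succ_succ, coefU, Nat.add_sub_cancel]
  · exact fun i hi => eval_paraBI_last (isMirrorPoint_grid (Finset.mem_range.1 hi))
  · exact fun n hn => sum_weight_paraBI hS hn

end Orthogonality

end ParaBI

/-! ### Assembly of the statements, with j = 2M + 1 -/

theorem mainTheorem11 (j : ℕ) (hj : Odd j) (a b α : ℝ) :
    -- truncation of the complementary Bannai-Ito polynomials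
    (∀ e₁ e₂ : ℝ, e₁ + e₂ ≠ 0 → e₁ / (e₁ + e₂) = α →
      (∀ n : ℕ,
        Tendsto (fun t => ParaBI.cbiA n (ParaBI.rho1 j a b) (ParaBI.rho2 j a b e₁ t)
            (ParaBI.r1 j a b) (ParaBI.r2 j a b e₂ t)) (𝓝[≠] 0) (𝓝 (ParaBI.coefA j a b α n)) ∧
        Tendsto (fun t => ParaBI.cbiC n (ParaBI.rho1 j a b) (ParaBI.rho2 j a b e₁ t)
            (ParaBI.r1 j a b) (ParaBI.r2 j a b e₂ t)) (𝓝[≠] 0) (𝓝 (ParaBI.coefC j a b α n))) ∧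
      (α ≠ 0 → ∀ n ≤ 2 * j, ∀ x : ℝ,
        Tendsto (fun t => (ParaBI.cbi n (ParaBI.rho1 j a b) (ParaBI.rho2 j a b e₁ t)
            (ParaBI.r1 j a b) (ParaBI.r2 j a b e₂ t)).eval x) (𝓝[≠] 0)
          (𝓝 ((ParaBI.paraBI j a b α n).eval x)))) ∧
    -- recurrence relation and its truncation
    (∀ n : ℕ, (ParaBI.paraBI j a b α n).Monic ∧ (ParaBI.paraBI j a b α n).natDegree = n) ∧
    (X * ParaBI.paraBI j a b α 0 = ParaBI.paraBI j a b α 1 +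
      C ((b - j - 1 + a) / 4 - ParaBI.coefA j a b α 0 - ParaBI.coefC j a b α 0) *
        ParaBI.paraBI j a b α 0) ∧
    (∀ n : ℕ, 1 ≤ n →
      X * ParaBI.paraBI j a b α n = ParaBI.paraBI j a b α (n + 1) +
        C ((b - j - 1 + a) / 4 - ParaBI.coefA j a b α n - ParaBI.coefC j a b α n) *
          ParaBI.paraBI j a b α n +
        C (ParaBI.coefA j a b α (n - 1) * ParaBI.coefC j a b α n) *
          ParaBI.paraBI j a b α (n - 1)) ∧
    ParaBI.coefU j a b α (2 * j + 1) = 0 ∧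
    -- positivity conditions
    (((a ≤ -j ∧ |b| ≤ 1) ∨ (|a| ≤ 1 ∧ b ≤ -j)) ∧ 0 ≤ α ∧ α ≤ 1 →
      ∀ n ∈ Finset.Icc 1 (2 * j), 0 ≤ ParaBI.coefU j a b α n) ∧
    (((a < -j ∧ |b| < 1) ∨ (|a| < 1 ∧ b < -j)) ∧ 0 < α ∧ α < 1 →
      ∀ n ∈ Finset.Icc 1 (2 * j), 0 < ParaBI.coefU j a b α n) ∧
    (3 ≤ j → (∀ n ∈ Finset.Icc 1 (2 * j), 0 < ParaBI.coefU j a b α n) →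
      ((a < -j ∧ |b| < 1) ∨ (|a| < 1 ∧ b < -j)) ∧ 0 < α ∧ α < 1) ∧
    -- Dunkl-difference equation
    (∀ β : ℝ, ∀ n ≤ 2 * j, ∀ x : ℝ, x ≠ 0 → x ≠ -1 → x ≠ 1 / 2 → x ≠ -1 / 2 →
      ParaBI.dunkl j a b β (fun y => (ParaBI.paraBI j a b α n).eval y) x =
        ParaBI.dunklEigenvalue j β n * (ParaBI.paraBI j a b α n).eval x) ∧
    -- explicit expression
    (α ≠ 0 → (∀ i < j, -(j + a) / 2 + i ≠ 0 ∧ -(j + b) / 2 + i ≠ 0) →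
      (∀ n ≤ j, ∀ x : ℝ, (ParaBI.paraBI j a b α (2 * n)).eval x =
        ParaBI.kappa1 j a b α n * ∑ k ∈ Finset.range (n + 1), ParaBI.sumA j a b α n k x) ∧
      (∀ n < j, n ≠ (j - 1) / 2 → ∀ x : ℝ, (ParaBI.paraBI j a b α (2 * n + 1)).eval x =
        ParaBI.kappa2 j a b α n * (x + (b + j + 1 + a) / 4) *
          ∑ k ∈ Finset.range (n + 1), ParaBI.sumB j a b α n k x)) ∧
    (∀ x : ℝ, (ParaBI.paraBI j a b α j).eval x =
      (-1) ^ ((j - 1) / 2) * (x + (b + j + 1 + a) / 4) *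
        ParaBI.poch (-(b + j - 3 + a) / 4 + x) ((j - 1) / 2) *
        ParaBI.poch (-(b + j - 3 + a) / 4 - x) ((j - 1) / 2)) ∧
    -- orthogonality relation
    (((a < -j ∧ |b| < 1) ∨ (|a| < 1 ∧ b < -j)) ∧ 0 ≤ α ∧ α ≤ 1 →
      (∀ n ≤ 2 * j, ParaBI.norm j a b α n =
        Real.sqrt (∏ i ∈ Finset.Icc 1 n, ParaBI.coefU j a b α i)) ∧
      (∀ n ≤ 2 * j, ∀ m ≤ 2 * j,
        ∑ i ∈ Finset.range (2 * j + 1), ParaBI.weight j a b α i *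
            (ParaBI.paraBI j a b α n).eval (ParaBI.grid j a b i) *
            (ParaBI.paraBI j a b α m).eval (ParaBI.grid j a b i) =
          if n = m then ParaBI.norm j a b α n ^ 2 else 0)) := by
  obtain ⟨M, rfl⟩ := hj
  have hj : Odd (2 * M + 1) := odd_two_mul_add_one M
  have eM : (2 * M + 1 - 1) / 2 = M := by omega
  have eq : -(b + (2 * M + 1 : ℕ) - 3 + a) / 4 = -(a + b + (2 * M + 1 : ℕ) + 1) / 4 + 1 := by ring
  refine ⟨fun e₁ e₂ he hα => ⟨fun n => ⟨ParaBI.tendsto_cbiA hj he hα n,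
      ParaBI.tendsto_cbiC hj he hα n⟩, fun hα0 n _ x => ParaBI.tendsto_cbi hj he hα hα0 n x⟩,
    ParaBI.paraBI_monic_natDegree _ a b α, ?_, fun n hn => ?_, ParaBI.coefU_truncation _ a b α,
    fun h n hn => ParaBI.coefU_nonneg h.1 h.2.1 h.2.2 (Finset.mem_Icc.1 hn).1
      (Finset.mem_Icc.1 hn).2,
    fun h n hn => ParaBI.coefU_pos h.1 h.2.1 h.2.2 (Finset.mem_Icc.1 hn).1 (Finset.mem_Icc.1 hn).2,
    ParaBI.positivity_converse,
    fun β n hn x hx hx0 hx2 hx1 => ParaBI.dunkl_paraBI M a b α β hn hx hx0 hx2 hx1,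
    fun hα hab => ⟨fun n hn x => ?_, fun n hn hnM x => ?_⟩, fun x => ?_,
    fun h => ⟨fun n hn => ParaBI.norm_eq_sqrt h.1 hn, fun n hn m hm =>
      ParaBI.sum_weight_mul_paraBI h.1 h.2.1 h.2.2 hn hm⟩⟩
  · simp only [ParaBI.paraBI, ParaBI.rho1]
    ring
  · obtain ⟨n, rfl⟩ : ∃ m, n = m + 1 := ⟨n - 1, by omega⟩
    rw [Nat.add_sub_cancel, ParaBI.paraBI, ParaBI.rho1]
    ring
  · rw [ParaBI.eval_paraBI_even M a b α hn, Finset.mul_sum]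
    refine Finset.sum_congr rfl fun k hk => ?_
    rw [ParaBI.kappa1_mul_sumA hα hab hn (by simpa [Nat.lt_succ_iff] using hk)]
  · rw [eM] at hnM
    rw [ParaBI.eval_paraBI_odd M a b α hn.le, mul_right_comm, mul_comm, Finset.mul_sum]
    congr 1
    · refine Finset.sum_congr rfl fun k hk => ?_
      rw [ParaBI.kappa2_mul_sumB hα hab hn hnM (by simpa [Nat.lt_succ_iff] using hk)]
    · ring
  · rw [ParaBI.eval_paraBI_middle, eM, eq, ParaBI.newtonBasis_eq_poch]
    ring
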